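/- Let $P$ be a simplicial poset, i.e. a finite poset with a least element $\hat 0$ such that every interval $[\hat 0,y]$ is a Boolean lattice, and let $x_1,\dots,x_n$ be its atoms. For $y\in P$ put $\operatorname{supp}(y)=\{i: x_i\preceq y\}$ and $\operatorname{lk}_P(y)=\{w\in P: y\preceq w\}$ (a simplicial poset with least element $y$); for $\alpha\in\mathbb Z^n$ put $\operatorname{supp}(\alpha)=\{i:\alpha_i\neq 0\}$. Let $\Bbbk$ be a field, $A=\Bbbk[x_1,\dots,x_n]$ and $\mathfrak m=(x_1,\dots,x_n)$. For $w,y\in P$ let $\mathcal M(w,y)$ be the set of minimal upper bounds of $w$ and $y$. The face ring $A_P$ is the quotient of the polynomial ring $\Bbbk[y:y\in P]$ by the ideal generated by $\hat 0-1$, by $wy$ for all $w,y$ with $\mathcal M(w,y)=\emptyset$, and by $wy-(w\wedge y)\sum_{z\in\mathcal M(w,y)}z$ for all $w,y$ with $\mathcal M(w,y)\ne\emptyset$. With $\deg(y)=\sum_{i\in\operatorname{supp}(y)}\mathbf e_i$ it is a $\mathbb Z^n$-graded $A$-module, and so its local cohomology modules $H^i_{\mathfrak m}(A_P)=\varinjlim_t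 \operatorname{Ext}^i_A(A/\mathfrak m^t,A_P)$, $i\ge 0$, are $\mathbb Z^n$-graded. For a simplicial poset $Q$, let $\widetilde H^d(Q)$, $d\in\mathbb Z$, be the cohomology over $\Bbbk$ of the cochain complex $\widetilde C^\bullet(Q)$, where $\widetilde C^d(Q)$ has as a basis the elements of $Q$ of rank $d+1$ and $$\delta(y)=\sum_{a\not\preceq y}(-1)^{\#\{b\preceq y\,:\,a<b\}}\sum_{z\in\mathcal M(a,y)}z ,$$ with $a,b$ ranging over atoms of $Q$ and $<$ any partial order of the atoms that is total on the set of atoms below each element of $Q$. Then, for every $i\ge 0$ and every $\alpha\in\mathbb Z^n$ with $\alpha_j\le 0$ for all $j$, there is an isomorphism of $\Bbbk$-vector spaces $$H^i_{\mathfrak m}(A_P)_\alpha\;\cong\bigoplus_{\substack{w\in P\\ \operatorname{supp}(w)=\operatorname{supp}(\alpha)}}\widetilde H^{\,i-|\operatorname{supp}(\alpha)|-1}\bigl(\operatorname{lk}_P(w)\bigr),$$ and $H^i_{\mathfrak m}(A_P)_\alpha=0$ if $\alpha_j>0$ for some $j$. -/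

import Mathlib

open CategoryTheory Opposite
open scoped DirectSum

universe u

noncomputable section

namespace SimplicialPoset

/-! ### Simplicial posets -/

/-- A finite poset with least element `⊥` is simplicial if every interval `[⊥, y]` is a Boolean
lattice, i.e. isomorphic to the lattice of subsets of a finite set. -/
def IsSimplicial (P : Type*) [PartialOrder P] [OrderBot P] [Finite P] : Prop :=
  ∀ y : P, ∃ m : ℕ, Nonempty (Set.Icc (⊥ : P) y ≃o Finset (Fin m))

/-- The vertices (atoms) of `P`. -/
abbrev Vertex (P : Type*) [PartialOrder P] [OrderBot P] : Type _ := {a : P // IsAtom a}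

/-- The rank of `y`: the maximal length of a chain from `⊥` to `y`. -/
def rk {P : Type*} [PartialOrder P] (y : P) : ℕ := (Order.height y).toNat

/-- The link of `y`: the poset of all elements above `y`. -/
abbrev Link {P : Type*} [PartialOrder P] (y : P) : Type _ := ↥(Set.Ici y)

/-- The set of minimal upper bounds of `w` and `y`. -/
def minUpperBounds {P : Type*} [PartialOrder P] [Finite P] (w y : P) : Finset P :=
  (Set.toFinite {z : P | Minimal (fun b => w ≤ b ∧ y ≤ b) z}).toFinset

/-- The support of a face, with respect to a labelling `x` of the vertices. -/
def supp {P : Type*} [PartialOrder P] [OrderBot P] {n : ℕ} (x : Fin n ≃ Vertex P) (y : P) :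
    Finset (Fin n) :=
  (Set.toFinite {j : Fin n | (x j : P) ≤ y}).toFinset

/-- The support of a degree. -/
def degSupp {n : ℕ} (α : Fin n → ℤ) : Finset (Fin n) := Finset.univ.filter fun j => α j ≠ 0

/-! ### Reduced cohomology -/

/-- An orientation: a (strict) partial order on the vertices that is total on the vertex set of
each face. -/
structure VertexOrientation (Q : Type*) [PartialOrder Q] [OrderBot Q] where
  lt : Vertex Q → Vertex Q → Prop
  irrefl : ∀ a, ¬ lt a a
  trans : ∀ a b c, lt a b → lt b c → lt a c
  total : ∀ (y : Q) (a b : Vertex Q), (a : Q) ≤ y → (b : Q) ≤ y → a ≠ b → lt a b ∨ lt b a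

section Cohomology

variable (k : Type u) [Field k] {Q : Type u} [PartialOrder Q] [OrderBot Q] [Finite Q]

/-- The coboundary operator, on the vector space `Q → k` whose standard basis is identified with the
set of faces: `δ y = ∑ₐ (-1)^{#{b ≤ y : a < b}} ∑_{z ∈ M(a, y)} z`, where `a` runs over the vertices
not in `y` and `b` over the vertices in `y`. -/
def coboundary (O : VertexOrientation Q) : (Q → k) →ₗ[k] (Q → k) :=
  (Pi.basisFun k Q).constr k fun y : Q =>
    ∑ a ∈ (Set.toFinite {a : Vertex Q | ¬ (a : Q) ≤ y}).toFinset,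
      (-1 : k) ^ Set.ncard {b : Vertex Q | (b : Q) ≤ y ∧ O.lt a b} •
        ∑ z ∈ minUpperBounds (a : Q) y, Pi.basisFun k Q z

variable (Q) in
/-- The reduced `d`-cochains: the span of the faces of rank `d + 1`. -/
def cochains (d : ℤ) : Submodule k (Q → k) :=
  Submodule.span k (Pi.basisFun k Q '' {y : Q | (rk y : ℤ) = d + 1})

/-- The `d`-cocycles. -/
def cocycles (O : VertexOrientation Q) (d : ℤ) : Submodule k (Q → k) :=
  cochains k Q d ⊓ LinearMap.ker (coboundary k O)

/-- The `d`-coboundaries. -/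
def coboundaries (O : VertexOrientation Q) (d : ℤ) : Submodule k (Q → k) :=
  (cochains k Q (d - 1)).map (coboundary k O)

/-- The reduced cohomology of `Q` in degree `d`: cocycles modulo coboundaries. -/
abbrev ReducedCohomology (O : VertexOrientation Q) (d : ℤ) : Type u :=
  ↥(cocycles k O d) ⧸ (coboundaries k O d).submoduleOf (cocycles k O d)

end Cohomology

/-! ### The face ring -/

section FaceRing

variable (k : Type u) [Field k] (P : Type u) [PartialOrder P] [OrderBot P] [Finite P]

/-- The ideal of relations of the face ring.  If `w` and `y` have an upper bound in a simplicial
poset, then they have a (unique) greatest lower bound `m`. -/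
def faceIdeal : Ideal (MvPolynomial P k) :=
  Ideal.span
    ({p | ∃ w y : P, minUpperBounds w y = ∅ ∧ p = MvPolynomial.X w * MvPolynomial.X y} ∪
     {p | ∃ w y m : P, (minUpperBounds w y).Nonempty ∧ IsGLB {w, y} m ∧
        p = MvPolynomial.X w * MvPolynomial.X y -
          MvPolynomial.X m * ∑ z ∈ minUpperBounds w y, MvPolynomial.X z} ∪
     {MvPolynomial.X (⊥ : P) - 1})

/-- The face ring `A_P = k[P] / I_P`. -/
abbrev FaceRing : Type u := MvPolynomial P k ⧸ faceIdeal k P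

variable {P} {n : ℕ} (x : Fin n ≃ Vertex P)

/-- The `k`-algebra map `k[x₁, …, xₙ] → A_P` sending each variable to the corresponding vertex. -/
def structureMap : MvPolynomial (Fin n) k →ₐ[k] FaceRing k P :=
  MvPolynomial.aeval fun j => Ideal.Quotient.mk (faceIdeal k P) (MvPolynomial.X (x j : P))

/-- The face ring, regarded as a module over `k[x₁, …, xₙ]`. -/
def FaceModule (_x : Fin n ≃ Vertex P) : Type u := FaceRing k P

instance : AddCommGroup (FaceModule k x) := inferInstanceAs (AddCommGroup (FaceRing k P))

instance : Module (MvPolynomial (Fin n) k) (FaceModule k x) :=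
  Module.compHom (FaceRing k P) (structureMap k x).toRingHom

open Classical in
/-- The degree in `ℤⁿ` of a face `y`: the sum of the basis vectors `eⱼ` with `xⱼ ≤ y`. -/
def faceDegree (y : P) : Fin n → ℤ := fun j => if (x j : P) ≤ y then 1 else 0

/-- The degree `β` piece of the face ring. -/
def faceGrading (β : Fin n → ℤ) : AddSubgroup (FaceModule k x) :=
  (MvPolynomial.weightedHomogeneousSubmodule k (faceDegree x) β).toAddSubgroup.map
    (Ideal.Quotient.mk (faceIdeal k P)).toAddMonoidHom

end FaceRing

/-! ### `ℤⁿ`-graded modules over `k[x₁, …, xₙ]` and the grading on local cohomology -/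

section Graded

variable {k : Type u} [Field k] {n : ℕ}

/-- The family `ℳ` makes `M` a `ℤⁿ`-graded module over `k[x₁, …, xₙ]`, with `deg xⱼ = eⱼ`. -/
structure IsMultigrading {M : Type u} [AddCommGroup M] [Module (MvPolynomial (Fin n) k) M]
    (ℳ : (Fin n → ℤ) → AddSubgroup M) : Prop where
  isInternal : DirectSum.IsInternal ℳ
  C_smul_mem : ∀ (c : k) (β : Fin n → ℤ), ∀ v ∈ ℳ β,
    (MvPolynomial.C c : MvPolynomial (Fin n) k) • v ∈ ℳ β
  X_smul_mem : ∀ (j : Fin n) (β : Fin n → ℤ), ∀ v ∈ ℳ β,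
    (MvPolynomial.X j : MvPolynomial (Fin n) k) • v ∈ ℳ (β + Pi.single j 1)

variable (k n) in
/-- The irrelevant ideal `(x₁, …, xₙ)`. -/
def irrelevantIdeal : Ideal (MvPolynomial (Fin n) k) := Ideal.span (Set.range MvPolynomial.X)

/-- The degree `β` piece of `k[x₁, …, xₙ] / J`, for a homogeneous ideal `J`. -/
def quotientGrading (J : Ideal (MvPolynomial (Fin n) k)) (β : Fin n → ℤ) :
    AddSubgroup (MvPolynomial (Fin n) k ⧸ J) :=
  (MvPolynomial.weightedHomogeneousSubmodule k
    (fun j : Fin n => (Pi.single j 1 : Fin n → ℤ)) β).toAddSubgroup.map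
    (Ideal.Quotient.mk J).toAddMonoidHom

/-- A projective resolution of `k[x₁, …, xₙ] / J` by `ℤⁿ`-graded modules, in which the differentials
and the augmentation preserve degrees. -/
structure GradedResolution (J : Ideal (MvPolynomial (Fin n) k)) where
  res : ProjectiveResolution
    (ModuleCat.of (MvPolynomial (Fin n) k) (MvPolynomial (Fin n) k ⧸ J))
  gr : ∀ j : ℕ, (Fin n → ℤ) → AddSubgroup (res.complex.X j)
  isMultigrading : ∀ j, IsMultigrading (k := k) (gr j)
  d_mem : ∀ (j : ℕ) (β : Fin n → ℤ), ∀ q ∈ gr (j + 1) β, res.complex.d (j + 1) j q ∈ gr j β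
  π_mem : ∀ (β : Fin n → ℤ), ∀ q ∈ gr 0 β,
    (res.π.f 0 q : MvPolynomial (Fin n) k ⧸ J) ∈ quotientGrading J β

variable (M : Type u) [AddCommGroup M] [Module (MvPolynomial (Fin n) k) M]
  (ℳ : (Fin n → ℤ) → AddSubgroup M)

/-- The class `e ∈ Extⁱ(A/J, M)` is homogeneous of degree `α`: it is represented by a cocycle
`f : Fᵢ → M` with `f((Fᵢ)_β) ⊆ M_{β + α}` for all `β`, where `F` is a graded projective resolution
of `A/J`.  (The existence of such an `f` does not depend on the choice of `F`.) -/
def IsHomogeneousExt (J : Ideal (MvPolynomial (Fin n) k)) (i : ℕ) (α : Fin n → ℤ)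
    (e : ((Ext (MvPolynomial (Fin n) k) (ModuleCat.{u} (MvPolynomial (Fin n) k)) i).obj
      (op (ModuleCat.of _ (MvPolynomial (Fin n) k ⧸ J)))).obj (ModuleCat.of _ M)) : Prop :=
  ∃ (F : GradedResolution J) (f : F.res.complex.X i ⟶ ModuleCat.of _ M)
    (z : (F.res.complex.linearYonedaObj (MvPolynomial (Fin n) k) (ModuleCat.of _ M)).cycles i),
    (∀ (β : Fin n → ℤ), ∀ q ∈ F.gr i β, f q ∈ ℳ (β + α)) ∧
    (F.res.complex.linearYonedaObj (MvPolynomial (Fin n) k) (ModuleCat.of _ M)).iCycles i z = f ∧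
    (F.res.isoExt i (ModuleCat.of _ M)).hom e =
      (F.res.complex.linearYonedaObj (MvPolynomial (Fin n) k) (ModuleCat.of _ M)).homologyπ i z

/-- The local cohomology module `Hⁱ_𝔪(M)`, the direct limit of `Extⁱ(A/𝔪ᵗ, M)`. -/
abbrev LocalCohomology (i : ℕ) : Type u :=
  (localCohomology (irrelevantIdeal k n) i).obj (ModuleCat.of (MvPolynomial (Fin n) k) M)

/-- The canonical map `Extⁱ(A/J, M) → Extⁱ(A/𝔪ᵗ, M) → Hⁱ_𝔪(M)` for an ideal `J ⊇ 𝔪ᵗ`, induced by the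
projection `A/𝔪ᵗ → A/J`. -/
def extToLocalCohomology (J : Ideal (MvPolynomial (Fin n) k)) (i t : ℕ)
    (hJ : irrelevantIdeal k n ^ t ≤ J) :
    ((Ext (MvPolynomial (Fin n) k) (ModuleCat.{u} (MvPolynomial (Fin n) k)) i).obj
      (op (ModuleCat.of _ (MvPolynomial (Fin n) k ⧸ J)))).obj (ModuleCat.of _ M) ⟶
    (localCohomology (irrelevantIdeal k n) i).obj (ModuleCat.of (MvPolynomial (Fin n) k) M) :=
  ((Ext (MvPolynomial (Fin n) k) (ModuleCat.{u} (MvPolynomial (Fin n) k)) i).map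
    (ModuleCat.ofHom (Submodule.mapQ (irrelevantIdeal k n ^ t) J LinearMap.id hJ)).op).app
      (ModuleCat.of _ M) ≫
  (Limits.colimit.ι
    (localCohomology.diagram (localCohomology.idealPowersDiagram (irrelevantIdeal k n)) i)
    (op (op t))).app (ModuleCat.of _ M)

variable (k) in
/-- The degree `α` piece `Hⁱ_𝔪(M)_α`, a `k`-subspace of `Hⁱ_𝔪(M)`: it consists of the images of the
homogeneous classes of degree `α` in the modules `Extⁱ(A/J, M)`, where `J` is a `ℤⁿ`-homogeneous
ideal containing a power of `𝔪` (such as `𝔪ᵗ` itself, or the ideal generated by the `t`-th powers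
of the variables). -/
def localCohomologyPiece (i : ℕ) (α : Fin n → ℤ) :
    Submodule k (RestrictScalars k (MvPolynomial (Fin n) k)
      (LocalCohomology (k := k) (n := n) M i)) :=
  Submodule.span k {h | ∃ (J : Ideal (MvPolynomial (Fin n) k)) (t : ℕ)
    (hJ : irrelevantIdeal k n ^ t ≤ J) (e : _),
    IsMultigrading (k := k) (quotientGrading J) ∧
    IsHomogeneousExt M ℳ J i α e ∧
    h = (RestrictScalars.addEquiv k (MvPolynomial (Fin n) k) _).symm
      (extToLocalCohomology M J i t hJ e)}

end Graded

end SimplicialPoset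

end

/-! Write `M` for the face ring, `F` for the support of `α`, and `1_σ` for the indicator vector of a
set `σ` of labels.

Local cohomology is the limit over `s` of the Koszul cohomology of `x₁ˢ, …, xₙˢ` with values in `M`.
A Koszul cochain of degree `α` is a family `c_σ ∈ M_{α + s·1_σ}`, and passing from `s` to `t`
multiplies `c_σ` by `∏_{l ∈ σ} x_l^{t-s}`. The degree `α` piece in the statement allows arbitrary
homogeneous ideals and graded resolutions; `exists_gradedLift` compares each of them with a Koszul
resolution by a degree-preserving chain map.

The face ring has a basis of standard monomials `x^m · y` with `supp m ⊆ supp y`. They span by the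
straightening rule `faceElt_mul`, and they are independent because restriction to the faces recovers
the coefficients (`faceCoeff_standardElt`). Hence `M_β` vanishes unless `β ≥ 0`, and then it has a
basis indexed by the faces with support `supp β`. In particular multiplication by `x_l` is a
bijection `M_β → M_{β + e_l}` as soon as `β_l ≥ 1` (`monomial_smul_bijOn`).

Choose `s` with `α_j + s ≥ 1` for all `j`. Then the transition maps are bijective in degree `α`, so
the single complex for this `s` computes `Hⁱ_𝔪(M)_α` (`mem_localCohomologyPiece_iff`,
`koszulClass_eq_zero_iff`). If some `α_j > 0`, this complex is the cone of the bijection `x_jˢ`,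
hence acyclic (`exists_koszulδ_eq_of_bijOn`).

If `α ≤ 0`, only the `σ ⊇ F` contribute, and `σ` contributes the faces of support `σ`. So the
complex has as basis the faces `y` with `F ⊆ supp y`. Each of them lies above exactly one `w` with
`supp w = F`, and the differential leads from `y` to larger faces, which stay above `w`. The complex
is therefore the direct sum of the cochain complexes of the links, shifted by `|F| + 1`; the sign
`linkSign` reconciles the order of the labels with the chosen orientations (`glue_coboundary`). -/

noncomputable section

namespace SimplicialPoset

open Limits

/-! ### Ext classes represented by explicit cocycles. -/

section ExtClass
variable {R : Type u} [CommRing R] {X Y : ModuleCat.{u} R}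

/-- The map of complexes of homomorphisms into `N` given by precomposition with a chain map. -/
def linearYonedaMap {K L : ChainComplex (ModuleCat.{u} R) ℕ} (φ : K ⟶ L) (N : ModuleCat.{u} R) :
    L.linearYonedaObj R N ⟶ K.linearYonedaObj R N :=
  (HomologicalComplex.unopFunctor _ _).map
    ((((linearYoneda R (ModuleCat.{u} R)).obj N).rightOp.mapHomologicalComplex _).map φ).op

/-- Pure diagram pasting: `isoExt` is a composite of two isomorphisms, and `h₁`, `h₂` are the
naturality squares of its two factors. -/
lemma comp_inv_eq_of_comm {C : Type*} [Category C] {E E' L L' H H' : C} {a : E ⟶ E'}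
    {p : E' ⟶ L'} {q : E ⟶ L} {c : L ⟶ L'} {s : H ≅ L} {s' : H' ≅ L'} {m : H ⟶ H'}
    (h₁ : a ≫ p = q ≫ c) (h₂ : s.hom ≫ c = m ≫ s'.hom) :
    a ≫ p ≫ s'.inv = (q ≫ s.inv) ≫ m := by
  rw [reassoc_of% h₁, Category.assoc, ← cancel_mono s'.hom]
  simp [← h₂]

/-- `Ext` is built from a left derived functor with values in an opposite category, so both
naturality squares (of the derived functor and of homology under `op`) are transported by `unop`. -/
lemma isoExt_hom_naturality (f : X ⟶ Y) (P : ProjectiveResolution X) (Q : ProjectiveResolution Y)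
    (φ : P.complex ⟶ Q.complex) (comm : φ.f 0 ≫ Q.π.f 0 = P.π.f 0 ≫ f) (N : ModuleCat.{u} R)
    (i : ℕ) :
    ((Ext R (ModuleCat.{u} R) i).map f.op).app N ≫ (P.isoExt (R := R) i N).hom =
      (Q.isoExt (R := R) i N).hom ≫ HomologicalComplex.homologyMap (linearYonedaMap φ N) i :=
  comp_inv_eq_of_comm (congrArg Quiver.Hom.unop
    (ProjectiveResolution.isoLeftDerivedObj_inv_naturality f P Q φ comm
      ((linearYoneda R (ModuleCat.{u} R)).obj N).rightOp i))
    (s := ((Q.complex.linearYonedaObj R N).homologyOp i).unop)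
    (s' := ((P.complex.linearYonedaObj R N).homologyOp i).unop)
    (congrArg Quiver.Hom.unop
      (HomologicalComplex.homologyOp_hom_naturality (linearYonedaMap φ N) i))

lemma next_up (i : ℕ) : (ComplexShape.up ℕ).next i = i + 1 := CochainComplex.next ℕ i

/-- This includes `i = 0`, where `prev` takes its default value `0`, which is also the truncated `0
- 1`. The boundary criterion below is thereby uniform in `i`: the differential from `0` to `0` is
zero. -/
lemma prev_up (i : ℕ) : (ComplexShape.up ℕ).prev i = i - 1 := by
  cases i with
  | zero => simp
  | succ i => simp

/-- The map from cocycles to cohomology. -/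
def homologyClass (K : CochainComplex (ModuleCat.{u} R) ℕ) (i : ℕ) :
    LinearMap.ker (K.d i (i + 1)).hom →ₗ[R] K.homology i :=
  (K.liftCycles (ModuleCat.ofHom (LinearMap.ker (K.d i (i + 1)).hom).subtype) (i + 1) (next_up i)
    (by ext f; exact f.2) ≫ K.homologyπ i).hom

lemma exists_cycles (K : CochainComplex (ModuleCat.{u} R) ℕ) (i : ℕ)
    (f : LinearMap.ker (K.d i (i + 1)).hom) :
    ∃ z : K.cycles i, K.iCycles i z = f.1 ∧ K.homologyπ i z = homologyClass K i f :=
  ⟨K.liftCycles (ModuleCat.ofHom (LinearMap.ker (K.d i (i + 1)).hom).subtype) (i + 1) (next_up i)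
    (by ext f; exact f.2) f, by
    rw [← ModuleCat.comp_apply, HomologicalComplex.liftCycles_i]; rfl, rfl⟩

lemma iCycles_injective (K : CochainComplex (ModuleCat.{u} R) ℕ) (i : ℕ) :
    Function.Injective (K.iCycles i) :=
  (ModuleCat.mono_iff_injective (K.iCycles i)).1 inferInstance

/-- Converts the formulation with abstract `cycles`, used in the definition of homogeneous classes,
into honest elements of a kernel. -/
lemma eq_homologyClass_iff (K : CochainComplex (ModuleCat.{u} R) ℕ) (i : ℕ) (f : K.X i)
    (e : K.homology i) :
    (∃ z : K.cycles i, K.iCycles i z = f ∧ e = K.homologyπ i z) ↔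
      ∃ hf : f ∈ LinearMap.ker (K.d i (i + 1)).hom, e = homologyClass K i ⟨f, hf⟩ := by
  constructor
  · rintro ⟨z, rfl, rfl⟩
    have hf : K.iCycles i z ∈ LinearMap.ker (K.d i (i + 1)).hom := by
      change (K.d i (i + 1)) (K.iCycles i z) = 0
      rw [← ModuleCat.comp_apply, HomologicalComplex.iCycles_d]
      rfl
    obtain ⟨z', hz', h⟩ := exists_cycles K i ⟨_, hf⟩
    exact ⟨hf, by rw [← h, iCycles_injective K i hz']⟩
  · rintro ⟨hf, rfl⟩
    obtain ⟨z', hz', h⟩ := exists_cycles K i ⟨_, hf⟩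
    exact ⟨z', hz', h.symm⟩

/-- `homologyπ` is the cokernel of `toCycles`, so its kernel is the image of the differential;
`iCycles` being injective, the equation can be tested in `K.X i`. -/
lemma homologyClass_eq_zero_iff (K : CochainComplex (ModuleCat.{u} R) ℕ) (i : ℕ)
    (f : LinearMap.ker (K.d i (i + 1)).hom) :
    homologyClass K i f = 0 ↔ ∃ g : K.X (i - 1), K.d (i - 1) i g = f.1 := by
  obtain ⟨z, hz, h⟩ := exists_cycles K i f
  have hex := ShortComplex.exact_of_g_is_cokernel
    (ShortComplex.mk _ _ (K.toCycles_comp_homologyπ (i - 1) i))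
    (K.homologyIsCokernel (i - 1) i (prev_up i))
  rw [ShortComplex.moduleCat_exact_iff] at hex
  rw [← h]
  constructor
  · intro h
    obtain ⟨g, hg⟩ := hex z h
    refine ⟨g, ?_⟩
    rw [← hz, ← hg]
    change _ = K.iCycles i (K.toCycles (i - 1) i g)
    rw [← ModuleCat.comp_apply, HomologicalComplex.toCycles_i]
  · rintro ⟨g, hg⟩
    have : z = K.toCycles (i - 1) i g := by
      apply iCycles_injective K i
      rw [hz, ← ModuleCat.comp_apply, HomologicalComplex.toCycles_i, ← hg]
    rw [this, ← ModuleCat.comp_apply, HomologicalComplex.toCycles_comp_homologyπ]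
    rfl

lemma homologyMap_homologyClass {K L : CochainComplex (ModuleCat.{u} R) ℕ} (φ : K ⟶ L) (i : ℕ)
    (f : LinearMap.ker (K.d i (i + 1)).hom)
    (hf' : φ.f i f.1 ∈ LinearMap.ker (L.d i (i + 1)).hom) :
    HomologicalComplex.homologyMap φ i (homologyClass K i f) =
      homologyClass L i ⟨φ.f i f.1, hf'⟩ := by
  obtain ⟨z, hz, h⟩ := exists_cycles K i f
  obtain ⟨z', hz', h'⟩ := exists_cycles L i ⟨φ.f i f.1, hf'⟩
  have : z' = HomologicalComplex.cyclesMap φ i z := by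
    apply iCycles_injective L i
    rw [hz', ← ModuleCat.comp_apply, HomologicalComplex.cyclesMap_i, ModuleCat.comp_apply, hz]
  rw [← h, ← h', this, ← ModuleCat.comp_apply, ← ModuleCat.comp_apply,
    HomologicalComplex.homologyπ_naturality]

/-- The cocycles of degree `i` in the complex of homomorphisms from a projective resolution. -/
def homCocycles (P : ProjectiveResolution X) (i : ℕ) (N : ModuleCat.{u} R) :
    Submodule R (P.complex.X i ⟶ N) :=
  LinearMap.ker ((P.complex.linearYonedaObj R N).d i (i + 1)).hom

lemma mem_homCocycles {P : ProjectiveResolution X} {i : ℕ} {N : ModuleCat.{u} R}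
    {f : P.complex.X i ⟶ N} : f ∈ homCocycles P i N ↔ P.complex.d (i + 1) i ≫ f = 0 := Iff.rfl

/-- The class of a cocycle in `Ext`. -/
def extClass (P : ProjectiveResolution X) (i : ℕ) (N : ModuleCat.{u} R) :
    homCocycles P i N →ₗ[R] ((Ext R (ModuleCat.{u} R) i).obj (op X)).obj N :=
  (P.isoExt (R := R) i N).inv.hom ∘ₗ homologyClass (P.complex.linearYonedaObj R N) i

lemma isoExt_hom_extClass (P : ProjectiveResolution X) (i : ℕ) (N : ModuleCat.{u} R)
    (f : homCocycles P i N) :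
    (P.isoExt (R := R) i N).hom (extClass P i N f) =
      homologyClass (P.complex.linearYonedaObj R N) i f := by
  change (P.isoExt (R := R) i N).hom ((P.isoExt (R := R) i N).inv
    (homologyClass (P.complex.linearYonedaObj R N) i f)) = _
  rw [← ModuleCat.comp_apply, Iso.inv_hom_id]
  rfl

lemma isoExt_hom_injective (P : ProjectiveResolution X) (i : ℕ) (N : ModuleCat.{u} R) :
    Function.Injective (P.isoExt (R := R) i N).hom :=
  (ModuleCat.mono_iff_injective (P.isoExt (R := R) i N).hom).1 inferInstance

lemma eq_extClass_iff (P : ProjectiveResolution X) (i : ℕ) (N : ModuleCat.{u} R)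
    (f : P.complex.X i ⟶ N) (e : ((Ext R (ModuleCat.{u} R) i).obj (op X)).obj N) :
    (∃ z : (P.complex.linearYonedaObj R N).cycles i,
      (P.complex.linearYonedaObj R N).iCycles i z = f ∧
      (P.isoExt (R := R) i N).hom e = (P.complex.linearYonedaObj R N).homologyπ i z) ↔
    ∃ hf : f ∈ homCocycles P i N, e = extClass P i N ⟨f, hf⟩ := by
  refine (eq_homologyClass_iff (P.complex.linearYonedaObj R N) i f _).trans
    (exists_congr fun hf => ?_)
  rw [← (isoExt_hom_injective P i N).eq_iff, isoExt_hom_extClass]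
  rfl

lemma extClass_eq_zero_iff (P : ProjectiveResolution X) (i : ℕ) (N : ModuleCat.{u} R)
    (f : homCocycles P i N) :
    extClass P i N f = 0 ↔ ∃ g : P.complex.X (i - 1) ⟶ N, P.complex.d i (i - 1) ≫ g = f.1 := by
  rw [← (isoExt_hom_injective P i N).eq_iff, isoExt_hom_extClass, map_zero]
  exact homologyClass_eq_zero_iff (P.complex.linearYonedaObj R N) i f

/-- On representatives, functoriality of `Ext` is precomposition with any chain map of resolutions
lying over `u`. -/
lemma extMap_extClass (u : X ⟶ Y) (P : ProjectiveResolution X) (Q : ProjectiveResolution Y)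
    (φ : P.complex ⟶ Q.complex) (comm : φ.f 0 ≫ Q.π.f 0 = P.π.f 0 ≫ u) (N : ModuleCat.{u} R)
    (i : ℕ) (f : Q.complex.X i ⟶ N) (hf : f ∈ homCocycles Q i N)
    (hf' : φ.f i ≫ f ∈ homCocycles P i N) :
    ((Ext R (ModuleCat.{u} R) i).map u.op).app N (extClass Q i N ⟨f, hf⟩) =
      extClass P i N ⟨φ.f i ≫ f, hf'⟩ := by
  apply isoExt_hom_injective P i N
  rw [← ModuleCat.comp_apply, isoExt_hom_naturality u P Q φ comm, ModuleCat.comp_apply,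
    isoExt_hom_extClass, isoExt_hom_extClass]
  exact homologyMap_homologyClass (linearYonedaMap φ N) i ⟨f, hf⟩ hf'

lemma comp_mem_homCocycles (P : ProjectiveResolution X) (Q : ProjectiveResolution Y)
    (φ : P.complex ⟶ Q.complex) {N : ModuleCat.{u} R}
    {i : ℕ} {f : Q.complex.X i ⟶ N} (hf : f ∈ homCocycles Q i N) :
    φ.f i ≫ f ∈ homCocycles P i N := by
  rw [mem_homCocycles] at hf ⊢
  rw [← Category.assoc, ← φ.comm, Category.assoc, hf, comp_zero]

end ExtClass

/-! ### Local cohomology as a filtered colimit of Ext modules. -/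

section Colimit

variable {k : Type u} [Field k] {n : ℕ}
variable (M : Type u) [AddCommGroup M] [Module (MvPolynomial (Fin n) k) M]
  (ℳ : (Fin n → ℤ) → AddSubgroup M)

lemma isHomogeneousExt_iff (J : Ideal (MvPolynomial (Fin n) k)) (i : ℕ) (α : Fin n → ℤ)
    (e : ((Ext (MvPolynomial (Fin n) k) (ModuleCat.{u} (MvPolynomial (Fin n) k)) i).obj
      (op (ModuleCat.of _ (MvPolynomial (Fin n) k ⧸ J)))).obj (ModuleCat.of _ M)) :
    IsHomogeneousExt M ℳ J i α e ↔
      ∃ (F : GradedResolution J) (f : F.res.complex.X i ⟶ ModuleCat.of _ M)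
        (hf : f ∈ homCocycles F.res i (ModuleCat.of _ M)),
        (∀ (β : Fin n → ℤ), ∀ q ∈ F.gr i β, f q ∈ ℳ (β + α)) ∧
        e = extClass F.res i (ModuleCat.of _ M) ⟨f, hf⟩ := by
  constructor
  · rintro ⟨F, f, z, h, h'⟩
    obtain ⟨hf, he⟩ := (eq_extClass_iff F.res i _ f e).1 ⟨z, h'⟩
    exact ⟨F, f, hf, h, he⟩
  · rintro ⟨F, f, hf, h, he⟩
    obtain ⟨z, hz⟩ := (eq_extClass_iff F.res i _ f e).2 ⟨hf, he⟩
    exact ⟨F, f, z, h, hz⟩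

/-- The projection `A/I → A/J` for ideals `I ≤ J`. -/
def quotientProj {R : Type u} [CommRing R] {I J : Ideal R} (h : I ≤ J) :
    ModuleCat.of R (R ⧸ I) ⟶ ModuleCat.of R (R ⧸ J) :=
  ModuleCat.ofHom (Submodule.mapQ I J LinearMap.id h)

lemma quotientProj_comp {R : Type u} [CommRing R] {I J L : Ideal R} (h : I ≤ J) (h' : J ≤ L) :
    quotientProj h ≫ quotientProj h' = quotientProj (h.trans h') := by
  ext; rfl

/-- The map on `Ext` induced by the projection `A/I → A/J`. -/
def extProj {R : Type u} [CommRing R] {I J : Ideal R} (h : I ≤ J) (i : ℕ) (N : ModuleCat.{u} R) :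
    ((Ext R (ModuleCat.{u} R) i).obj (op (ModuleCat.of R (R ⧸ J)))).obj N ⟶
      ((Ext R (ModuleCat.{u} R) i).obj (op (ModuleCat.of R (R ⧸ I)))).obj N :=
  ((Ext R (ModuleCat.{u} R) i).map (quotientProj h).op).app N

lemma extProj_comp {R : Type u} [CommRing R] {I J L : Ideal R} (h : I ≤ J) (h' : J ≤ L) (i : ℕ)
    (N : ModuleCat.{u} R) :
    extProj h' i N ≫ extProj h i N = extProj (h.trans h') i N := by
  simp only [extProj]
  rw [← NatTrans.comp_app, ← Functor.map_comp, ← op_comp, quotientProj_comp]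

/-- The canonical map from `Extⁱ(A/𝔪ᵗ, M)` to local cohomology. -/
def extPowToLocalCohomology (i t : ℕ) :
    ((Ext (MvPolynomial (Fin n) k) (ModuleCat.{u} (MvPolynomial (Fin n) k)) i).obj
      (op (ModuleCat.of _ (MvPolynomial (Fin n) k ⧸ irrelevantIdeal k n ^ t)))).obj
        (ModuleCat.of _ M) ⟶
    (localCohomology (irrelevantIdeal k n) i).obj (ModuleCat.of (MvPolynomial (Fin n) k) M) :=
  (Limits.colimit.ι
    (localCohomology.diagram (localCohomology.idealPowersDiagram (irrelevantIdeal k n)) i)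
    (op (op t))).app (ModuleCat.of _ M)

lemma extToLocalCohomology_eq_comp (J : Ideal (MvPolynomial (Fin n) k)) (i t : ℕ)
    (hJ : irrelevantIdeal k n ^ t ≤ J) :
    extToLocalCohomology M J i t hJ = extProj hJ i _ ≫ extPowToLocalCohomology M i t := rfl

lemma extProj_comp_extPowToLocalCohomology (i : ℕ) {t t' : ℕ} (h : t ≤ t') :
    extProj (Ideal.pow_le_pow_right h) i _ ≫ extPowToLocalCohomology (k := k) (n := n) M i t' =
      extPowToLocalCohomology M i t :=
  congrArg (fun τ => τ.app (ModuleCat.of _ M)) (Limits.colimit.w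
    (localCohomology.diagram (localCohomology.idealPowersDiagram (irrelevantIdeal k n)) i)
    (homOfLE h).op.op)

lemma extToLocalCohomology_eq (J : Ideal (MvPolynomial (Fin n) k)) (i t t' : ℕ)
    (hJ : irrelevantIdeal k n ^ t ≤ J) (h : t ≤ t') :
    extToLocalCohomology M J i t hJ =
      extToLocalCohomology M J i t' ((Ideal.pow_le_pow_right h).trans hJ) := by
  rw [extToLocalCohomology_eq_comp, extToLocalCohomology_eq_comp,
    ← extProj_comp_extPowToLocalCohomology M i h, ← Category.assoc, extProj_comp]

/-- The exponents `t` and `t'` are only witnesses: after enlarging both to their maximum, the two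
maps factor through the same Ext module. -/
lemma extProj_comp_extToLocalCohomology {I J : Ideal (MvPolynomial (Fin n) k)} (h : I ≤ J)
    (i t t' : ℕ) (hI : irrelevantIdeal k n ^ t ≤ I) (hJ : irrelevantIdeal k n ^ t' ≤ J) :
    extProj h i (ModuleCat.of _ M) ≫ extToLocalCohomology M I i t hI =
      extToLocalCohomology M J i t' hJ := by
  rw [extToLocalCohomology_eq M I i t (max t t') hI (le_max_left _ _),
    extToLocalCohomology_eq M J i t' (max t t') hJ (le_max_right _ _),
    extToLocalCohomology_eq_comp, extToLocalCohomology_eq_comp, ← Category.assoc, extProj_comp]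

/-- Evaluation at `M` preserves the colimit, and in a filtered colimit of modules an element that
becomes zero is already zero at a finite stage. -/
lemma exists_extProj_eq_zero (J : Ideal (MvPolynomial (Fin n) k)) (i t : ℕ)
    (hJ : irrelevantIdeal k n ^ t ≤ J) (e : ((Ext (MvPolynomial (Fin n) k)
      (ModuleCat.{u} (MvPolynomial (Fin n) k)) i).obj
      (op (ModuleCat.of _ (MvPolynomial (Fin n) k ⧸ J)))).obj (ModuleCat.of _ M))
    (he : extToLocalCohomology M J i t hJ e = 0) :
    ∃ (t' : ℕ) (h : irrelevantIdeal k n ^ t' ≤ J), extProj h i (ModuleCat.of _ M) e = 0 := by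
  let D := localCohomology.diagram (localCohomology.idealPowersDiagram (irrelevantIdeal k n)) i
  let E := (evaluation (ModuleCat.{u} (MvPolynomial (Fin n) k))
    (ModuleCat.{u} (MvPolynomial (Fin n) k))).obj (ModuleCat.of _ M)
  have hc : IsColimit (E.mapCocone (colimit.cocone D)) :=
    isColimitOfPreserves E (colimit.isColimit D)
  have h0 : (E.mapCocone (colimit.cocone D)).ι.app (op (op t))
      (extProj hJ i (ModuleCat.of _ M) e) =
      (E.mapCocone (colimit.cocone D)).ι.app (op (op t)) 0 := by
    rw [map_zero]
    exact he
  -- The index category of ideal powers lives in universe `0`, the modules in universe `u`.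
  have : PreservesFilteredColimitsOfSize.{0, 0}
      (forget (ModuleCat.{u} (MvPolynomial (Fin n) k))) :=
    preservesFilteredColimitsOfSize_shrink.{0, u, 0, u} _
  obtain ⟨j, f, g, hfg⟩ := Concrete.isColimit_exists_of_rep_eq (D ⋙ E) hc _ _ h0
  rw [map_zero] at hfg
  refine ⟨j.unop.unop, (Ideal.pow_le_pow_right (leOfHom f.unop.unop)).trans hJ, ?_⟩
  rw [← extProj_comp (Ideal.pow_le_pow_right (leOfHom f.unop.unop)) hJ]
  exact hfg

end Colimit

/-! ### Gradings described by their projections. -/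

section Grading

variable {ι : Type*} [DecidableEq ι] {M N : Type*} [AddCommGroup M] [AddCommGroup N]

/-- `p` is the family of projections onto the homogeneous components of a grading `ℳ`. -/
structure IsProjFamily (ℳ : ι → AddSubgroup M) (p : ι → M →+ M) : Prop where
  mem : ∀ β v, p β v ∈ ℳ β
  self : ∀ β, ∀ v ∈ ℳ β, p β v = v
  ne : ∀ β γ, β ≠ γ → ∀ v ∈ ℳ β, p γ v = 0
  top : ∀ v, v ∈ ⨆ β, ℳ β

/-- The projection `p γ` recovers the component `x γ` from the sum, which gives uniqueness of
decompositions; `top` gives their existence. -/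
lemma IsProjFamily.isInternal {ℳ : ι → AddSubgroup M} {p : ι → M →+ M} (h : IsProjFamily ℳ p) :
    DirectSum.IsInternal ℳ := by
  have key : ∀ (x : ⨁ β, ℳ β) (γ : ι), p γ (DirectSum.coeAddMonoidHom ℳ x) = x γ := by
    intro x γ
    induction x using DirectSum.induction_on with
    | zero => simp
    | of β v =>
      rw [DirectSum.coeAddMonoidHom_of]
      by_cases hβ : β = γ
      · subst hβ
        rw [h.self _ _ v.2, DirectSum.of_eq_same]
      · rw [h.ne _ _ hβ _ v.2, DirectSum.of_eq_of_ne _ _ _ (Ne.symm hβ)]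
        rfl
    | add x y hx hy => rw [map_add, map_add, hx, hy, DirectSum.add_apply, AddSubgroup.coe_add]
  constructor
  · rw [injective_iff_map_eq_zero]
    intro x hx
    ext γ
    rw [← key, hx, map_zero]
    rfl
  · intro v
    induction h.top v using AddSubgroup.iSup_induction' with
    | hp β v hv => exact ⟨DirectSum.of _ β ⟨v, hv⟩, by simp⟩
    | h1 => exact ⟨0, map_zero _⟩
    | hadd v w _ _ hv hw =>
      obtain ⟨a, rfl⟩ := hv
      obtain ⟨b, rfl⟩ := hw
      exact ⟨a + b, map_add _ _ _⟩

lemma exists_isProjFamily {ℳ : ι → AddSubgroup M} (h : DirectSum.IsInternal ℳ) :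
    ∃ p, IsProjFamily ℳ p := by
  let e := AddEquiv.ofBijective _ h
  have he : ∀ β (v : ℳ β), e.symm v = DirectSum.of (fun β => ℳ β) β v := fun β v => by
    rw [AddEquiv.symm_apply_eq]
    exact (DirectSum.coeAddMonoidHom_of ℳ β v).symm
  refine ⟨fun β => ((ℳ β).subtype.comp (DFinsupp.evalAddMonoidHom β)).comp e.symm.toAddMonoidHom,
    fun β v => ?_, fun β v hv => ?_, fun β γ hβγ v hv => ?_, fun v => ?_⟩
  · exact (((e.symm v) β)).2
  · change ((e.symm v β : ℳ β) : M) = v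
    rw [he β ⟨v, hv⟩, DirectSum.of_eq_same]
  · change ((e.symm v γ : ℳ γ) : M) = 0
    rw [he β ⟨v, hv⟩, DirectSum.of_eq_of_ne _ _ _ (Ne.symm hβγ)]
    rfl
  · obtain ⟨x, rfl⟩ := h.2 v
    induction x using DirectSum.induction_on with
    | zero => simp
    | of β v =>
      rw [DirectSum.coeAddMonoidHom_of]
      exact AddSubgroup.mem_iSup_of_mem β v.2
    | add x y hx hy =>
      rw [map_add]
      exact add_mem hx hy

/-- The shift `e` must be injective: otherwise components of several degrees could land in the same
degree of the target. -/
lemma IsProjFamily.map_comm {ℳ : ι → AddSubgroup M} {𝒩 : ι → AddSubgroup N} {p : ι → M →+ M}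
    {q : ι → N →+ N} (hp : IsProjFamily ℳ p) (hq : IsProjFamily 𝒩 q) (d : M →+ N) (e : ι → ι)
    (he : Function.Injective e) (hd : ∀ β, ∀ v ∈ ℳ β, d v ∈ 𝒩 (e β)) (β : ι) (v : M) :
    q (e β) (d v) = d (p β v) := by
  induction hp.top v using AddSubgroup.iSup_induction' with
  | hp γ v hv =>
    by_cases hβ : γ = β
    · subst hβ
      rw [hp.self _ _ hv, hq.self _ _ (hd _ _ hv)]
    · rw [hp.ne _ _ hβ _ hv, hq.ne _ _ (he.ne hβ) _ (hd _ _ hv), map_zero]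
  | h1 => simp
  | hadd v w _ _ hv hw => rw [map_add, map_add, hv, hw, map_add, map_add]

/-- The degree `β` component of any preimage is again a preimage. -/
lemma exists_homogeneous_preimage {ℳ : ι → AddSubgroup M} {𝒩 : ι → AddSubgroup N}
    (hℳ : DirectSum.IsInternal ℳ) (h𝒩 : DirectSum.IsInternal 𝒩) (d : M →+ N)
    (hd : ∀ β, ∀ v ∈ ℳ β, d v ∈ 𝒩 β) {β : ι} {z : N} (hz : z ∈ 𝒩 β) (v : M) (hv : d v = z) :
    ∃ v' ∈ ℳ β, d v' = z := by
  obtain ⟨p, hp⟩ := exists_isProjFamily hℳ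
  obtain ⟨q, hq⟩ := exists_isProjFamily h𝒩
  exact ⟨p β v, hp.mem _ _, by
    rw [← hp.map_comm hq d id Function.injective_id hd, hv, id, hq.self _ _ hz]⟩

end Grading

/-! ### The Koszul complex of powers of the variables and its contracting homotopy. -/

section Koszul

variable {k : Type u} [Field k] {n : ℕ}

variable (k n) in
/-- The homogeneous polynomials of multidegree `β`. -/
abbrev polyPiece (β : Fin n → ℤ) : Submodule k (MvPolynomial (Fin n) k) :=
  MvPolynomial.weightedHomogeneousSubmodule k
    (fun j : Fin n => (Pi.single j 1 : Fin n → ℤ)) β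

lemma weight_single_apply (m : Fin n →₀ ℕ) (j : Fin n) :
    Finsupp.weight (fun j : Fin n => (Pi.single j 1 : Fin n → ℤ)) m j = m j := by
  classical
  rw [Finsupp.weight_apply, Finsupp.sum_fintype _ _ (by simp)]
  simp [Finset.sum_apply, Pi.single_apply]

/-- The multidegree of a monomial. -/
def mdeg (m : Fin n →₀ ℕ) : Fin n → ℤ := fun j => m j

lemma monomial_mem_polyPiece (m : Fin n →₀ ℕ) (c : k) :
    MvPolynomial.monomial m c ∈ polyPiece k n (mdeg m) :=
  MvPolynomial.isWeightedHomogeneous_monomial _ _ _ (funext fun j => weight_single_apply m j)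

lemma X_mem_polyPiece (j : Fin n) :
    (MvPolynomial.X j : MvPolynomial (Fin n) k) ∈ polyPiece k n (Pi.single j 1) :=
  MvPolynomial.isWeightedHomogeneous_X _ _ _

lemma mul_mem_polyPiece {p q : MvPolynomial (Fin n) k} {β γ : Fin n → ℤ}
    (hp : p ∈ polyPiece k n β) (hq : q ∈ polyPiece k n γ) : p * q ∈ polyPiece k n (β + γ) :=
  MvPolynomial.IsWeightedHomogeneous.mul hp hq

lemma pow_mem_polyPiece {p : MvPolynomial (Fin n) k} {β : Fin n → ℤ}
    (hp : p ∈ polyPiece k n β) (s : ℕ) : p ^ s ∈ polyPiece k n (s • β) :=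
  MvPolynomial.IsWeightedHomogeneous.pow hp s

lemma C_mem_polyPiece (c : k) :
    (MvPolynomial.C c : MvPolynomial (Fin n) k) ∈ polyPiece k n 0 :=
  MvPolynomial.isWeightedHomogeneous_C _ _

/-- The projection of polynomials onto a multidegree. -/
def polyProj (β : Fin n → ℤ) : MvPolynomial (Fin n) k →+ MvPolynomial (Fin n) k :=
  (MvPolynomial.weightedHomogeneousComponent
    (fun j : Fin n => (Pi.single j 1 : Fin n → ℤ)) β).toAddMonoidHom

lemma mem_iSup_of_monomial {N : Type*} [AddCommGroup N] (f : MvPolynomial (Fin n) k →+ N)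
    {S : AddSubgroup N} (h : ∀ m c, f (MvPolynomial.monomial m c) ∈ S)
    (p : MvPolynomial (Fin n) k) : f p ∈ S := by
  induction p using MvPolynomial.induction_on' with
  | monomial m c => exact h m c
  | add p q hp hq =>
    rw [map_add]
    exact add_mem hp hq

lemma polyProj_isProjFamily : IsProjFamily (fun β => (polyPiece k n β).toAddSubgroup) polyProj where
  mem _ _ := MvPolynomial.weightedHomogeneousComponent_mem _ _ _
  self _ _ hv := MvPolynomial.weightedHomogeneousComponent_eq_self hv
  ne _ _ h _ hv := MvPolynomial.IsWeightedHomogeneous.weightedHomogeneousComponent_ne _ hv h.symm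
  top v := mem_iSup_of_monomial (AddMonoidHom.id _) (fun m c =>
    AddSubgroup.mem_iSup_of_mem (mdeg m) (monomial_mem_polyPiece m c)) v

/-- The sign of the vertex `l` relative to the face `τ`. -/
def kSign (l : Fin n) (τ : Finset (Fin n)) : ℤ := (-1) ^ (τ.filter (l < ·)).card

lemma kSign_mul_self (l : Fin n) (τ : Finset (Fin n)) : kSign l τ * kSign l τ = 1 := by
  rw [kSign, ← mul_pow]
  simp

lemma kSign_empty (l : Fin n) : kSign l ∅ = 1 := by simp [kSign]

lemma kSign_insert {l l' : Fin n} {τ : Finset (Fin n)} (h : l' ∉ τ) :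
    kSign l (insert l' τ) = (if l < l' then -1 else 1) * kSign l τ := by
  unfold kSign
  rw [Finset.filter_insert]
  split_ifs with hl
  · rw [Finset.card_insert_of_notMem (by simp [h]), pow_succ]
    ring
  · rw [one_mul]

/-- Exactly one of `l < l'` and `l' < l` holds, so inserting the two labels in the two possible
orders gives opposite signs. This is what makes the differential square to zero. -/
lemma kSign_mul_kSign_insert {l l' : Fin n} {τ : Finset (Fin n)} (hne : l ≠ l') (h : l ∉ τ)
    (h' : l' ∉ τ) :
    kSign l τ * kSign l' (insert l τ) = -(kSign l' τ * kSign l (insert l' τ)) := by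
  rw [kSign_insert h, kSign_insert h']
  rcases lt_or_gt_of_ne hne with hl | hl
  · rw [if_neg hl.not_gt, if_pos hl]; ring
  · rw [if_neg hl.not_gt, if_pos hl]; ring

section

variable {R : Type*} [CommRing R] {M : Type*} [AddCommGroup M] [Module R M] (y : Fin n → R)

/-- The differential of the (total) Koszul complex of a sequence. -/
def koszulD : (Finset (Fin n) → R) →ₗ[R] (Finset (Fin n) → R) where
  toFun q τ := ∑ l ∈ τᶜ, kSign l τ • (y l * q (insert l τ))
  map_add' p q := by
    ext τ
    simp [mul_add, Finset.sum_add_distrib]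
  map_smul' a q := by
    ext τ
    simp [Finset.mul_sum, mul_left_comm]

lemma koszulD_apply (q : Finset (Fin n) → R) (τ : Finset (Fin n)) :
    koszulD y q τ = ∑ l ∈ τᶜ, kSign l τ • (y l * q (insert l τ)) := rfl

variable (M) in
/-- The differential of the Koszul cochain complex of a sequence with values in a module. -/
def koszulδ : (Finset (Fin n) → M) →ₗ[R] (Finset (Fin n) → M) where
  toFun c τ := ∑ l ∈ τ, kSign l (τ.erase l) • y l • c (τ.erase l)
  map_add' p q := by
    ext τ
    simp [Finset.sum_add_distrib]
  map_smul' a q := by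
    ext τ
    simp only [Pi.smul_apply, Finset.smul_sum, RingHom.id_apply]
    exact Finset.sum_congr rfl fun l _ => by
      rw [smul_comm (y l) a, smul_comm _ a]

lemma koszulδ_apply (c : Finset (Fin n) → M) (τ : Finset (Fin n)) :
    koszulδ M y c τ = ∑ l ∈ τ, kSign l (τ.erase l) • y l • c (τ.erase l) := rfl

/-- The cochain differential is the transpose of the chain differential: pairs `l ∉ τ` correspond to
pairs `l ∈ σ` through `σ = insert l τ`. -/
lemma sum_koszulD_smul (q : Finset (Fin n) → R) (c : Finset (Fin n) → M) :
    ∑ τ, koszulD y q τ • c τ = ∑ σ, q σ • koszulδ M y c σ := by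
  simp only [koszulD_apply, koszulδ_apply, Finset.sum_smul, Finset.smul_sum]
  rw [Finset.sum_sigma', Finset.sum_sigma']
  refine Finset.sum_bij' (fun a _ => ⟨insert a.2 a.1, a.2⟩) (fun a _ => ⟨a.1.erase a.2, a.2⟩)
    ?_ ?_ ?_ ?_ ?_
  · intro a ha; simp
  · intro a ha; simp
  · rintro ⟨τ, l⟩ ha
    have : l ∉ τ := by simpa using ha
    simp [this]
  · rintro ⟨τ, l⟩ ha
    have : l ∈ τ := by simpa using ha
    simp [this]
  · rintro ⟨τ, l⟩ ha
    have : l ∉ τ := by simpa using ha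
    simp only [Finset.erase_insert this]
    rw [smul_assoc, smul_comm (q _), mul_smul, smul_comm (q _)]

/-- Exchanging the two inserted labels is a sign-reversing involution without fixed points on the
terms. -/
lemma koszulD_koszulD (q : Finset (Fin n) → R) : koszulD y (koszulD y q) = 0 := by
  ext ρ
  simp only [koszulD_apply, Finset.mul_sum, Finset.smul_sum, Pi.zero_apply]
  rw [Finset.sum_sigma']
  refine Finset.sum_involution (fun a _ => ⟨a.2, a.1⟩) ?_ ?_ ?_ ?_
  · rintro ⟨l, l'⟩ ha
    simp only [Finset.mem_sigma, Finset.mem_compl, Finset.mem_insert, not_or] at ha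
    obtain ⟨h1, h2, h3⟩ := ha
    have := kSign_mul_kSign_insert (Ne.symm h2) h1 h3
    simp only [mul_smul_comm, smul_smul]
    rw [this, Finset.insert_comm l l', mul_left_comm, neg_smul, neg_add_cancel]
  · rintro ⟨l, l'⟩ ha _ h
    simp only [Finset.mem_sigma, Finset.mem_compl, Finset.mem_insert, not_or] at ha
    simp only [Sigma.mk.injEq] at h
    exact ha.2.1 h.1
  · rintro ⟨l, l'⟩ ha
    simp only [Finset.mem_sigma, Finset.mem_compl, Finset.mem_insert, not_or] at ha ⊢
    exact ⟨ha.2.2, fun h => ha.2.1 h.symm, ha.1⟩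
  · rintro ⟨l, l'⟩ ha
    rfl

lemma koszulD_single (σ : Finset (Fin n)) (a : R) :
    koszulD y (Pi.single σ a) =
      ∑ l ∈ σ, kSign l (σ.erase l) • Pi.single (σ.erase l) (y l * a) := by
  ext τ
  rw [koszulD_apply, Finset.sum_apply]
  simp only [Pi.smul_apply]
  by_cases h : ∃ l ∉ τ, insert l τ = σ
  · obtain ⟨l, hl, rfl⟩ := h
    rw [Finset.sum_eq_single l, Finset.sum_eq_single l]
    · simp [hl]
    · intro l' h1 h2
      rw [Pi.single_eq_of_ne, smul_zero]
      intro h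
      have : l ∈ (insert l τ).erase l' := by simp [Ne.symm h2]
      rw [← h] at this
      exact hl this
    · simp
    · intro l' h1 h2
      rw [Pi.single_eq_of_ne, mul_zero, smul_zero]
      intro h
      have : l' ∈ insert l τ := h ▸ Finset.mem_insert_self _ _
      rw [Finset.mem_insert] at this
      simp [h2] at this
      simp [this] at h1
    · simp [hl]
  · push Not at h
    rw [Finset.sum_eq_zero, Finset.sum_eq_zero]
    · intro l hl
      rw [Pi.single_eq_of_ne, smul_zero]
      rintro rfl
      exact h l (by simp) (by simp [hl])
    · intro l hl
      rw [Pi.single_eq_of_ne (h l (by simpa using hl)), mul_zero, smul_zero]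

end

/-- The sign rule behind the cancellation of mixed terms, both for the contracting homotopy and for
the cone argument in a positive degree. -/
lemma kSign_insert_mul_kSign_insert {l l' : Fin n} {τ : Finset (Fin n)} (hne : l ≠ l')
    (h : l ∉ τ) (h' : l' ∉ τ) :
    kSign l (insert l' τ) * kSign l' (insert l τ) = -(kSign l τ * kSign l' τ) := by
  rw [kSign_insert h, kSign_insert h']
  rcases lt_or_gt_of_ne hne with hl | hl
  · rw [if_neg hl.not_gt, if_pos hl]; ring
  · rw [if_neg hl.not_gt, if_pos hl]; ring

/-- The exponent of the multidegree of the element `m e_σ` of the Koszul complex. -/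
def totalExp (s : ℕ) (σ : Finset (Fin n)) (m : Fin n →₀ ℕ) (l : Fin n) : ℕ :=
  m l + if l ∈ σ then s else 0

open Classical in
/-- A variable whose exponent is at least `s`. -/
def pickVar (s : ℕ) (β : Fin n → ℕ) : Option (Fin n) :=
  if H : ∃ l, s ≤ β l then some H.choose else none

lemma exists_pickVar {s : ℕ} {β : Fin n → ℕ} (h : ∃ l, s ≤ β l) :
    ∃ l, pickVar s β = some l ∧ s ≤ β l :=
  ⟨h.choose, by rw [pickVar, dif_pos h], h.choose_spec⟩

variable (k n) in
/-- The powers of the variables. -/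
def varPow (s : ℕ) (l : Fin n) : MvPolynomial (Fin n) k := MvPolynomial.X l ^ s

variable (k) in
/-- The basis element `m e_σ` of the Koszul complex. -/
def koszulMon (σ : Finset (Fin n)) (m : Fin n →₀ ℕ) : Finset (Fin n) → MvPolynomial (Fin n) k :=
  Pi.single σ (MvPolynomial.monomial m 1)

variable (k n) in
/-- The basis of the Koszul complex over the field of coefficients. -/
def koszulBasis : Module.Basis ((_ : Finset (Fin n)) × (Fin n →₀ ℕ)) k
    (Finset (Fin n) → MvPolynomial (Fin n) k) :=
  Pi.basis fun _ => MvPolynomial.basisMonomials (Fin n) k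

lemma koszulBasis_apply (p : (_ : Finset (Fin n)) × (Fin n →₀ ℕ)) :
    koszulBasis k n p = koszulMon k p.1 p.2 := by
  simp [koszulBasis, koszulMon, Pi.basis_apply]

variable (k n) in
/-- A contracting homotopy of the Koszul complex of powers of the variables. -/
def koszulHomotopy (s : ℕ) : (Finset (Fin n) → MvPolynomial (Fin n) k) →ₗ[k]
    (Finset (Fin n) → MvPolynomial (Fin n) k) :=
  (koszulBasis k n).constr k fun p =>
    match pickVar s (totalExp s p.1 p.2) with
    | none => 0
    | some l => if l ∈ p.1 then 0 else
        kSign l p.1 • koszulMon k (insert l p.1) (p.2 - Finsupp.single l s)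

lemma koszulHomotopy_mon {s : ℕ} {σ : Finset (Fin n)} {m : Fin n →₀ ℕ} {l : Fin n}
    (h : pickVar s (totalExp s σ m) = some l) :
    koszulHomotopy k n s (koszulMon k σ m) = if l ∈ σ then 0 else
      kSign l σ • koszulMon k (insert l σ) (m - Finsupp.single l s) := by
  rw [← koszulBasis_apply ⟨σ, m⟩, koszulHomotopy, Module.Basis.constr_basis]
  simp only [h]

lemma koszulD_mon (s : ℕ) (σ : Finset (Fin n)) (m : Fin n →₀ ℕ) :
    koszulD (varPow k n s) (koszulMon k σ m) =
      ∑ l ∈ σ, kSign l (σ.erase l) • koszulMon k (σ.erase l) (m + Finsupp.single l s) := by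
  rw [koszulMon, koszulD_single]
  refine Finset.sum_congr rfl fun l _ => ?_
  rw [koszulMon, varPow, MvPolynomial.X_pow_eq_monomial, MvPolynomial.monomial_mul, add_comm m,
    mul_one]

/-- The differential preserves multidegree. Since `pickVar` looks only at the multidegree, the same
variable is picked for a basis element and for all the terms of its boundary. -/
lemma totalExp_erase {s : ℕ} {σ : Finset (Fin n)} {m : Fin n →₀ ℕ} {l : Fin n} (h : l ∈ σ) :
    totalExp s (σ.erase l) (m + Finsupp.single l s) = totalExp s σ m := by
  ext j
  by_cases hj : j = l
  · subst hj; simp [totalExp, h]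
  · simp [totalExp, hj]

/-- In a fixed multidegree let `l` be the picked variable. The homotopy divides by `x_lˢ` and
inserts `l` into `σ`, or gives `0` if `l ∈ σ`. If `l ∈ σ`, only the term of the boundary omitting
`l` survives and returns the element; if `l ∉ σ`, the first summand returns it and the other terms
cancel in pairs. Nonemptiness of `σ` guarantees an exponent at least `s`. -/
lemma koszulD_homotopy_mon {s : ℕ} {σ : Finset (Fin n)} (hσ : σ.Nonempty) (m : Fin n →₀ ℕ) :
    koszulD (varPow k n s) (koszulHomotopy k n s (koszulMon k σ m)) +
      koszulHomotopy k n s (koszulD (varPow k n s) (koszulMon k σ m)) = koszulMon k σ m := by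
  obtain ⟨j, hj⟩ := hσ
  obtain ⟨l, hl, hls⟩ := exists_pickVar (s := s) (β := totalExp s σ m)
    ⟨j, by simp [totalExp, hj]⟩
  rw [koszulHomotopy_mon hl, koszulD_mon, map_sum]
  simp only [map_zsmul]
  have hl' : ∀ l' ∈ σ, koszulHomotopy k n s
      (koszulMon k (σ.erase l') (m + Finsupp.single l' s)) = if l ∈ σ.erase l' then 0 else
      kSign l (σ.erase l') • koszulMon k (insert l (σ.erase l'))
        (m + Finsupp.single l' s - Finsupp.single l s) := fun l' h' =>
    koszulHomotopy_mon (by rw [totalExp_erase h', hl])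
  rw [Finset.sum_congr rfl fun l' h' => by rw [hl' l' h']]
  by_cases hlσ : l ∈ σ
  · rw [if_pos hlσ, map_zero, zero_add, Finset.sum_eq_single l]
    · rw [if_neg (by simp), smul_smul, kSign_mul_self, one_smul, Finset.insert_erase hlσ,
        add_tsub_cancel_right]
    · intro l' _ hne
      rw [if_pos (by simp [hlσ, Ne.symm hne]), smul_zero]
    · intro h; exact absurd hlσ h
  · have hsm : s ≤ m l := by simpa [totalExp, hlσ] using hls
    have hle : Finsupp.single l s ≤ m := by simpa using hsm
    rw [if_neg hlσ, map_zsmul, koszulD_mon, Finset.sum_insert hlσ, Finset.erase_insert hlσ,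
      tsub_add_cancel_of_le hle, smul_add, smul_smul, kSign_mul_self, one_smul, add_assoc,
      Finset.smul_sum, ← Finset.sum_add_distrib, Finset.sum_eq_zero, add_zero]
    intro l' h'
    have hne : l ≠ l' := fun h => hlσ (h ▸ h')
    have h1 : (insert l σ).erase l' = insert l (σ.erase l') := Finset.erase_insert_of_ne hne
    rw [if_neg (by simp [hlσ]), h1, smul_smul, smul_smul, tsub_add_eq_add_tsub hle, ← add_smul]
    obtain ⟨τ, hτ, rfl⟩ : ∃ τ, l' ∉ τ ∧ σ = insert l' τ :=
      ⟨σ.erase l', by simp, by simp [Finset.insert_erase h']⟩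
    rw [Finset.erase_insert hτ, kSign_insert_mul_kSign_insert hne (by simp at hlσ; tauto) hτ,
      mul_comm (kSign l' τ), neg_add_cancel, zero_smul]

/-- Every cycle of positive degree in the Koszul complex of powers of the variables is a
boundary. -/
lemma exists_koszulD_eq (s : ℕ) (q : Finset (Fin n) → MvPolynomial (Fin n) k) (hq : q ∅ = 0)
    (hD : koszulD (varPow k n s) q = 0) : ∃ p, koszulD (varPow k n s) p = q := by
  let Dk : (Finset (Fin n) → MvPolynomial (Fin n) k) →ₗ[k]
      (Finset (Fin n) → MvPolynomial (Fin n) k) := (koszulD (varPow k n s)).restrictScalars k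
  -- The homotopy identity is only available on the `e_σ` with `σ` nonempty; `E` discards the
  -- component at `∅`, which vanishes for `q`.
  let E : (Finset (Fin n) → MvPolynomial (Fin n) k) →ₗ[k]
      (Finset (Fin n) → MvPolynomial (Fin n) k) :=
    LinearMap.id - LinearMap.single k _ ∅ ∘ₗ LinearMap.proj ∅
  have hE : Dk ∘ₗ koszulHomotopy k n s ∘ₗ E + koszulHomotopy k n s ∘ₗ Dk ∘ₗ E = E := by
    refine (koszulBasis k n).ext fun p => ?_
    rw [koszulBasis_apply]
    by_cases hp : p.1 = ∅
    · have : E (koszulMon k p.1 p.2) = 0 := by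
        simp [E, koszulMon, hp]
      simp [this]
    · have : E (koszulMon k p.1 p.2) = koszulMon k p.1 p.2 := by
        simp [E, koszulMon, Ne.symm hp]
      simp only [LinearMap.add_apply, LinearMap.comp_apply, this]
      exact koszulD_homotopy_mon (Finset.nonempty_iff_ne_empty.2 hp) _
  have hEq : E q = q := by simp [E, hq]
  refine ⟨koszulHomotopy k n s q, ?_⟩
  have := LinearMap.congr_fun hE q
  simp only [LinearMap.add_apply, LinearMap.comp_apply, hEq] at this
  have hD' : Dk q = 0 := hD
  rw [hD', map_zero, add_zero] at this
  exact this

end Koszul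

/-! ### The Koszul complex as a projective resolution. -/

section KoszulResolution

variable {n : ℕ}

section

variable {R : Type*} [CommRing R] {M : Type*} [AddCommGroup M] [Module R M] (y : Fin n → R)

variable (R M) in
/-- The families indexed by subsets that are supported on the subsets with `j` elements. -/
def cardSupported (j : ℕ) : Submodule R (Finset (Fin n) → M) where
  carrier := {q | ∀ σ, σ.card ≠ j → q σ = 0}
  zero_mem' _ _ := rfl
  add_mem' hp hq σ hσ := by rw [Pi.add_apply, hp σ hσ, hq σ hσ, add_zero]
  smul_mem' a q hq σ hσ := by rw [Pi.smul_apply, hq σ hσ, smul_zero]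

variable (R M) in
/-- The projection onto the families supported on the subsets with `j` elements. -/
def cardProj (j : ℕ) : (Finset (Fin n) → M) →ₗ[R] cardSupported (n := n) R M j where
  toFun q := ⟨fun σ => if σ.card = j then q σ else 0, fun σ hσ => if_neg hσ⟩
  map_add' p q := by
    ext σ
    by_cases h : σ.card = j <;> simp [h]
  map_smul' a q := by
    ext σ
    by_cases h : σ.card = j <;> simp [h]

lemma cardProj_apply (j : ℕ) (q : Finset (Fin n) → M) (σ : Finset (Fin n)) :
    (cardProj R M j q : Finset (Fin n) → M) σ = if σ.card = j then q σ else 0 := rfl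

lemma cardProj_self {j : ℕ} (q : cardSupported (n := n) R M j) : cardProj R M j q.1 = q := by
  ext σ
  rw [cardProj_apply]
  split_ifs with h
  · rfl
  · exact (q.2 σ h).symm

/-- Allows a preimage found in the total complex to be cut down to its part of the right homological
degree. -/
lemma koszulD_cardProj (j : ℕ) (q : Finset (Fin n) → R) :
    koszulD y (cardProj R R (j + 1) q).1 = (cardProj R R j (koszulD y q)).1 := by
  ext τ
  rw [koszulD_apply, cardProj_apply]
  split_ifs with h
  · rw [koszulD_apply]
    refine Finset.sum_congr rfl fun l hl => ?_
    rw [cardProj_apply, if_pos]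
    rw [Finset.card_insert_of_notMem (by simpa using hl), h]
  · refine Finset.sum_eq_zero fun l hl => ?_
    rw [cardProj_apply, if_neg, mul_zero, smul_zero]
    rw [Finset.card_insert_of_notMem (by simpa using hl)]
    omega

lemma koszulD_mem {j : ℕ} {q : Finset (Fin n) → R} (hq : q ∈ cardSupported R R (j + 1)) :
    koszulD y q ∈ cardSupported R R j := by
  have := koszulD_cardProj y j q
  rw [show cardProj R R (j + 1) q = ⟨q, hq⟩ from cardProj_self ⟨q, hq⟩] at this
  rw [this]
  exact Subtype.mem _

/-- The differential of the Koszul complex. -/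
def koszulDiff (j : ℕ) : cardSupported (n := n) R R (j + 1) →ₗ[R] cardSupported (n := n) R R j :=
  (koszulD y).restrict fun _ => koszulD_mem y

lemma koszulDiff_coe (j : ℕ) (q : cardSupported (n := n) R R (j + 1)) :
    (koszulDiff y j q).1 = koszulD y q.1 := rfl

instance (j : ℕ) : Module.Projective R (cardSupported (n := n) R R j) :=
  Module.Projective.of_split (cardSupported R R j).subtype (cardProj R R j)
    (LinearMap.ext cardProj_self)

end

section

variable {R : Type u} [CommRing R] (y : Fin n → R)

/-- The Koszul complex. -/
def koszulComplex : ChainComplex (ModuleCat.{u} R) ℕ :=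
  ChainComplex.of (fun j => ModuleCat.of R (cardSupported (n := n) R R j))
    (fun j => ModuleCat.ofHom (koszulDiff y j)) (fun j => by
      ext q : 2
      exact Subtype.ext (koszulD_koszulD y q.1))

lemma koszulComplex_d (j : ℕ) :
    (koszulComplex y).d (j + 1) j = ModuleCat.ofHom (koszulDiff y j) :=
  ChainComplex.of_d (fun j => ModuleCat.of R (cardSupported (n := n) R R j))
    (fun j => ModuleCat.ofHom (koszulDiff y j)) j

/-- The augmentation of the Koszul complex. -/
def koszulAug : cardSupported (n := n) R R 0 →ₗ[R] R ⧸ Ideal.span (Set.range y) :=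
  (Submodule.mkQ _) ∘ₗ LinearMap.proj ∅ ∘ₗ (cardSupported R R 0).subtype

lemma koszulAug_apply (q : cardSupported (n := n) R R 0) :
    koszulAug y q = Ideal.Quotient.mk _ (q.1 ∅) := rfl

lemma koszulAug_koszulDiff (q : cardSupported (n := n) R R 1) :
    koszulAug y (koszulDiff y 0 q) = 0 := by
  rw [koszulAug_apply, Ideal.Quotient.eq_zero_iff_mem, koszulDiff_coe, koszulD_apply]
  refine Ideal.sum_mem _ fun l _ => ?_
  exact zsmul_mem (Ideal.mul_mem_right _ _ (Ideal.subset_span (Set.mem_range_self l))) _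

lemma koszulAug_surjective : Function.Surjective (koszulAug y) := by
  intro a
  obtain ⟨a, rfl⟩ := Ideal.Quotient.mk_surjective a
  refine ⟨cardProj R R 0 (fun _ => a), ?_⟩
  rw [koszulAug_apply, cardProj_apply, if_pos (by simp)]

/-- Exactness at degree zero needs no regularity of the sequence: the coefficients of an ideal
element as a combination of the `y l`, placed at the singletons, form a preimage. -/
lemma exists_koszulDiff_of_koszulAug_eq_zero (q : cardSupported (n := n) R R 0)
    (hq : koszulAug y q = 0) : ∃ p, koszulDiff y 0 p = q := by
  rw [koszulAug_apply, Ideal.Quotient.eq_zero_iff_mem, Ideal.mem_span_range_iff_exists_fun] at hq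
  obtain ⟨c, hc⟩ := hq
  refine ⟨cardProj R R 1 (∑ l, Pi.single {l} (c l)), Subtype.ext ?_⟩
  rw [koszulDiff_coe, koszulD_cardProj]
  ext τ
  rw [cardProj_apply]
  split_ifs with h
  · obtain rfl : τ = ∅ := by simpa using h
    rw [koszulD_apply, ← hc]
    refine Finset.sum_congr (by simp) fun l _ => ?_
    rw [kSign_empty, one_smul, mul_comm]
    congr 1
    rw [Finset.sum_apply, Finset.sum_eq_single l]
    · simp
    · intro l' _ h'
      rw [Pi.single_eq_of_ne]
      simpa using Ne.symm h'
    · simp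
  · exact (q.2 τ h).symm

/-- A Koszul complex that is exact in positive degrees is a projective resolution. -/
def koszulResolution (hex : ∀ (j : ℕ) (q : cardSupported (n := n) R R (j + 1)),
    koszulDiff y j q = 0 → ∃ p, koszulDiff y (j + 1) p = q) :
    ProjectiveResolution (ModuleCat.of R (R ⧸ Ideal.span (Set.range y))) where
  complex := koszulComplex y
  projective j := (IsProjective.iff_projective _).1
    (inferInstanceAs (Module.Projective R (cardSupported (n := n) R R j)))
  π := (ChainComplex.toSingle₀Equiv _ _).symm ⟨ModuleCat.ofHom (koszulAug y), by
    rw [koszulComplex_d]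
    ext q
    exact koszulAug_koszulDiff y q⟩
  quasiIso := ⟨fun j => by
    cases j with
    | zero =>
      rw [ChainComplex.quasiIsoAt₀_iff, ShortComplex.quasiIso_iff_of_zeros']
      · constructor
        · rw [ShortComplex.moduleCat_exact_iff]
          intro q hq
          obtain ⟨p, hp⟩ := exists_koszulDiff_of_koszulAug_eq_zero y q hq
          refine ⟨p, ?_⟩
          change (koszulComplex y).d 1 0 p = q
          rw [koszulComplex_d]
          exact hp
        · refine (ModuleCat.epi_iff_surjective _).2 ?_
          exact koszulAug_surjective y
      all_goals rfl
    | succ j =>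
      rw [quasiIsoAt_iff_exactAt']
      · rw [HomologicalComplex.exactAt_iff' _ (j + 1 + 1) (j + 1) j (by simp) (by simp),
          ShortComplex.moduleCat_exact_iff]
        intro q hq
        obtain ⟨p, hp⟩ := hex j q (by
          change (koszulComplex y).d (j + 1) j q = 0 at hq
          rw [koszulComplex_d] at hq
          exact hq)
        refine ⟨p, ?_⟩
        change (koszulComplex y).d (j + 1 + 1) (j + 1) p = q
        rw [koszulComplex_d]
        exact hp
      · apply ChainComplex.exactAt_succ_single_obj⟩

end

end KoszulResolution

/-! ### The multigrading of the Koszul resolution. -/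

section GradedKoszul

variable {k : Type u} [Field k] {n : ℕ}

lemma koszulDiff_varPow_exact (s j : ℕ)
    (q : cardSupported (n := n) (MvPolynomial (Fin n) k) (MvPolynomial (Fin n) k) (j + 1))
    (hq : koszulDiff (varPow k n s) j q = 0) : ∃ p, koszulDiff (varPow k n s) (j + 1) p = q := by
  obtain ⟨p, hp⟩ := exists_koszulD_eq s q.1 (q.2 ∅ (by simp)) (congrArg Subtype.val hq)
  refine ⟨cardProj _ _ _ p, Subtype.ext ?_⟩
  rw [koszulDiff_coe, koszulD_cardProj, hp, cardProj_self]

variable (k n) in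
/-- The ideal generated by the `s`-th powers of the variables. -/
def powIdeal (s : ℕ) : Ideal (MvPolynomial (Fin n) k) := Ideal.span (Set.range (varPow k n s))

variable (k n) in
/-- The Koszul resolution of the quotient by the `s`-th powers of the variables. -/
def powResolution (s : ℕ) : ProjectiveResolution
    (ModuleCat.of (MvPolynomial (Fin n) k) (MvPolynomial (Fin n) k ⧸ powIdeal k n s)) :=
  koszulResolution (varPow k n s) (koszulDiff_varPow_exact s)

/-- The multidegree of the generator `e_σ` of the Koszul complex. -/
def sDeg (s : ℕ) (σ : Finset (Fin n)) : Fin n → ℤ := fun j => if j ∈ σ then s else 0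

lemma sDeg_empty (s : ℕ) : sDeg s (∅ : Finset (Fin n)) = 0 := by
  ext; simp [sDeg]

lemma sDeg_insert (s : ℕ) {σ : Finset (Fin n)} {l : Fin n} (h : l ∉ σ) :
    sDeg s (insert l σ) = sDeg s σ + s • Pi.single l 1 := by
  ext j
  by_cases hj : j = l
  · subst hj; simp [sDeg, h]
  · simp [sDeg, hj]

lemma varPow_mem (s : ℕ) (l : Fin n) : varPow k n s l ∈ polyPiece k n (s • Pi.single l 1) :=
  pow_mem_polyPiece (X_mem_polyPiece l) s

variable (k) in
/-- The multigrading of the Koszul complex. -/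
def koszulGr (s j : ℕ) (β : Fin n → ℤ) : AddSubgroup
    (cardSupported (n := n) (MvPolynomial (Fin n) k) (MvPolynomial (Fin n) k) j) where
  carrier := {q | ∀ σ, q.1 σ ∈ polyPiece k n (β - sDeg s σ)}
  zero_mem' _ := zero_mem _
  add_mem' hp hq σ := add_mem (hp σ) (hq σ)
  neg_mem' hp σ := neg_mem (hp σ)

lemma koszulDiff_mem_koszulGr {s j : ℕ} {β : Fin n → ℤ}
    {q : cardSupported (n := n) (MvPolynomial (Fin n) k) (MvPolynomial (Fin n) k) (j + 1)}
    (hq : q ∈ koszulGr k s (j + 1) β) :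
    koszulDiff (varPow k n s) j q ∈ koszulGr k s j β := by
  intro τ
  rw [koszulDiff_coe, koszulD_apply]
  refine sum_mem fun l hl => zsmul_mem ?_ _
  have := mul_mem_polyPiece (varPow_mem s l) (hq (insert l τ))
  rwa [sDeg_insert s (by simpa using hl), sub_add_eq_sub_sub, add_sub_cancel] at this

/-- The projections onto the multidegrees of the Koszul complex. -/
def koszulProj (s j : ℕ) (β : Fin n → ℤ) :
    cardSupported (n := n) (MvPolynomial (Fin n) k) (MvPolynomial (Fin n) k) j →+
    cardSupported (n := n) (MvPolynomial (Fin n) k) (MvPolynomial (Fin n) k) j where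
  toFun q := ⟨fun σ => polyProj (β - sDeg s σ) (q.1 σ), fun σ hσ =>
    (congrArg _ (q.2 σ hσ)).trans (map_zero _)⟩
  map_zero' := Subtype.ext (funext fun _ => map_zero _)
  map_add' _ _ := Subtype.ext (funext fun _ => map_add _ _ _)

lemma eq_sum_cardProj_single {R M : Type*} [CommRing R] [AddCommGroup M] [Module R M] {j : ℕ}
    (q : cardSupported (n := n) R M j) : q = ∑ σ, cardProj R M j (Pi.single σ (q.1 σ)) := by
  rw [← map_sum, Finset.univ_sum_single, cardProj_self]

lemma koszulProj_isProjFamily (s j : ℕ) :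
    IsProjFamily (koszulGr k (n := n) s j) (koszulProj s j) where
  mem β q σ := polyProj_isProjFamily.mem _ _
  self β q hq := Subtype.ext (funext fun σ => polyProj_isProjFamily.self _ _ (hq σ))
  ne β γ h q hq := Subtype.ext (funext fun σ => polyProj_isProjFamily.ne _ _
    (fun h' => h (sub_left_injective h')) _ (hq σ))
  top q := by
    rw [eq_sum_cardProj_single q]
    refine sum_mem fun σ _ => ?_
    refine mem_iSup_of_monomial ((cardProj _ _ j).toAddMonoidHom.comp
      (AddMonoidHom.single (fun _ => MvPolynomial (Fin n) k) σ)) (fun m c => ?_) _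
    refine AddSubgroup.mem_iSup_of_mem (mdeg m + sDeg s σ) fun τ => ?_
    change (cardProj _ _ j (Pi.single σ (MvPolynomial.monomial m c))).1 τ ∈ _
    rw [cardProj_apply]
    split_ifs
    · by_cases hτ : τ = σ
      · subst hτ
        rw [Pi.single_eq_same, add_sub_cancel_right]
        exact monomial_mem_polyPiece m c
      · rw [Pi.single_eq_of_ne hτ]
        exact zero_mem _
    · exact zero_mem _

lemma koszulGr_isMultigrading (s j : ℕ) : IsMultigrading (k := k) (koszulGr k (n := n) s j) where
  isInternal := (koszulProj_isProjFamily s j).isInternal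
  C_smul_mem c β q hq σ := by
    have := mul_mem_polyPiece (C_mem_polyPiece c) (hq σ)
    rwa [zero_add] at this
  X_smul_mem l β q hq σ := by
    have := mul_mem_polyPiece (X_mem_polyPiece l) (hq σ)
    rwa [← add_sub_assoc, add_comm] at this

/-- The generators are homogeneous, so projecting `∑ c_l x_lˢ` to a degree amounts to projecting
each coefficient to the degree shifted by `-s e_l`. -/
lemma polyProj_mem_powIdeal (s : ℕ) (β : Fin n → ℤ) {p : MvPolynomial (Fin n) k}
    (hp : p ∈ powIdeal k n s) : polyProj β p ∈ powIdeal k n s := by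
  rw [powIdeal, Ideal.mem_span_range_iff_exists_fun] at hp
  obtain ⟨c, rfl⟩ := hp
  rw [map_sum]
  refine sum_mem fun l _ => ?_
  have := polyProj_isProjFamily.map_comm polyProj_isProjFamily
    (AddMonoidHom.mulRight (varPow k n s l)) (fun γ => γ + s • Pi.single l 1)
    (add_left_injective _) (fun γ v hv => mul_mem_polyPiece hv (varPow_mem s l))
    (β - s • Pi.single l 1) (c l)
  simp only [sub_add_cancel] at this
  change polyProj β (c l * varPow k n s l) = _ * _ at this
  rw [this]
  exact Ideal.mul_mem_left _ _ (Ideal.subset_span (Set.mem_range_self l))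

/-- An ideal stable under the projections lets them descend to the quotient. -/
lemma quotientGrading_isMultigrading (J : Ideal (MvPolynomial (Fin n) k))
    (hJ : ∀ β, ∀ p ∈ J, polyProj β p ∈ J) : IsMultigrading (k := k) (quotientGrading J) where
  isInternal := by
    let f := (Ideal.Quotient.mk J).toAddMonoidHom
    have hf : Function.Surjective f := Ideal.Quotient.mk_surjective
    have hker : ∀ β, f.ker ≤ (f.comp (polyProj β)).ker := fun β p hp => by
      have hp' : p ∈ J := Ideal.Quotient.eq_zero_iff_mem.1 hp
      exact Ideal.Quotient.eq_zero_iff_mem.2 (hJ β p hp')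
    let p := fun β => f.liftOfSurjective hf ⟨f.comp (polyProj β), hker β⟩
    have hp : ∀ β a, p β (f a) = f (polyProj β a) := fun β a =>
      AddMonoidHom.liftOfRightInverse_comp_apply _ _ _ _ _
    refine IsProjFamily.isInternal (p := p) ⟨fun β v => ?_, ?_, ?_, fun v => ?_⟩
    · obtain ⟨a, rfl⟩ := hf v
      rw [hp]
      exact ⟨_, polyProj_isProjFamily.mem β a, rfl⟩
    · rintro β _ ⟨a, ha, rfl⟩
      exact (hp β a).trans (congrArg f (polyProj_isProjFamily.self β a ha))
    · rintro β γ h _ ⟨a, ha, rfl⟩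
      refine (hp γ a).trans ?_
      rw [polyProj_isProjFamily.ne β γ h a ha, map_zero]
    · obtain ⟨a, rfl⟩ := hf v
      exact mem_iSup_of_monomial f (fun m c => AddSubgroup.mem_iSup_of_mem (S := quotientGrading J)
        (mdeg m) ⟨_, monomial_mem_polyPiece m c, rfl⟩) a
  C_smul_mem := by
    rintro c β _ ⟨a, ha, rfl⟩
    refine ⟨MvPolynomial.C c * a, ?_, rfl⟩
    have := mul_mem_polyPiece (C_mem_polyPiece c) ha
    rwa [zero_add] at this
  X_smul_mem := by
    rintro l β _ ⟨a, ha, rfl⟩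
    refine ⟨MvPolynomial.X l * a, ?_, rfl⟩
    have := mul_mem_polyPiece (X_mem_polyPiece l) ha
    rwa [add_comm] at this

variable (k n) in
/-- The graded Koszul resolution. -/
def powGradedResolution (s : ℕ) : GradedResolution (powIdeal k n s) where
  res := powResolution k n s
  gr := koszulGr k s
  isMultigrading := koszulGr_isMultigrading s
  d_mem j β q hq := by
    change (koszulComplex (varPow k n s)).d (j + 1) j q ∈ _
    rw [koszulComplex_d]
    exact koszulDiff_mem_koszulGr hq
  π_mem β q hq := by
    have := hq ∅
    rw [sDeg_empty, sub_zero] at this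
    exact ⟨_, this, rfl⟩

end GradedKoszul

/-! ### Graded comparison maps between resolutions. -/

section Comparison

variable {n : ℕ}

section

variable {R : Type*} [CommRing R] {M : Type*} [AddCommGroup M] [Module R M]

variable (R M) in
/-- The homomorphism on the `j`-th term of the Koszul complex given by a cochain. -/
def koszulPair (j : ℕ) :
    (Finset (Fin n) → M) →ₗ[R] (cardSupported (n := n) R R j →ₗ[R] M) where
  toFun c :=
    { toFun := fun q => ∑ σ, q.1 σ • c σ
      map_add' := fun p q => by simp [add_smul, Finset.sum_add_distrib]
      map_smul' := fun a q => by simp [mul_smul, Finset.smul_sum] }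
  map_add' c c' := by
    ext q
    simp [smul_add, Finset.sum_add_distrib]
  map_smul' a c := by
    ext q
    simp [Finset.smul_sum, smul_comm a]

lemma koszulPair_apply (j : ℕ) (c : Finset (Fin n) → M) (q : cardSupported (n := n) R R j) :
    koszulPair R M j c q = ∑ σ, q.1 σ • c σ := rfl

variable (R) in
/-- The generator `e_σ` of the Koszul complex (zero if `σ` does not have `j` elements). -/
def koszulGen (j : ℕ) (σ : Finset (Fin n)) : cardSupported (n := n) R R j :=
  cardProj R R j (Pi.single σ 1)

lemma koszulGen_apply (j : ℕ) (σ τ : Finset (Fin n)) :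
    (koszulGen R j σ).1 τ = if τ = σ ∧ τ.card = j then 1 else 0 := by
  rw [koszulGen, cardProj_apply, Pi.single_apply]
  by_cases h : τ = σ <;> by_cases h' : τ.card = j <;> simp [h]

lemma koszulPair_gen (j : ℕ) (c : Finset (Fin n) → M) (σ : Finset (Fin n)) :
    koszulPair R M j c (koszulGen R j σ) = if σ.card = j then c σ else 0 := by
  rw [koszulPair_apply, Finset.sum_eq_single σ]
  · rw [koszulGen_apply]; by_cases h : σ.card = j <;> simp [h]
  · intro τ _ hτ
    rw [koszulGen_apply, if_neg (fun h => hτ h.1), zero_smul]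
  · simp

lemma eq_sum_koszulGen (j : ℕ) (q : cardSupported (n := n) R R j) :
    q = ∑ σ, q.1 σ • koszulGen R j σ := by
  conv_lhs => rw [eq_sum_cardProj_single q]
  refine Finset.sum_congr rfl fun σ _ => ?_
  rw [koszulGen, ← map_smul, ← Pi.single_smul, smul_eq_mul, mul_one]

lemma koszulHom_ext {j : ℕ} {f g : cardSupported (n := n) R R j →ₗ[R] M}
    (h : ∀ σ, σ.card = j → f (koszulGen R j σ) = g (koszulGen R j σ)) : f = g := by
  ext q
  rw [eq_sum_koszulGen j q, map_sum, map_sum]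
  refine Finset.sum_congr rfl fun σ _ => ?_
  rw [map_smul, map_smul]
  by_cases hσ : σ.card = j
  · rw [h σ hσ]
  · rw [q.2 σ hσ, zero_smul, zero_smul]

/-- The cochain of a homomorphism on the `j`-th term of the Koszul complex. -/
def koszulVal {j : ℕ} (f : cardSupported (n := n) R R j →ₗ[R] M) (σ : Finset (Fin n)) : M :=
  f (koszulGen R j σ)

lemma koszulGen_eq_zero {j : ℕ} {σ : Finset (Fin n)} (h : σ.card ≠ j) : koszulGen R j σ = 0 := by
  ext τ
  rw [koszulGen_apply, if_neg]
  · rfl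
  · rintro ⟨rfl, h'⟩; exact h h'

lemma koszulVal_mem {j : ℕ} (f : cardSupported (n := n) R R j →ₗ[R] M) :
    koszulVal f ∈ cardSupported R M j := fun σ hσ => by
  rw [koszulVal, koszulGen_eq_zero hσ, map_zero]

lemma koszulPair_koszulVal {j : ℕ} (f : cardSupported (n := n) R R j →ₗ[R] M) :
    koszulPair R M j (koszulVal f) = f :=
  koszulHom_ext fun σ hσ => by rw [koszulPair_gen, if_pos hσ, koszulVal]

lemma koszulVal_koszulPair {j : ℕ} {c : Finset (Fin n) → M} (hc : c ∈ cardSupported R M j) :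
    koszulVal (koszulPair R M j c) = c := by
  ext σ
  rw [koszulVal, koszulPair_gen]
  split_ifs with h
  · rfl
  · exact (hc σ h).symm

lemma koszulPair_koszulDiff (y : Fin n → R) (j : ℕ) (c : Finset (Fin n) → M)
    (q : cardSupported (n := n) R R (j + 1)) :
    koszulPair R M j c (koszulDiff y j q) = koszulPair R M (j + 1) (koszulδ M y c) q := by
  rw [koszulPair_apply, koszulPair_apply, koszulDiff_coe, sum_koszulD_smul]

lemma koszulδ_mem (y : Fin n → R) {j : ℕ} {c : Finset (Fin n) → M}
    (hc : c ∈ cardSupported R M j) : koszulδ M y c ∈ cardSupported R M (j + 1) := fun τ hτ => by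
  rw [koszulδ_apply]
  refine Finset.sum_eq_zero fun l hl => ?_
  rw [hc, smul_zero, smul_zero]
  rw [Finset.card_erase_of_mem hl]
  have := Finset.card_pos.2 ⟨l, hl⟩
  omega

lemma koszulPair_comp_eq_zero_iff (y : Fin n → R) {j : ℕ} {c : Finset (Fin n) → M}
    (hc : c ∈ cardSupported R M j) :
    koszulPair R M j c ∘ₗ koszulDiff y j = 0 ↔ koszulδ M y c = 0 := by
  have : koszulPair R M j c ∘ₗ koszulDiff y j = koszulPair R M (j + 1) (koszulδ M y c) :=
    LinearMap.ext fun q => koszulPair_koszulDiff y j c q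
  rw [this]
  constructor
  · intro h
    rw [← koszulVal_koszulPair (koszulδ_mem y hc), h]
    ext; rfl
  · intro h
    rw [h, map_zero]

end

variable {k : Type u} [Field k]

lemma IsMultigrading.monomial_smul_mem {M : Type u} [AddCommGroup M]
    [Module (MvPolynomial (Fin n) k) M] {ℳ : (Fin n → ℤ) → AddSubgroup M}
    (h : IsMultigrading (k := k) ℳ) (m : Fin n →₀ ℕ) (c : k) {β : Fin n → ℤ} {v : M}
    (hv : v ∈ ℳ β) : MvPolynomial.monomial m c • v ∈ ℳ (mdeg m + β) := by
  induction m using Finsupp.induction_linear generalizing c β v with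
  | zero =>
    have e : mdeg (0 : Fin n →₀ ℕ) + β = β := by ext; simp [mdeg]
    rw [e]
    exact h.C_smul_mem c β v hv
  | add m m' hm hm' =>
    have e : mdeg (m + m') + β = mdeg m + (mdeg m' + β) := by ext; simp [mdeg, add_assoc]
    rw [e, show MvPolynomial.monomial (m + m') c = MvPolynomial.monomial m c *
      MvPolynomial.monomial m' (1 : k) by simp [MvPolynomial.monomial_mul], mul_smul]
    exact hm c (hm' 1 hv)
  | single j e =>
    induction e generalizing c β v with
    | zero =>
      have e : mdeg (Finsupp.single j 0 : Fin n →₀ ℕ) + β = β := by ext; simp [mdeg]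
      rw [e, Finsupp.single_zero]
      exact h.C_smul_mem c β v hv
    | succ e ih =>
      have e' : mdeg (Finsupp.single j (e + 1) : Fin n →₀ ℕ) + β =
          mdeg (Finsupp.single j e) + (β + Pi.single j 1) := by
        ext l
        by_cases hl : l = j
        · subst hl; simp [mdeg]; ring
        · simp [mdeg, hl]
      rw [e', show MvPolynomial.monomial (Finsupp.single j (e + 1)) c =
        MvPolynomial.monomial (Finsupp.single j e) c * MvPolynomial.X j by
          simp [MvPolynomial.X, MvPolynomial.monomial_mul, Finsupp.single_add], mul_smul]
      exact ih c (h.X_smul_mem j β v hv)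

lemma IsMultigrading.smul_mem {M : Type u} [AddCommGroup M]
    [Module (MvPolynomial (Fin n) k) M] {ℳ : (Fin n → ℤ) → AddSubgroup M}
    (h : IsMultigrading (k := k) ℳ) {p : MvPolynomial (Fin n) k} {γ β : Fin n → ℤ} {v : M}
    (hp : p ∈ polyPiece k n γ) (hv : v ∈ ℳ β) : p • v ∈ ℳ (γ + β) := by
  rw [p.as_sum, Finset.sum_smul]
  refine sum_mem fun m hm => ?_
  have hγ : mdeg m = γ := by
    rw [← hp (MvPolynomial.mem_support_iff.1 hm)]
    exact funext fun j => (weight_single_apply m j).symm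
  rw [← hγ]
  exact h.monomial_smul_mem m _ hv

/-- Since `e_σ` has degree `s·1_σ`, a family with `c_σ` in degree `α + s·1_σ` is the same as a
homomorphism that is homogeneous of degree `α`. -/
lemma koszulPair_mem {M : Type u} [AddCommGroup M]
    [Module (MvPolynomial (Fin n) k) M] {ℳ : (Fin n → ℤ) → AddSubgroup M}
    (h : IsMultigrading (k := k) ℳ) {s j : ℕ} {α : Fin n → ℤ} {c : Finset (Fin n) → M}
    (hc : ∀ σ, c σ ∈ ℳ (α + sDeg s σ)) {β : Fin n → ℤ}
    {q : cardSupported (n := n) (MvPolynomial (Fin n) k) (MvPolynomial (Fin n) k) j}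
    (hq : q ∈ koszulGr k s j β) : koszulPair _ M j c q ∈ ℳ (β + α) := by
  rw [koszulPair_apply]
  refine sum_mem fun σ _ => ?_
  have := h.smul_mem (hq σ) (hc σ)
  rwa [add_comm α, ← add_assoc, sub_add_cancel] at this

lemma koszulGen_mem_koszulGr (s j : ℕ) (σ : Finset (Fin n)) :
    koszulGen (MvPolynomial (Fin n) k) j σ ∈ koszulGr k s j (sDeg s σ) := fun τ => by
  rw [koszulGen_apply]
  split_ifs with h
  · rw [h.1, sub_self]
    exact C_mem_polyPiece 1
  · exact zero_mem _

section Lift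

variable {J : Ideal (MvPolynomial (Fin n) k)} (F : GradedResolution J) (s : ℕ)

/-- The homogeneous partial lifts from the Koszul complex to a graded resolution. -/
def IsGradedLift (j : ℕ) (f : cardSupported (n := n) (MvPolynomial (Fin n) k)
    (MvPolynomial (Fin n) k) j →ₗ[MvPolynomial (Fin n) k] F.res.complex.X j) : Prop :=
  (∀ β, ∀ q ∈ koszulGr k s j β, f q ∈ F.gr j β) ∧
  ∀ q, ∃ w, F.res.complex.d (j + 1) j w = f (koszulDiff (varPow k n s) j q)

/-- The Koszul term is free on the `e_σ`, so it suffices to lift `f (d e_σ)`; the component of a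
lift in the degree of `e_σ` is still a lift. Exactness of `F` then makes the next lifting problem
solvable, which is the second half of `IsGradedLift`. -/
lemma exists_isGradedLift_succ {j : ℕ} {f : cardSupported (n := n) (MvPolynomial (Fin n) k)
    (MvPolynomial (Fin n) k) j →ₗ[MvPolynomial (Fin n) k] F.res.complex.X j}
    (hf : IsGradedLift F s j f) :
    ∃ f', IsGradedLift F s (j + 1) f' ∧
      ∀ q, F.res.complex.d (j + 1) j (f' q) = f (koszulDiff (varPow k n s) j q) := by
  have key : ∀ σ, ∃ w ∈ F.gr (j + 1) (0 + sDeg s σ), F.res.complex.d (j + 1) j w =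
      f (koszulDiff (varPow k n s) j (koszulGen _ (j + 1) σ)) := fun σ => by
    obtain ⟨w, hw⟩ := hf.2 (koszulGen _ (j + 1) σ)
    rw [zero_add]
    exact exists_homogeneous_preimage (F.isMultigrading (j + 1)).isInternal
      (F.isMultigrading j).isInternal (F.res.complex.d (j + 1) j).hom.toAddMonoidHom
      (F.d_mem j) (hf.1 _ _ (koszulDiff_mem_koszulGr (koszulGen_mem_koszulGr s (j + 1) σ))) w hw
  choose w hw hdw using key
  have hd : ∀ q, F.res.complex.d (j + 1) j (koszulPair _ _ (j + 1) w q) =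
      f (koszulDiff (varPow k n s) j q) := by
    intro q
    refine LinearMap.congr_fun (f := (F.res.complex.d (j + 1) j).hom ∘ₗ koszulPair _ _ (j + 1) w)
      (g := f ∘ₗ koszulDiff (varPow k n s) j) (koszulHom_ext fun σ hσ => ?_) q
    rw [LinearMap.comp_apply, koszulPair_gen, if_pos hσ]
    exact hdw σ
  refine ⟨koszulPair _ _ (j + 1) w, ⟨fun β q hq => ?_, fun q => ?_⟩, hd⟩
  · have := koszulPair_mem (F.isMultigrading (j + 1)) hw hq
    rwa [add_zero] at this
  · have hex := F.res.exact_succ j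
    rw [ShortComplex.moduleCat_exact_iff] at hex
    refine hex (koszulPair _ _ (j + 1) w (koszulDiff (varPow k n s) (j + 1) q)) ?_
    refine (hd _).trans ?_
    rw [show koszulDiff (varPow k n s) j (koszulDiff (varPow k n s) (j + 1) q) = 0 from
      Subtype.ext (koszulD_koszulD _ q.1), map_zero]

/-- The augmentation of a graded resolution. -/
def gradedAug : F.res.complex.X 0 →ₗ[MvPolynomial (Fin n) k] MvPolynomial (Fin n) k ⧸ J :=
  (F.res.π.f 0).hom

/-- The image of the generator `e_∅` under the graded lift: it has to be homogeneous of degree zero.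
-/
lemma exists_homogeneous_one (hJ : IsMultigrading (k := k) (quotientGrading J)) :
    ∃ w ∈ F.gr 0 0, gradedAug F w = 1 := by
  have hepi : Function.Surjective (F.res.π.f 0) :=
    (ModuleCat.epi_iff_surjective _).1 inferInstance
  obtain ⟨w, hw⟩ := hepi (1 : MvPolynomial (Fin n) k ⧸ J)
  exact exists_homogeneous_preimage (F.isMultigrading 0).isInternal hJ.isInternal
    (gradedAug F).toAddMonoidHom F.π_mem (β := 0) ⟨1, C_mem_polyPiece 1, rfl⟩ w hw

variable {s}

lemma exists_isGradedLift_zero (hJ : IsMultigrading (k := k) (quotientGrading J))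
    (hs : powIdeal k n s ≤ J) :
    ∃ f, IsGradedLift F s 0 f ∧
      ∀ q, gradedAug F (f q) = Submodule.mapQ (powIdeal k n s) J LinearMap.id hs
        (koszulAug (varPow k n s) q) := by
  obtain ⟨w, hw, hw1⟩ := exists_homogeneous_one F hJ
  have hval : ∀ q, koszulPair (n := n) (MvPolynomial (Fin n) k) _ 0 (fun _ => w) q =
      q.1 ∅ • w := fun q => by
    rw [koszulPair_apply, Finset.sum_eq_single ∅]
    · intro σ _ hσ
      rw [q.2 σ (by simpa using hσ), zero_smul]
    · simp
  have haug : ∀ q, gradedAug F (koszulPair (n := n) (MvPolynomial (Fin n) k) _ 0 (fun _ => w) q) =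
      Submodule.mapQ (powIdeal k n s) J LinearMap.id hs (koszulAug (varPow k n s) q) := fun q => by
    rw [hval, map_smul, hw1]
    exact (congrArg (Ideal.Quotient.mk J) (mul_one (q.1 ∅)))
  refine ⟨koszulPair (n := n) (MvPolynomial (Fin n) k) _ 0 (fun _ => w),
    ⟨fun β q hq => ?_, fun q => ?_⟩, haug⟩
  · rw [hval]
    have := hq ∅
    rw [sDeg_empty, sub_zero] at this
    have := (F.isMultigrading 0).smul_mem this hw
    rwa [add_zero] at this
  · have hex := F.res.exact₀
    rw [ShortComplex.moduleCat_exact_iff] at hex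
    refine hex _ ?_
    refine (haug _).trans ?_
    rw [koszulAug_koszulDiff]
    exact map_zero _

/-- The sequence of homogeneous partial lifts. -/
def gradedLiftSeq (f₀ : {f // IsGradedLift F s 0 f}) : ∀ j, {f // IsGradedLift F s j f}
  | 0 => f₀
  | j + 1 => ⟨_, (exists_isGradedLift_succ F s (gradedLiftSeq f₀ j).2).choose_spec.1⟩

lemma gradedLiftSeq_comm (f₀ : {f // IsGradedLift F s 0 f}) (j : ℕ)
    (q : cardSupported (n := n) (MvPolynomial (Fin n) k) (MvPolynomial (Fin n) k) (j + 1)) :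
    F.res.complex.d (j + 1) j ((gradedLiftSeq F f₀ (j + 1)).1 q) =
      (gradedLiftSeq F f₀ j).1 (koszulDiff (varPow k n s) j q) :=
  (exists_isGradedLift_succ F s (gradedLiftSeq F f₀ j).2).choose_spec.2 q

/-- The chain map given by a sequence of homogeneous partial lifts. -/
def gradedLift (f₀ : {f // IsGradedLift F s 0 f}) :
    (powResolution k n s).complex ⟶ F.res.complex where
  f j := ModuleCat.ofHom (gradedLiftSeq F f₀ j).1
  comm' i j hij := by
    obtain rfl : j + 1 = i := hij
    change _ = (koszulComplex (varPow k n s)).d (j + 1) j ≫ _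
    rw [koszulComplex_d]
    ext q : 2
    exact gradedLiftSeq_comm F f₀ j q

lemma exists_gradedLift (hJ : IsMultigrading (k := k) (quotientGrading J))
    (hs : powIdeal k n s ≤ J) :
    ∃ φ : (powResolution k n s).complex ⟶ F.res.complex,
      φ.f 0 ≫ F.res.π.f 0 = (powResolution k n s).π.f 0 ≫ quotientProj hs ∧
      ∀ j β, ∀ q ∈ koszulGr k s j β, φ.f j q ∈ F.gr j β := by
  obtain ⟨f, hf, hf'⟩ := exists_isGradedLift_zero F hJ hs
  refine ⟨gradedLift F ⟨f, hf⟩, ?_, fun j β q hq => (gradedLiftSeq F ⟨f, hf⟩ j).2.1 β q hq⟩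
  ext q : 2
  exact hf' q

end Lift

section Transition

/-- The comparison map between Koszul complexes of different powers of the variables. -/
def koszulTransition (s t j : ℕ) :
    cardSupported (n := n) (MvPolynomial (Fin n) k) (MvPolynomial (Fin n) k) j
      →ₗ[MvPolynomial (Fin n) k]
    cardSupported (n := n) (MvPolynomial (Fin n) k) (MvPolynomial (Fin n) k) j where
  toFun q := ⟨fun σ => (∏ l ∈ σ, varPow k n (t - s) l) * q.1 σ, fun σ hσ =>
    (congrArg _ (q.2 σ hσ)).trans (mul_zero _)⟩
  map_add' _ _ := Subtype.ext (funext fun _ => mul_add _ _ _)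
  map_smul' _ _ := Subtype.ext (funext fun _ => mul_left_comm _ _ _)

/-- For `l ∉ τ`, the extra factor `x_l^{t-s}` at `insert l τ` turns `x_lˢ` into `x_lᵗ`. -/
lemma koszulDiff_koszulTransition {s t : ℕ} (h : s ≤ t) (j : ℕ)
    (q : cardSupported (n := n) (MvPolynomial (Fin n) k) (MvPolynomial (Fin n) k) (j + 1)) :
    koszulDiff (varPow k n s) j (koszulTransition s t (j + 1) q) =
      koszulTransition s t j (koszulDiff (varPow k n t) j q) := by
  ext τ : 2
  change koszulD (varPow k n s) (koszulTransition s t (j + 1) q).1 τ =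
    (∏ l ∈ τ, varPow k n (t - s) l) * koszulD (varPow k n t) q.1 τ
  rw [koszulD_apply, koszulD_apply, Finset.mul_sum]
  refine Finset.sum_congr rfl fun l hl => ?_
  change kSign l τ • (varPow k n s l *
    ((∏ l ∈ insert l τ, varPow k n (t - s) l) * q.1 (insert l τ))) = _
  rw [Finset.prod_insert (by simpa using hl), mul_smul_comm]
  congr 1
  have : varPow k n t l = varPow k n s l * varPow k n (t - s) l := by
    rw [varPow, varPow, varPow, ← pow_add, Nat.add_sub_cancel' h]
  rw [this]
  ring

lemma powIdeal_anti {s t : ℕ} (h : s ≤ t) : powIdeal k n t ≤ powIdeal k n s := by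
  refine Ideal.span_le.2 ?_
  rintro _ ⟨l, rfl⟩
  have : varPow k n t l = varPow k n s l * varPow k n (t - s) l := by
    rw [varPow, varPow, varPow, ← pow_add, Nat.add_sub_cancel' h]
  rw [this]
  exact Ideal.mul_mem_right _ _ (Ideal.subset_span (Set.mem_range_self l))

/-- The comparison chain map between Koszul resolutions of different powers of the variables. -/
def powTransition {s t : ℕ} (h : s ≤ t) :
    (powResolution k n t).complex ⟶ (powResolution k n s).complex where
  f j := ModuleCat.ofHom (koszulTransition s t j)
  comm' i j hij := by
    obtain rfl : j + 1 = i := hij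
    change _ ≫ (koszulComplex (varPow k n s)).d (j + 1) j =
      (koszulComplex (varPow k n t)).d (j + 1) j ≫ _
    rw [koszulComplex_d, koszulComplex_d]
    ext q : 2
    exact koszulDiff_koszulTransition h j q

lemma powTransition_comm {s t : ℕ} (h : s ≤ t) :
    (powTransition (k := k) (n := n) h).f 0 ≫ (powResolution k n s).π.f 0 =
      (powResolution k n t).π.f 0 ≫ quotientProj (powIdeal_anti h) := by
  ext q : 2
  exact congrArg (Ideal.Quotient.mk (powIdeal k n s)) ((congrArg (· * q.1 ∅)
    (Finset.prod_empty (f := varPow k n (t - s)))).trans (one_mul _))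

end Transition

end Comparison

/-! ### Graded pieces of local cohomology from one Koszul complex. -/

section LocalCohomologyKoszul

variable {k : Type u} [Field k] {n : ℕ}

lemma exists_pow_le_powIdeal (s : ℕ) : ∃ t, irrelevantIdeal k n ^ t ≤ powIdeal k n s := by
  refine Ideal.exists_pow_le_of_le_radical_of_fg ?_
    ((Submodule.fg_def).2 ⟨_, Set.finite_range _, rfl⟩)
  refine Ideal.span_le.2 ?_
  rintro _ ⟨l, rfl⟩
  exact ⟨s, Ideal.subset_span (Set.mem_range_self l)⟩

lemma powIdeal_le_pow (t : ℕ) : powIdeal k n t ≤ irrelevantIdeal k n ^ t := by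
  refine Ideal.span_le.2 ?_
  rintro _ ⟨l, rfl⟩
  exact Ideal.pow_mem_pow (Ideal.subset_span (Set.mem_range_self l)) t

variable (k n) in
/-- The cocycles of the Koszul cochain complex of the `s`-th powers of the variables. -/
def koszulCocycles (M : Type u) [AddCommGroup M] [Module (MvPolynomial (Fin n) k) M] (s i : ℕ) :
    Submodule (MvPolynomial (Fin n) k) (Finset (Fin n) → M) :=
  cardSupported _ M i ⊓ LinearMap.ker (koszulδ M (varPow k n s))

variable {M : Type u} [AddCommGroup M] [Module (MvPolynomial (Fin n) k) M]

lemma koszulVal_comp_koszulDiff {R N : Type*} [CommRing R] [AddCommGroup N] [Module R N]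
    (y : Fin n → R) {j : ℕ} (f : cardSupported (n := n) R R j →ₗ[R] N) :
    koszulVal (f ∘ₗ koszulDiff y j) = koszulδ N y (koszulVal f) := by
  rw [← koszulVal_koszulPair (koszulδ_mem y (koszulVal_mem f))]
  congr 1
  ext q : 1
  rw [← koszulPair_koszulDiff, koszulPair_koszulVal]
  rfl

/-- A homomorphism from the Koszul resolution as a linear map. -/
def koszulLin {s i : ℕ}
    (f : (powResolution k n s).complex.X i ⟶ ModuleCat.of (MvPolynomial (Fin n) k) M) :
    cardSupported (n := n) (MvPolynomial (Fin n) k) (MvPolynomial (Fin n) k) i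
      →ₗ[MvPolynomial (Fin n) k] M :=
  f.hom

lemma koszulLin_comp_d {s i : ℕ}
    (f : (powResolution k n s).complex.X i ⟶ ModuleCat.of (MvPolynomial (Fin n) k) M) :
    koszulLin ((powResolution k n s).complex.d (i + 1) i ≫ f) =
      koszulLin f ∘ₗ koszulDiff (varPow k n s) i := by
  change koszulLin ((koszulComplex (varPow k n s)).d (i + 1) i ≫ f) = _
  rw [koszulComplex_d]
  rfl

variable (k) in
/-- The homomorphism from the Koszul resolution given by a cochain. -/
def koszulHom (s i : ℕ) (c : Finset (Fin n) → M) :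
    (powResolution k n s).complex.X i ⟶ ModuleCat.of (MvPolynomial (Fin n) k) M :=
  ModuleCat.ofHom (koszulPair (MvPolynomial (Fin n) k) M i c)

lemma koszulHom_zero (s i : ℕ) : koszulHom k s i (0 : Finset (Fin n) → M) = 0 := by
  rw [koszulHom, map_zero]
  rfl

lemma koszulPair_mem_homCocycles {s i : ℕ} {c : Finset (Fin n) → M}
    (hc : c ∈ koszulCocycles k n M s i) :
    koszulHom k s i c ∈
      homCocycles (powResolution k n s) i (ModuleCat.of _ M) := by
  rw [mem_homCocycles]
  change (koszulComplex (varPow k n s)).d (i + 1) i ≫ _ = 0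
  rw [koszulComplex_d]
  ext q : 2
  exact LinearMap.congr_fun ((koszulPair_comp_eq_zero_iff (varPow k n s) hc.1).2 hc.2) q

/-- The homomorphism from the Koszul resolution given by a Koszul cocycle. -/
def koszulToHomCocycles (s i : ℕ) : koszulCocycles k n M s i →ₗ[MvPolynomial (Fin n) k]
    homCocycles (powResolution k n s) i (ModuleCat.of _ M) where
  toFun c := ⟨koszulHom k s i c.1, koszulPair_mem_homCocycles c.2⟩
  map_add' c c' := Subtype.ext (by
    ext q : 2
    exact LinearMap.congr_fun (map_add (koszulPair _ M i) c.1 c'.1) q)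
  map_smul' a c := Subtype.ext (by
    ext q : 2
    exact LinearMap.congr_fun (map_smul (koszulPair _ M i) a c.1) q)

/-- The local cohomology class of a Koszul cocycle. -/
def koszulClass (s i : ℕ) : koszulCocycles k n M s i →ₗ[MvPolynomial (Fin n) k]
    LocalCohomology (k := k) (n := n) M i :=
  (extToLocalCohomology M (powIdeal k n s) i _ (exists_pow_le_powIdeal s).choose_spec).hom ∘ₗ
    extClass (powResolution k n s) i (ModuleCat.of _ M) ∘ₗ koszulToHomCocycles s i

lemma koszulClass_apply {s i : ℕ} (c : koszulCocycles k n M s i) :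
    koszulClass s i c = extToLocalCohomology M (powIdeal k n s) i _
      (exists_pow_le_powIdeal s).choose_spec
      (extClass (powResolution k n s) i (ModuleCat.of _ M)
        ⟨koszulHom k s i c.1, koszulPair_mem_homCocycles c.2⟩) := rfl

/-- The transition maps between Koszul cochains of different powers of the variables. -/
def cochainTransition (s t : ℕ) (c : Finset (Fin n) → M) : Finset (Fin n) → M :=
  fun σ => (∏ l ∈ σ, varPow k n (t - s) l) • c σ

lemma koszulδ_cochainTransition {s t : ℕ} (h : s ≤ t) (c : Finset (Fin n) → M) :
    koszulδ M (varPow k n t) (cochainTransition (k := k) s t c) =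
      cochainTransition (k := k) s t (koszulδ M (varPow k n s) c) := by
  ext τ
  simp only [cochainTransition, koszulδ_apply, Finset.smul_sum]
  refine Finset.sum_congr rfl fun l hl => ?_
  have : varPow k n t l = varPow k n s l * varPow k n (t - s) l := by
    rw [varPow, varPow, varPow, ← pow_add, Nat.add_sub_cancel' h]
  rw [smul_comm _ (kSign l (τ.erase l)), smul_smul, smul_smul, this, mul_assoc,
    Finset.mul_prod_erase τ (varPow k n (t - s)) hl, mul_comm]

lemma cochainTransition_mem {s t i : ℕ} (h : s ≤ t) {c : Finset (Fin n) → M}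
    (hc : c ∈ koszulCocycles k n M s i) :
    cochainTransition (k := k) s t c ∈ koszulCocycles k n M t i := by
  refine ⟨fun σ hσ => ?_, ?_⟩
  · rw [cochainTransition, hc.1 σ hσ, smul_zero]
  · change koszulδ M (varPow k n t) _ = 0
    rw [koszulδ_cochainTransition h, LinearMap.mem_ker.1 hc.2]
    ext σ
    exact smul_zero _

lemma koszulPair_koszulTransition (s t i : ℕ) (c : Finset (Fin n) → M)
    (q : cardSupported (n := n) (MvPolynomial (Fin n) k) (MvPolynomial (Fin n) k) i) :
    koszulPair (MvPolynomial (Fin n) k) M i c (koszulTransition s t i q) =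
      koszulPair (MvPolynomial (Fin n) k) M i (cochainTransition (k := k) s t c) q := by
  rw [koszulPair_apply, koszulPair_apply]
  refine Finset.sum_congr rfl fun σ _ => ?_
  change ((∏ l ∈ σ, varPow k n (t - s) l) * q.1 σ) • c σ =
    q.1 σ • (∏ l ∈ σ, varPow k n (t - s) l) • c σ
  rw [smul_smul, mul_comm]

lemma powTransition_comp {s t : ℕ} (h : s ≤ t) (i : ℕ) (c : Finset (Fin n) → M) :
    (powTransition (k := k) (n := n) h).f i ≫ koszulHom k s i c =
      koszulHom k t i (cochainTransition (k := k) s t c) := by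
  ext q : 2
  exact koszulPair_koszulTransition s t i c q

lemma extProj_extClass {s t : ℕ} (h : s ≤ t) (i : ℕ) {c : Finset (Fin n) → M}
    (hc : c ∈ koszulCocycles k n M s i) :
    extProj (powIdeal_anti h) i (ModuleCat.of _ M)
      (extClass (powResolution k n s) i (ModuleCat.of _ M)
        ⟨koszulHom k s i c, koszulPair_mem_homCocycles hc⟩) =
    extClass (powResolution k n t) i (ModuleCat.of _ M)
        ⟨koszulHom k t i (cochainTransition (k := k) s t c),
          koszulPair_mem_homCocycles (cochainTransition_mem h hc)⟩ := by
  have := extMap_extClass (quotientProj (powIdeal_anti h)) (powResolution k n t)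
    (powResolution k n s) (powTransition h) (powTransition_comm h) (ModuleCat.of _ M) i
    _ (koszulPair_mem_homCocycles hc) (comp_mem_homCocycles _ _ _ (koszulPair_mem_homCocycles hc))
  refine this.trans ?_
  congr 1
  exact Subtype.ext (powTransition_comp h i c)

lemma koszulClass_cochainTransition {s t i : ℕ} (h : s ≤ t) {c : Finset (Fin n) → M}
    (hc : c ∈ koszulCocycles k n M s i) :
    koszulClass t i ⟨cochainTransition (k := k) s t c, cochainTransition_mem h hc⟩ =
      koszulClass s i ⟨c, hc⟩ := by
  rw [koszulClass_apply, koszulClass_apply, ← extProj_extClass h i hc]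
  rw [← extProj_comp_extToLocalCohomology M (powIdeal_anti h) i _ _
    (exists_pow_le_powIdeal t).choose_spec (exists_pow_le_powIdeal s).choose_spec]
  rfl

lemma koszulHom_koszulVal {s i : ℕ}
    (f : (powResolution k n s).complex.X i ⟶ ModuleCat.of (MvPolynomial (Fin n) k) M) :
    koszulHom k s i (koszulVal (koszulLin f)) = f := by
  ext q : 2
  exact LinearMap.congr_fun (koszulPair_koszulVal (koszulLin f)) q

lemma koszulVal_mem_koszulCocycles {s i : ℕ}
    {f : (powResolution k n s).complex.X i ⟶ ModuleCat.of (MvPolynomial (Fin n) k) M}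
    (hf : f ∈ homCocycles (powResolution k n s) i (ModuleCat.of _ M)) :
    koszulVal (koszulLin f) ∈ koszulCocycles k n M s i := by
  refine ⟨koszulVal_mem _, ?_⟩
  change koszulδ M (varPow k n s) _ = 0
  rw [← koszulVal_comp_koszulDiff, ← koszulLin_comp_d, mem_homCocycles.1 hf]
  rfl

lemma koszulClass_eq_zero_of_koszulδ {s i : ℕ} {c b : Finset (Fin n) → M}
    (hc : c ∈ koszulCocycles k n M s i) (hb : ∀ σ, σ.card + 1 ≠ i → b σ = 0)
    (hbc : koszulδ M (varPow k n s) b = c) : koszulClass s i ⟨c, hc⟩ = 0 := by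
  rw [koszulClass_apply, (extClass_eq_zero_iff _ _ _ _).2, map_zero]
  refine ⟨koszulHom k s (i - 1) b, ?_⟩
  cases i with
  | zero =>
    -- No set satisfies `σ.card + 1 = 0`, so the support condition leaves only the zero cochain.
    obtain rfl : b = 0 := funext fun σ => hb σ (by omega)
    rw [map_zero] at hbc
    subst hbc
    change _ ≫ koszulHom k s (0 - 1) 0 = koszulHom k s 0 0
    rw [koszulHom_zero, Limits.comp_zero]
  | succ i =>
    change (koszulComplex (varPow k n s)).d (i + 1) i ≫ _ = _
    rw [koszulComplex_d]
    subst hbc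
    ext q : 2
    exact koszulPair_koszulDiff (varPow k n s) i b q

lemma exists_koszulδ_of_extClass_eq_zero {s i : ℕ} {c : Finset (Fin n) → M}
    (hc : c ∈ koszulCocycles k n M s i)
    (h : extClass (powResolution k n s) i (ModuleCat.of _ M)
        ⟨koszulHom k s i c, koszulPair_mem_homCocycles hc⟩ = 0) :
    ∃ b : Finset (Fin n) → M, (∀ σ, σ.card + 1 ≠ i → b σ = 0) ∧
      koszulδ M (varPow k n s) b = c := by
  obtain ⟨g, hg⟩ := (extClass_eq_zero_iff _ _ _ _).1 h
  cases i with
  | zero =>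
    refine ⟨0, fun _ _ => rfl, ?_⟩
    rw [map_zero, ← koszulVal_koszulPair hc.1]
    -- In degree zero, `i - 1` is again `0` and the differential from `0` to `0` vanishes, so the
    -- cocycle itself is zero.
    rw [HomologicalComplex.shape _ _ _ (by simp), Limits.zero_comp] at hg
    have : koszulPair (MvPolynomial (Fin n) k) M 0 c = 0 :=
      (congrArg ModuleCat.Hom.hom hg).symm
    rw [this]
    rfl
  | succ i =>
    refine ⟨koszulVal (koszulLin (i := i) g), fun σ hσ =>
      koszulVal_mem (koszulLin (i := i) g) σ (by omega), ?_⟩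
    rw [← koszulVal_comp_koszulDiff, ← koszulLin_comp_d]
    refine (congrArg (fun f => koszulVal (koszulLin f)) hg).trans ?_
    exact koszulVal_koszulPair hc.1

variable {ℳ : (Fin n → ℤ) → AddSubgroup M}

/-- The Koszul cochains that are homogeneous of degree `α`. -/
def IsHomogeneousCochain (ℳ : (Fin n → ℤ) → AddSubgroup M) (s : ℕ) (α : Fin n → ℤ)
    (c : Finset (Fin n) → M) : Prop :=
  ∀ σ, c σ ∈ ℳ (α + sDeg s σ)

lemma IsHomogeneousCochain.koszulδ (hℳ : IsMultigrading (k := k) ℳ) {s : ℕ} {α : Fin n → ℤ}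
    {c : Finset (Fin n) → M} (hc : IsHomogeneousCochain ℳ s α c) :
    IsHomogeneousCochain ℳ s α (koszulδ M (varPow k n s) c) := fun τ => by
  rw [koszulδ_apply]
  refine sum_mem fun l hl => zsmul_mem ?_ _
  have := hℳ.smul_mem (varPow_mem s l) (hc (τ.erase l))
  rwa [add_comm, add_assoc, ← sDeg_insert s (by simp), Finset.insert_erase hl] at this

variable (k) in
/-- The transition maps of the Koszul cochain complexes are bijective in degree `α`, from the
`s`-th powers of the variables on. -/
def IsStableDegree (ℳ : (Fin n → ℤ) → AddSubgroup M) (s : ℕ) (α : Fin n → ℤ) : Prop :=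
  ∀ (σ : Finset (Fin n)) (t : ℕ), s ≤ t →
    Set.BijOn (fun v => (∏ l ∈ σ, varPow k n (t - s) l) • v) (ℳ (α + sDeg s σ) : Set M)
      (ℳ (α + sDeg t σ))

lemma IsStableDegree.eq_of_cochainTransition_eq {s t : ℕ} {α : Fin n → ℤ}
    (hst : IsStableDegree k ℳ s α) (h : s ≤ t) {c c' : Finset (Fin n) → M}
    (hc : IsHomogeneousCochain ℳ s α c) (hc' : IsHomogeneousCochain ℳ s α c')
    (heq : cochainTransition (k := k) s t c = cochainTransition (k := k) s t c') : c = c' :=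
  funext fun σ => (hst σ t h).injOn (hc σ) (hc' σ) (congrFun heq σ)

lemma IsStableDegree.exists_cochainTransition_eq {s t : ℕ} {α : Fin n → ℤ}
    (hst : IsStableDegree k ℳ s α) (h : s ≤ t) {c : Finset (Fin n) → M}
    (hc : IsHomogeneousCochain ℳ t α c) :
    ∃ c', IsHomogeneousCochain ℳ s α c' ∧ cochainTransition (k := k) s t c' = c ∧
      ∀ σ, c σ = 0 → c' σ = 0 := by
  choose c' hc' h' using fun σ => (hst σ t h).surjOn (hc σ)
  refine ⟨c', hc', funext h', fun σ hσ => ?_⟩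
  refine (hst σ t h).injOn (hc' σ) (zero_mem _) ?_
  exact (h' σ).trans (hσ.trans (smul_zero _).symm)

/-- The descended cochain is a cocycle because its coboundary is killed by a transition map that is
injective in degree `α`. -/
lemma IsStableDegree.exists_mem_koszulCocycles (hℳ : IsMultigrading (k := k) ℳ) {s t i : ℕ}
    {α : Fin n → ℤ} (hst : IsStableDegree k ℳ s α) (h : s ≤ t) {c : Finset (Fin n) → M}
    (hc : IsHomogeneousCochain ℳ t α c) (hcc : c ∈ koszulCocycles k n M t i) :
    ∃ c' ∈ koszulCocycles k n M s i, IsHomogeneousCochain ℳ s α c' ∧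
      cochainTransition (k := k) s t c' = c := by
  obtain ⟨c', hc', h', h0⟩ := hst.exists_cochainTransition_eq h hc
  refine ⟨c', ⟨fun σ hσ => h0 σ (hcc.1 σ hσ), ?_⟩, hc', h'⟩
  refine hst.eq_of_cochainTransition_eq h (hc'.koszulδ hℳ) (fun _ => zero_mem _) ?_
  rw [← koszulδ_cochainTransition h, h', LinearMap.mem_ker.1 hcc.2]
  ext σ
  exact (smul_zero _).symm

/-- The differential preserves degree, so the degree `α` part of a primitive of a homogeneous
cochain is again a primitive. -/
lemma exists_homogeneous_koszulδ (hℳ : IsMultigrading (k := k) ℳ) {s i : ℕ} {α : Fin n → ℤ}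
    {b c : Finset (Fin n) → M} (hb : ∀ σ, σ.card + 1 ≠ i → b σ = 0)
    (hc : IsHomogeneousCochain ℳ s α c) (hbc : koszulδ M (varPow k n s) b = c) :
    ∃ b' : Finset (Fin n) → M, (∀ σ, σ.card + 1 ≠ i → b' σ = 0) ∧
      IsHomogeneousCochain ℳ s α b' ∧ koszulδ M (varPow k n s) b' = c := by
  obtain ⟨p, hp⟩ := exists_isProjFamily hℳ.isInternal
  refine ⟨fun σ => p (α + sDeg s σ) (b σ), fun σ hσ =>
    (congrArg _ (hb σ hσ)).trans (map_zero _),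
    fun σ => hp.mem _ _, ?_⟩
  ext τ
  have hcτ := hp.self _ _ (hc τ)
  rw [← hcτ, ← hbc, koszulδ_apply, koszulδ_apply, map_sum]
  refine Finset.sum_congr rfl fun l hl => ?_
  rw [map_zsmul]
  congr 1
  have := hp.map_comm hp (DistribSMul.toAddMonoidHom M (varPow k n s l))
    (fun γ => γ + s • Pi.single l 1) (add_left_injective _)
    (fun γ v hv => by
      rw [add_comm]
      exact hℳ.smul_mem (varPow_mem s l) hv) (α + sDeg s (τ.erase l)) (b (τ.erase l))
  simp only [add_assoc, ← sDeg_insert s (Finset.notMem_erase l τ), Finset.insert_erase hl] at this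
  exact this.symm

/-- A class that dies in the limit dies over `A/𝔪ᵗ` for some `t`, hence over the `r`-th powers of
the variables with `r = max s t`, where it acquires a primitive. Its degree `α` part is pulled back
to level `s` by stability, and injectivity of the transition transports the equation. -/
lemma koszulClass_eq_zero_iff (hℳ : IsMultigrading (k := k) ℳ) {s i : ℕ} {α : Fin n → ℤ}
    (hst : IsStableDegree k ℳ s α) {c : Finset (Fin n) → M} (hcc : c ∈ koszulCocycles k n M s i)
    (hc : IsHomogeneousCochain ℳ s α c) :
    koszulClass s i ⟨c, hcc⟩ = 0 ↔ ∃ b : Finset (Fin n) → M, (∀ σ, σ.card + 1 ≠ i → b σ = 0) ∧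
      IsHomogeneousCochain ℳ s α b ∧ koszulδ M (varPow k n s) b = c := by
  constructor
  · intro h
    rw [koszulClass_apply] at h
    obtain ⟨t, ht, h0⟩ := exists_extProj_eq_zero M (powIdeal k n s) i
      (exists_pow_le_powIdeal s).choose (exists_pow_le_powIdeal s).choose_spec _ h
    let r := max s t
    have hr : s ≤ r := le_max_left s t
    have hle : powIdeal k n r ≤ irrelevantIdeal k n ^ t :=
      (powIdeal_le_pow r).trans (Ideal.pow_le_pow_right (le_max_right s t))
    have h1 : extProj (powIdeal_anti hr) i (ModuleCat.of _ M)
      (extClass (powResolution k n s) i (ModuleCat.of _ M)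
        ⟨koszulHom k s i c, koszulPair_mem_homCocycles hcc⟩) = 0 := by
      have e := extProj_comp hle ht i (ModuleCat.of _ M)
      have e' : extProj (powIdeal_anti hr) i (ModuleCat.of _ M) =
        extProj (hle.trans ht) i (ModuleCat.of _ M) := rfl
      rw [e', ← e, ModuleCat.comp_apply]
      refine (congrArg (extProj hle i (ModuleCat.of _ M)) h0).trans ?_
      exact map_zero _
    rw [extProj_extClass hr i hcc] at h1
    have hc' : IsHomogeneousCochain ℳ r α (cochainTransition (k := k) s r c) :=
      fun σ => (hst σ r hr).mapsTo (hc σ)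
    obtain ⟨b, hb, hbc⟩ := exists_koszulδ_of_extClass_eq_zero (cochainTransition_mem hr hcc) h1
    obtain ⟨b, hb, hb', hbc⟩ := exists_homogeneous_koszulδ hℳ hb hc' hbc
    obtain ⟨b', hb'', htr, h0⟩ := hst.exists_cochainTransition_eq hr hb'
    refine ⟨b', fun σ hσ => h0 σ (hb σ hσ), hb'', ?_⟩
    refine hst.eq_of_cochainTransition_eq hr (hb''.koszulδ hℳ) hc ?_
    rw [← koszulδ_cochainTransition hr, htr, hbc]
  · rintro ⟨b, hb, _, hbc⟩
    exact koszulClass_eq_zero_of_koszulδ hcc hb hbc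

/-- For `r = max s t` the ideal of `r`-th powers lies in `𝔪ᵗ ≤ J`. Composing the cocycle with a
graded lift of the projection yields a homogeneous Koszul cocycle at level `r`, which descends to
level `s` by stability. -/
lemma exists_koszulClass_eq (hℳ : IsMultigrading (k := k) ℳ) {s i : ℕ} {α : Fin n → ℤ}
    (hst : IsStableDegree k ℳ s α) (J : Ideal (MvPolynomial (Fin n) k)) (t : ℕ)
    (hJ : irrelevantIdeal k n ^ t ≤ J) (e : ((Ext (MvPolynomial (Fin n) k)
      (ModuleCat.{u} (MvPolynomial (Fin n) k)) i).obj
      (op (ModuleCat.of _ (MvPolynomial (Fin n) k ⧸ J)))).obj (ModuleCat.of _ M))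
    (hgr : IsMultigrading (k := k) (quotientGrading J)) (he : IsHomogeneousExt M ℳ J i α e) :
    ∃ (c : Finset (Fin n) → M) (hc : c ∈ koszulCocycles k n M s i),
      IsHomogeneousCochain ℳ s α c ∧
      extToLocalCohomology M J i t hJ e = koszulClass s i ⟨c, hc⟩ := by
  obtain ⟨F, f, hf, hfα, rfl⟩ := (isHomogeneousExt_iff M ℳ J i α e).1 he
  let r := max s t
  have hr : s ≤ r := le_max_left s t
  have hle : powIdeal k n r ≤ J :=
    ((powIdeal_le_pow r).trans (Ideal.pow_le_pow_right (le_max_right s t))).trans hJ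
  obtain ⟨φ, hφ, hφgr⟩ := exists_gradedLift F hgr hle
  have hf' := comp_mem_homCocycles (powResolution k n r) F.res φ hf
  have hcc := koszulVal_mem_koszulCocycles hf'
  have hc : IsHomogeneousCochain ℳ r α (koszulVal (koszulLin (φ.f i ≫ f))) := fun σ => by
    rw [add_comm]
    exact hfα _ _ (hφgr i _ _ (koszulGen_mem_koszulGr r i σ))
  obtain ⟨c, hcc', hc', htr⟩ := hst.exists_mem_koszulCocycles hℳ hr hc hcc
  refine ⟨c, hcc', hc', ?_⟩
  rw [← koszulClass_cochainTransition hr hcc', koszulClass_apply]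
  have h1 := extMap_extClass (quotientProj hle) (powResolution k n r) F.res φ hφ
    (ModuleCat.of _ M) i f hf hf'
  have h2 : (⟨koszulHom k r i (cochainTransition (k := k) s r c),
      koszulPair_mem_homCocycles (cochainTransition_mem hr hcc')⟩ :
      homCocycles (powResolution k n r) i (ModuleCat.of _ M)) = ⟨φ.f i ≫ f, hf'⟩ :=
    Subtype.ext ((congrArg (koszulHom k r i) htr).trans (koszulHom_koszulVal _))
  rw [h2, ← h1, ← extProj_comp_extToLocalCohomology M hle i _ t
    (exists_pow_le_powIdeal r).choose_spec hJ]
  rfl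

/-- The classes on the right are already closed under sums and scalars, so the span in the
definition adds nothing. Conversely, the ideal of `s`-th powers with its Koszul resolution is an
admissible choice there. -/
lemma mem_localCohomologyPiece_iff (hℳ : IsMultigrading (k := k) ℳ) {s i : ℕ} {α : Fin n → ℤ}
    (hst : IsStableDegree k ℳ s α) (h : RestrictScalars k (MvPolynomial (Fin n) k)
      (LocalCohomology (k := k) (n := n) M i)) :
    h ∈ localCohomologyPiece k M ℳ i α ↔
      ∃ (c : Finset (Fin n) → M) (hc : c ∈ koszulCocycles k n M s i),
        IsHomogeneousCochain ℳ s α c ∧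
        h = (RestrictScalars.addEquiv k (MvPolynomial (Fin n) k) _).symm
          (koszulClass s i ⟨c, hc⟩) := by
  constructor
  · intro hh
    induction hh using Submodule.span_induction with
    | mem h hh =>
      obtain ⟨J, t, hJ, e, hgr, he, rfl⟩ := hh
      obtain ⟨c, hcc, hc, h⟩ := exists_koszulClass_eq hℳ hst J t hJ e hgr he
      exact ⟨c, hcc, hc, by rw [h]⟩
    | zero =>
      refine ⟨0, zero_mem _, fun _ => zero_mem _, ?_⟩
      rw [show (⟨0, zero_mem _⟩ : koszulCocycles k n M s i) = 0 from rfl, map_zero, map_zero]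
    | add x y _ _ hx hy =>
      obtain ⟨c, hcc, hc, rfl⟩ := hx
      obtain ⟨c', hcc', hc', rfl⟩ := hy
      refine ⟨c + c', add_mem hcc hcc', fun σ => add_mem (hc σ) (hc' σ), ?_⟩
      rw [← map_add, ← map_add]
      rfl
    | smul a x _ hx =>
      obtain ⟨c, hcc, hc, rfl⟩ := hx
      refine ⟨(MvPolynomial.C a : MvPolynomial (Fin n) k) • c, Submodule.smul_mem _ _ hcc,
        fun σ => hℳ.C_smul_mem a _ _ (hc σ), ?_⟩
      rw [show (⟨(MvPolynomial.C a : MvPolynomial (Fin n) k) • c, Submodule.smul_mem _ _ hcc⟩ :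
          koszulCocycles k n M s i) = (MvPolynomial.C a : MvPolynomial (Fin n) k) •
            (⟨c, hcc⟩ : koszulCocycles k n M s i) from rfl, map_smul]
      exact (RestrictScalars.addEquiv_symm_map_algebraMap_smul _ _ _ _ _).symm
  · rintro ⟨c, hcc, hc, rfl⟩
    refine Submodule.subset_span ⟨powIdeal k n s, _, (exists_pow_le_powIdeal s).choose_spec,
      extClass (powResolution k n s) i (ModuleCat.of _ M)
        ⟨koszulHom k s i c, koszulPair_mem_homCocycles hcc⟩,
      quotientGrading_isMultigrading _ (fun β p hp => polyProj_mem_powIdeal s β hp),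
      (isHomogeneousExt_iff M ℳ _ i α _).2 ⟨powGradedResolution k n s, koszulHom k s i c,
        koszulPair_mem_homCocycles hcc, fun β q hq => koszulPair_mem hℳ hc hq, rfl⟩, rfl⟩

end LocalCohomologyKoszul

/-! ### Faces of a simplicial poset and their supports. -/

section Combinatorics

variable {P : Type*} [PartialOrder P] [OrderBot P] {n : ℕ} (x : Fin n ≃ Vertex P)

lemma mem_supp {x : Fin n ≃ Vertex P} {y : P} {j : Fin n} : j ∈ supp x y ↔ (x j : P) ≤ y := by
  simp [supp]

lemma supp_mono {a b : P} (h : a ≤ b) : supp x a ⊆ supp x b := fun _ hj =>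
  mem_supp.2 ((mem_supp.1 hj).trans h)

lemma supp_bot : supp x (⊥ : P) = ∅ := by
  ext j
  simp only [mem_supp, Finset.notMem_empty, iff_false, le_bot_iff]
  exact (x j).2.1

lemma supp_vertex (j : Fin n) : supp x (x j : P) = {j} := by
  ext l
  rw [mem_supp, Finset.mem_singleton]
  constructor
  · intro h
    rcases (x j).2.le_iff.1 h with h' | h'
    · exact absurd h' (x l).2.1
    · exact x.injective (Subtype.ext h')
  · rintro rfl; exact le_rfl

lemma supp_isGLB {w y m : P} (hm : IsGLB {w, y} m) : supp x m = supp x w ∩ supp x y := by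
  ext j
  rw [Finset.mem_inter, mem_supp, mem_supp, mem_supp, isGLB_iff_le_iff.1 hm (x j : P),
    mem_lowerBounds]
  simp

variable [Finite P] {x}

/-- The lower intervals of a simplicial poset are the lattices of subsets of their supports. -/
lemma exists_atoms (hP : IsSimplicial P) (y : P) :
    ∃ (m : ℕ) (e : Set.Icc (⊥ : P) y ≃o Finset (Fin m)) (g : Fin m → Fin n),
      ∀ (a : Set.Icc (⊥ : P) y) (j : Fin n), j ∈ supp x a.1 ↔ ∃ t ∈ e a, g t = j := by
  obtain ⟨m, ⟨e⟩⟩ := hP y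
  have hatom : ∀ t, IsAtom ((e.symm {t}).1 : P) := fun t => by
    refine ⟨fun h => ?_, fun b hb => ?_⟩
    · have h1 : e.symm {t} = ⟨⊥, ⟨le_rfl, bot_le⟩⟩ := Subtype.ext h
      rw [OrderIso.symm_apply_eq] at h1
      have h2 : e ⟨⊥, ⟨le_rfl, bot_le⟩⟩ ≤ ∅ := by
        rw [← OrderIso.le_symm_apply]
        exact bot_le (a := ((e.symm ∅).1 : P))
      rw [← h1] at h2
      simp at h2
    · let b' : Set.Icc (⊥ : P) y := ⟨b, ⟨bot_le, hb.le.trans (e.symm {t}).2.2⟩⟩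
      have h1 : b' < e.symm {t} := hb
      rw [← OrderIso.symm_apply_apply e b', OrderIso.lt_iff_lt, Finset.ssubset_singleton_iff] at h1
      have h2 : b' ≤ ⟨⊥, ⟨le_rfl, bot_le⟩⟩ := by
        rw [← e.le_iff_le, h1]
        exact Finset.empty_subset _
      exact le_bot_iff.1 h2
  -- The singletons correspond to the atoms below `y`; `g` records their labels.
  refine ⟨m, e, fun t => x.symm ⟨_, hatom t⟩, fun a j => ?_⟩
  rw [mem_supp]
  constructor
  · intro h
    let j' : Set.Icc (⊥ : P) y := ⟨x j, ⟨bot_le, h.trans a.2.2⟩⟩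
    have hne : (e j').Nonempty := by
      rw [Finset.nonempty_iff_ne_empty]
      intro h0
      have : j' ≤ ⟨⊥, ⟨le_rfl, bot_le⟩⟩ := by
        rw [← e.le_iff_le, h0]
        exact Finset.empty_subset _
      exact (x j).2.1 (le_bot_iff.1 this)
    obtain ⟨t, ht⟩ := hne
    refine ⟨t, (e.le_iff_le.2 (show j' ≤ a from h)) ht, ?_⟩
    rw [Equiv.symm_apply_eq]
    refine Subtype.ext ?_
    have : e.symm {t} ≤ j' := by
      rw [OrderIso.symm_apply_le]
      simpa using ht
    exact ((x j).2.le_iff.1 this).resolve_left (hatom t).1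
  · rintro ⟨t, ht, rfl⟩
    rw [Equiv.apply_symm_apply]
    have : e.symm {t} ≤ a := by
      rw [OrderIso.symm_apply_le]
      simpa using ht
    exact this

/-- Inside the Boolean interval `[⊥, y]` the order is inclusion of supports. The common upper bound
is essential: distinct faces of a simplicial poset may have the same support. -/
lemma le_of_supp_subset (hP : IsSimplicial P) {a b y : P} (ha : a ≤ y) (hb : b ≤ y)
    (h : supp x a ⊆ supp x b) : a ≤ b := by
  obtain ⟨m, e, g, hg⟩ := exists_atoms (x := x) hP y
  -- The vertex labelled `g t` is the atom `e.symm {t}` itself, so the label determines `t`.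
  have hinj : Function.Injective g := fun t t' htt => by
    have h3 : ∀ t, (x (g t) : P) = (e.symm {t}).1 := fun t => by
      have hle : (x (g t) : P) ≤ (e.symm {t}).1 := mem_supp.1 ((hg _ _).2 ⟨t, by simp, rfl⟩)
      let j' : Set.Icc (⊥ : P) y := ⟨x (g t), ⟨bot_le, hle.trans (e.symm {t}).2.2⟩⟩
      have h4 : j' ≤ e.symm {t} := hle
      rw [OrderIso.le_symm_apply] at h4
      have : (e j').Nonempty := by
        obtain ⟨t', ht', _⟩ := (hg j' (g t)).1 (mem_supp.2 le_rfl)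
        exact ⟨t', ht'⟩
      have h5 : e j' = {t} := this.subset_singleton_iff.1 h4
      rw [← h5, OrderIso.symm_apply_apply]
    have h4 : e.symm {t} = e.symm {t'} := Subtype.ext (by rw [← h3, ← h3, htt])
    simpa using h4
  have : e ⟨a, ⟨bot_le, ha⟩⟩ ≤ e ⟨b, ⟨bot_le, hb⟩⟩ := fun t ht => by
    have := h ((hg ⟨a, ⟨bot_le, ha⟩⟩ (g t)).2 ⟨t, ht, rfl⟩)
    obtain ⟨t', ht', h'⟩ := (hg ⟨b, ⟨bot_le, hb⟩⟩ (g t)).1 this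
    rwa [← hinj h']
  exact e.le_iff_le.1 this

lemma exists_supp_eq (hP : IsSimplicial P) {y : P} {σ : Finset (Fin n)} (hσ : σ ⊆ supp x y) :
    ∃ a ≤ y, supp x a = σ := by
  obtain ⟨m, e, g, hg⟩ := exists_atoms (x := x) hP y
  refine ⟨(e.symm (Finset.univ.filter fun t => g t ∈ σ)).1, (e.symm _).2.2, ?_⟩
  ext j
  rw [hg, OrderIso.apply_symm_apply]
  constructor
  · rintro ⟨t, ht, rfl⟩
    simpa using ht
  · intro hj
    obtain ⟨t, _, rfl⟩ := (hg ⟨y, ⟨bot_le, le_rfl⟩⟩ j).1 (hσ hj)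
    exact ⟨t, by simpa using hj, rfl⟩

lemma eq_of_supp_eq (hP : IsSimplicial P) {a b y : P} (ha : a ≤ y) (hb : b ≤ y)
    (h : supp x a = supp x b) : a = b :=
  le_antisymm (le_of_supp_subset hP ha hb h.subset) (le_of_supp_subset hP hb ha h.superset)

/-- Below any upper bound there is a face whose support is exactly the union, and it is again an
upper bound; so minimality means having no further vertices. -/
lemma mem_minUpperBounds_iff (hP : IsSimplicial P) {w y z : P} :
    z ∈ minUpperBounds w y ↔ w ≤ z ∧ y ≤ z ∧ supp x z = supp x w ∪ supp x y := by
  rw [minUpperBounds, Set.Finite.mem_toFinset, Set.mem_ofPred_eq]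
  constructor
  · rintro ⟨⟨hw, hy⟩, hmin⟩
    obtain ⟨u, hu, hsu⟩ := exists_supp_eq hP
      (Finset.union_subset (supp_mono x hw) (supp_mono x hy))
    have h1 : w ≤ u := le_of_supp_subset hP hw hu (hsu ▸ Finset.subset_union_left)
    have h2 : y ≤ u := le_of_supp_subset hP hy hu (hsu ▸ Finset.subset_union_right)
    exact ⟨hw, hy, by rw [← hsu, le_antisymm hu (hmin ⟨h1, h2⟩ hu)]⟩
  · rintro ⟨hw, hy, h⟩
    refine ⟨⟨hw, hy⟩, fun b hb hbz => le_of_supp_subset hP (x := x) le_rfl hbz ?_⟩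
    rw [h]
    exact Finset.union_subset (supp_mono x hb.1) (supp_mono x hb.2)

lemma exists_mem_minUpperBounds (hP : IsSimplicial P) (x : Fin n ≃ Vertex P) {w y z : P}
    (hw : w ≤ z) (hy : y ≤ z) : ∃ u ∈ minUpperBounds w y, u ≤ z := by
  obtain ⟨u, hu, hsu⟩ := exists_supp_eq hP
    (Finset.union_subset (supp_mono x hw) (supp_mono x hy))
  exact ⟨u, (mem_minUpperBounds_iff hP).2
    ⟨le_of_supp_subset hP hw hu (hsu ▸ Finset.subset_union_left),
      le_of_supp_subset hP hy hu (hsu ▸ Finset.subset_union_right), hsu⟩, hu⟩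

lemma exists_isGLB (hP : IsSimplicial P) (x : Fin n ≃ Vertex P) {w y z : P} (hw : w ≤ z)
    (hy : y ≤ z) : ∃ m, IsGLB {w, y} m := by
  obtain ⟨m, hm, hsm⟩ := exists_supp_eq hP (y := z) (σ := supp x w ∩ supp x y)
    (Finset.inter_subset_left.trans (supp_mono x hw))
  refine ⟨m, ?_, fun l hl => ?_⟩
  · rintro b (rfl | rfl)
    · exact le_of_supp_subset hP hm hw (hsm ▸ Finset.inter_subset_left)
    · exact le_of_supp_subset hP hm hy (hsm ▸ Finset.inter_subset_right)
  · have h1 : l ≤ w := hl (by simp)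
    have h2 : l ≤ y := hl (by simp)
    exact le_of_supp_subset hP (h1.trans hw) hm
      (hsm ▸ Finset.subset_inter (supp_mono x h1) (supp_mono x h2))

end Combinatorics

/-! ### Restriction to faces and the straightening rule. -/

section FaceRingStructure

variable {k : Type u} [Field k] {P : Type u} [PartialOrder P] [OrderBot P] {n : ℕ}
  (x : Fin n ≃ Vertex P)

/-- The exponent of the squarefree monomial with a given support. -/
def finExp (σ : Finset (Fin n)) : Fin n →₀ ℕ := ∑ j ∈ σ, Finsupp.single j 1

lemma finExp_apply (σ : Finset (Fin n)) (j : Fin n) : finExp σ j = if j ∈ σ then 1 else 0 := by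
  simp [finExp, Finsupp.single_apply]

lemma support_finExp (σ : Finset (Fin n)) : (finExp σ).support = σ := by
  ext j; simp [finExp_apply]

lemma monomial_finExp (σ : Finset (Fin n)) :
    MvPolynomial.monomial (finExp σ) (1 : k) = ∏ j ∈ σ, MvPolynomial.X j := by
  rw [finExp, MvPolynomial.monomial_sum_one]
  rfl

lemma finExp_union_add_inter (σ τ : Finset (Fin n)) :
    finExp (σ ∪ τ) + finExp (σ ∩ τ) = finExp σ + finExp τ := by
  ext j
  simp only [Finsupp.add_apply, finExp_apply, Finset.mem_union, Finset.mem_inter]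
  by_cases h : j ∈ σ <;> by_cases h' : j ∈ τ <;> simp [h, h']

variable (k) in
open Classical in
/-- The restrictions of the generators of the face ring to the faces. -/
def restrictGen (w y : P) : MvPolynomial (Fin n) k :=
  if w ≤ y then MvPolynomial.monomial (finExp (supp x w)) 1 else 0

variable (k) in
/-- The restriction of polynomials to the faces. -/
def restrictPoly : MvPolynomial P k →ₐ[k] (P → MvPolynomial (Fin n) k) :=
  MvPolynomial.aeval (restrictGen k x)

lemma restrictPoly_X (w y : P) : restrictPoly k x (MvPolynomial.X w) y = restrictGen k x w y := by
  rw [restrictPoly, MvPolynomial.aeval_X]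

lemma faceDegree_eq (y : P) : faceDegree x y = sDeg 1 (supp x y) := by
  ext j
  rw [faceDegree, sDeg, Nat.cast_one]
  by_cases h : (x j : P) ≤ y
  · rw [if_pos h, if_pos (mem_supp.2 h)]
  · rw [if_neg h, if_neg fun h' => h (mem_supp.1 h')]

variable [Finite P]

/-- If `w, y ≤ z`, exactly one minimal upper bound of `w` and `y` lies below `z`, and the relation
restricts to `x^S x^T = x^{S ∩ T} x^{S ∪ T}`. Otherwise no upper bound lies below `z` and both sides
restrict to zero. -/
lemma faceIdeal_le_ker (hP : IsSimplicial P) :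
    faceIdeal k P ≤ RingHom.ker (restrictPoly k x) := by
  refine Ideal.span_le.2 ?_
  rintro p ((⟨w, y, h, rfl⟩ | ⟨w, y, m, ⟨u, hu⟩, hm, rfl⟩) | rfl)
  · refine RingHom.mem_ker.2 (funext fun z => ?_)
    rw [map_mul, Pi.mul_apply, restrictPoly_X, restrictPoly_X]
    by_cases hw : w ≤ z
    · by_cases hy : y ≤ z
      · obtain ⟨u, hu, _⟩ := exists_mem_minUpperBounds hP x hw hy
        rw [h] at hu
        simp at hu
      · rw [restrictGen, restrictGen, if_neg hy, mul_zero]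
        rfl
    · rw [restrictGen, if_neg hw, zero_mul]
      rfl
  · refine RingHom.mem_ker.2 (funext fun z => ?_)
    rw [map_sub, map_mul, map_mul, Pi.sub_apply, Pi.mul_apply, Pi.mul_apply, map_sum,
      Finset.sum_apply]
    simp only [restrictPoly_X, Pi.zero_apply]
    rw [sub_eq_zero]
    by_cases hwy : w ≤ z ∧ y ≤ z
    · obtain ⟨v, hv, hvz⟩ := exists_mem_minUpperBounds hP x hwy.1 hwy.2
      have hv' := (mem_minUpperBounds_iff (x := x) hP).1 hv
      rw [Finset.sum_eq_single v]
      · rw [restrictGen, restrictGen, restrictGen, restrictGen, if_pos hwy.1, if_pos hwy.2,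
          if_pos hvz, if_pos ((hm.1 (by simp)).trans hwy.1), MvPolynomial.monomial_mul,
          MvPolynomial.monomial_mul, supp_isGLB x hm, hv'.2.2, ← finExp_union_add_inter, add_comm]
      · intro v' hv'' hne
        rw [restrictGen, if_neg]
        intro h
        refine hne (eq_of_supp_eq (x := x) hP h hvz ?_)
        rw [hv'.2.2, ((mem_minUpperBounds_iff (x := x) hP).1 hv'').2.2]
      · intro h; exact absurd hv h
    · rw [Finset.sum_eq_zero, mul_zero]
      · rw [not_and_or] at hwy
        rcases hwy with h | h
        · rw [restrictGen, if_neg h, zero_mul]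
        · rw [mul_comm, restrictGen, if_neg h, zero_mul]
      · intro v hv
        rw [mem_minUpperBounds_iff (x := x) hP] at hv
        rw [restrictGen, if_neg]
        exact fun h => hwy ⟨hv.1.trans h, hv.2.1.trans h⟩
  · refine RingHom.mem_ker.2 (funext fun z => ?_)
    rw [map_sub, Pi.sub_apply, restrictPoly_X, map_one, restrictGen, if_pos bot_le, supp_bot,
      monomial_finExp]
    simp

/-- The restriction of elements of the face ring to the faces. -/
def restrictFace (hP : IsSimplicial P) : FaceRing k P →+* (P → MvPolynomial (Fin n) k) :=
  Ideal.Quotient.lift (faceIdeal k P) (restrictPoly k x).toRingHom (faceIdeal_le_ker x hP)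

variable (k) in
/-- The class of a face in the face ring. -/
def faceElt (y : P) : FaceRing k P := Ideal.Quotient.mk _ (MvPolynomial.X y)

lemma faceElt_bot : faceElt k (⊥ : P) = 1 := by
  rw [faceElt, ← map_one (Ideal.Quotient.mk _), Ideal.Quotient.eq]
  exact Ideal.subset_span (Or.inr rfl)

lemma faceElt_mul_eq_zero {w y : P} (h : minUpperBounds w y = ∅) :
    faceElt k w * faceElt k y = 0 := by
  rw [faceElt, faceElt, ← map_mul, Ideal.Quotient.eq_zero_iff_mem]
  exact Ideal.subset_span (Or.inl (Or.inl ⟨w, y, h, rfl⟩))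

lemma faceElt_mul_eq {w y m : P} (h : (minUpperBounds w y).Nonempty) (hm : IsGLB {w, y} m) :
    faceElt k w * faceElt k y = faceElt k m * ∑ z ∈ minUpperBounds w y, faceElt k z := by
  simp only [faceElt]
  rw [← map_mul, ← map_sum, ← map_mul, Ideal.Quotient.eq]
  exact Ideal.subset_span (Or.inl (Or.inr ⟨w, y, m, h, hm, rfl⟩))

variable {x}

/-- Split `u` into a vertex `x_j` and the opposite face `v`. Their meet is `⊥`, so `x_j v` is the
sum of all their minimal upper bounds; those other than `u` share its support, hence have no common
upper bound with `z` and are annihilated by it. -/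
lemma faceElt_mul_of_le (hP : IsSimplicial P) {u z : P} (h : u ≤ z) :
    faceElt k u * faceElt k z = (∏ j ∈ supp x u, faceElt k (x j : P)) * faceElt k z := by
  obtain ⟨σ, hσ⟩ : ∃ σ, supp x u = σ := ⟨_, rfl⟩
  rw [hσ]
  induction σ using Finset.induction_on generalizing u with
  | empty =>
    obtain rfl : u = ⊥ := eq_of_supp_eq (x := x) hP le_rfl bot_le (by rw [hσ, supp_bot])
    rw [faceElt_bot, Finset.prod_empty]
  | insert j τ hj ih =>
    obtain ⟨v, hvu, hv⟩ := exists_supp_eq hP (x := x) (y := u) (σ := τ)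
      (hσ ▸ Finset.subset_insert _ _)
    have hju : (x j : P) ≤ u := mem_supp.1 (hσ ▸ Finset.mem_insert_self _ _)
    have hu : u ∈ minUpperBounds (x j : P) v := by
      rw [mem_minUpperBounds_iff (x := x) hP, supp_vertex, hv, hσ]
      exact ⟨hju, hvu, rfl⟩
    obtain ⟨m, hm⟩ := exists_isGLB hP x hju hvu
    have hm0 : m = ⊥ := by
      refine eq_of_supp_eq (x := x) hP le_rfl bot_le ?_
      rw [supp_isGLB x hm, supp_vertex, hv, supp_bot, Finset.singleton_inter_of_notMem hj]
    subst hm0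
    have h1 := faceElt_mul_eq (k := k) ⟨u, hu⟩ hm
    rw [faceElt_bot, one_mul] at h1
    rw [Finset.prod_insert hj, mul_assoc, ← ih (hvu.trans h) hv, ← mul_assoc, h1, Finset.sum_mul,
      Finset.sum_eq_single u]
    · intro v' hv' hne
      refine faceElt_mul_eq_zero (Finset.eq_empty_iff_forall_notMem.2 fun t ht => ?_)
      rw [mem_minUpperBounds_iff (x := x) hP] at ht hv'
      refine hne (eq_of_supp_eq (x := x) hP ht.1 (h.trans ht.2.1) ?_)
      rw [hv'.2.2, supp_vertex, hv, hσ]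
      rfl
    · intro h; exact absurd hu h

/-- The straightening rule: the meet in the defining relation is replaced by a monomial in the
vertices, so each product of faces is a combination of products of a monomial and one face. -/
lemma faceElt_mul (hP : IsSimplicial P) (w y : P) :
    faceElt k w * faceElt k y =
      ∑ z ∈ minUpperBounds w y, (∏ j ∈ supp x w ∩ supp x y, faceElt k (x j : P)) * faceElt k z := by
  by_cases h : (minUpperBounds w y).Nonempty
  · obtain ⟨z, hz⟩ := h
    have hz' := (mem_minUpperBounds_iff (x := x) hP).1 hz
    obtain ⟨m, hm⟩ := exists_isGLB hP x hz'.1 hz'.2.1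
    rw [faceElt_mul_eq ⟨z, hz⟩ hm, Finset.mul_sum, ← supp_isGLB x hm]
    refine Finset.sum_congr rfl fun v hv => ?_
    rw [mem_minUpperBounds_iff (x := x) hP] at hv
    exact faceElt_mul_of_le hP ((hm.1 (by simp)).trans hv.1)
  · rw [Finset.not_nonempty_iff_eq_empty] at h
    rw [faceElt_mul_eq_zero h, h, Finset.sum_empty]

end FaceRingStructure

/-! ### Coefficients of restrictions, and spanning by standard monomials. -/

section FaceGrading

variable {k : Type u} [Field k] {P : Type u} [PartialOrder P] [OrderBot P] [Finite P] {n : ℕ}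
  (x : Fin n ≃ Vertex P)

/-! ### Restriction of elements of the face ring to faces -/

lemma restrictFace_mk (hP : IsSimplicial P) (p : MvPolynomial P k) :
    restrictFace x hP (Ideal.Quotient.mk _ p) = restrictPoly k x p := rfl

lemma restrictFace_faceElt (hP : IsSimplicial P) (w y : P) :
    restrictFace x hP (faceElt k w) y = restrictGen k x w y := by
  rw [faceElt, restrictFace_mk, restrictPoly_X]

lemma structureMap_X (j : Fin n) : structureMap k x (MvPolynomial.X j) = faceElt k (x j : P) := by
  rw [structureMap, MvPolynomial.aeval_X]
  rfl

lemma structureMap_C (a : k) :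
    structureMap k x (MvPolynomial.C a) = Ideal.Quotient.mk _ (MvPolynomial.C a) := by
  rw [structureMap, MvPolynomial.aeval_C]
  rfl

lemma restrictFace_structureMap_monomial (hP : IsSimplicial P) {m : Fin n →₀ ℕ} {y : P}
    (hm : m.support ⊆ supp x y) (a : k) :
    restrictFace x hP (structureMap k x (MvPolynomial.monomial m a)) y =
      MvPolynomial.monomial m a := by
  rw [MvPolynomial.monomial_eq, map_mul, map_mul, structureMap_C, restrictFace_mk, Pi.mul_apply,
    Finsupp.prod, map_prod, map_prod, Finset.prod_apply]
  congr 1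
  · rw [← MvPolynomial.algebraMap_eq, AlgHom.commutes]
    rfl
  · refine Finset.prod_congr rfl fun j hj => ?_
    rw [map_pow, map_pow, structureMap_X, Pi.pow_apply, restrictFace_faceElt, restrictGen,
      if_pos (mem_supp.1 (hm hj)), supp_vertex, monomial_finExp, Finset.prod_singleton]

variable (k) in
/-- The identification of the face module with the face ring. -/
def toFaceRing : FaceModule k x ≃+ FaceRing k P := AddEquiv.refl _

lemma toFaceRing_smul (p : MvPolynomial (Fin n) k) (v : FaceModule k x) :
    toFaceRing k x (p • v) = structureMap k x p * toFaceRing k x v := rfl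

/-- The coefficients of the restriction of an element of the face ring to the faces. -/
def faceCoeff (hP : IsSimplicial P) (m : Fin n →₀ ℕ) : FaceModule k x →+ (P → k) where
  toFun v y := MvPolynomial.coeff m (restrictFace x hP (toFaceRing k x v) y)
  map_zero' := by
    ext y
    rw [map_zero, map_zero]
    rfl
  map_add' v w := by
    ext y
    rw [map_add, map_add]
    exact MvPolynomial.coeff_add _ _ _

lemma faceCoeff_apply (hP : IsSimplicial P) (m : Fin n →₀ ℕ) (v : FaceModule k x) (y : P) :
    faceCoeff x hP m v y = MvPolynomial.coeff m (restrictFace x hP (toFaceRing k x v) y) := rfl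

variable (k) in
open Classical in
/-- The substitution of zero for the variables outside of a set. -/
def killVars (σ : Finset (Fin n)) : MvPolynomial (Fin n) k →ₐ[k] MvPolynomial (Fin n) k :=
  MvPolynomial.aeval fun j => if j ∈ σ then MvPolynomial.X j else 0

lemma killVars_monomial_of_subset {σ : Finset (Fin n)} {m : Fin n →₀ ℕ} (h : m.support ⊆ σ)
    (a : k) : killVars k σ (MvPolynomial.monomial m a) = MvPolynomial.monomial m a := by
  rw [killVars, MvPolynomial.aeval_monomial, MvPolynomial.monomial_eq, MvPolynomial.algebraMap_eq]
  congr 1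
  exact Finset.prod_congr rfl fun j hj => congrArg (· ^ m j) (if_pos (h hj))

lemma killVars_monomial_of_not_subset {σ : Finset (Fin n)} {m : Fin n →₀ ℕ} (h : ¬ m.support ⊆ σ)
    (a : k) : killVars k σ (MvPolynomial.monomial m a) = 0 := by
  obtain ⟨j, hj, hjσ⟩ := Finset.not_subset.1 h
  rw [killVars, MvPolynomial.aeval_monomial, Finsupp.prod, Finset.prod_eq_zero hj, mul_zero]
  rw [if_neg hjσ, zero_pow (Finsupp.mem_support_iff.1 hj)]

lemma coeff_killVars {σ : Finset (Fin n)} {m : Fin n →₀ ℕ} (h : m.support ⊆ σ)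
    (p : MvPolynomial (Fin n) k) :
    MvPolynomial.coeff m (killVars k σ p) = MvPolynomial.coeff m p := by
  classical
  induction p using MvPolynomial.induction_on' with
  | monomial m' c =>
    by_cases h' : m'.support ⊆ σ
    · rw [killVars_monomial_of_subset h']
    · rw [killVars_monomial_of_not_subset h', MvPolynomial.coeff_zero, MvPolynomial.coeff_monomial,
        if_neg]
      rintro rfl
      exact h' h
  | add p q hp hq => rw [map_add, MvPolynomial.coeff_add, MvPolynomial.coeff_add, hp, hq]

/-- Among faces `w ≤ z`, those with `w ≤ y` are exactly those whose monomial avoids the variables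
outside `supp y`; so killing these variables passes from `z` to `y`. It is enough to check
generators. -/
lemma restrictFace_of_le (hP : IsSimplicial P) {y z : P} (h : y ≤ z) (v : FaceRing k P) :
    restrictFace x hP v y = killVars k (supp x y) (restrictFace x hP v z) := by
  obtain ⟨p, rfl⟩ := Ideal.Quotient.mk_surjective v
  rw [restrictFace_mk]
  have : (Pi.evalAlgHom k (fun _ : P => MvPolynomial (Fin n) k) y).comp (restrictPoly k x) =
      ((killVars k (supp x y)).comp
        (Pi.evalAlgHom k (fun _ : P => MvPolynomial (Fin n) k) z)).comp (restrictPoly k x) := by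
    refine MvPolynomial.algHom_ext fun w => ?_
    change restrictPoly k x (MvPolynomial.X w) y =
      killVars k (supp x y) (restrictPoly k x (MvPolynomial.X w) z)
    rw [restrictPoly_X, restrictPoly_X, restrictGen, restrictGen]
    by_cases hw : w ≤ y
    · rw [if_pos hw, if_pos (hw.trans h), killVars_monomial_of_subset]
      rw [support_finExp]
      exact supp_mono x hw
    · rw [if_neg hw]
      split_ifs with hwz
      · rw [killVars_monomial_of_not_subset]
        rw [support_finExp]
        exact fun hs => hw (le_of_supp_subset hP hwz h hs)
      · rw [map_zero]
  exact DFunLike.congr_fun this p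

lemma faceCoeff_of_le (hP : IsSimplicial P) {m : Fin n →₀ ℕ} {y z : P} (h : y ≤ z)
    (hm : m.support ⊆ supp x y) (v : FaceModule k x) :
    faceCoeff x hP m v y = faceCoeff x hP m v z := by
  rw [faceCoeff_apply, faceCoeff_apply, restrictFace_of_le x hP h, coeff_killVars hm]

/-- The coefficient may be read at the smaller face `y`. With `y` the face of `z` opposite a label,
this gives the coefficients of the Koszul differential. -/
lemma faceCoeff_monomial_smul (hP : IsSimplicial P) {m m' : Fin n →₀ ℕ} {y z : P} (h : y ≤ z)
    (hm : m.support ⊆ supp x y) (hm' : m'.support ⊆ supp x z) (a : k) (v : FaceModule k x) :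
    faceCoeff x hP (m + m') ((MvPolynomial.monomial m' a : MvPolynomial (Fin n) k) • v) z =
      a * faceCoeff x hP m v y := by
  rw [faceCoeff_of_le x hP h hm, faceCoeff_apply, faceCoeff_apply, toFaceRing_smul,
    map_mul, Pi.mul_apply, restrictFace_structureMap_monomial x hP hm', add_comm,
    MvPolynomial.coeff_monomial_mul]

/-! ### The standard monomials of a given degree -/

lemma mdeg_add (m m' : Fin n →₀ ℕ) : mdeg (m + m') = mdeg m + mdeg m' := by
  ext j; simp [mdeg]

lemma mdeg_finExp (σ : Finset (Fin n)) : mdeg (finExp σ) = sDeg 1 σ := by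
  ext j; simp [mdeg, finExp_apply, sDeg]

lemma mdeg_injective : Function.Injective (mdeg (n := n)) := fun m m' h => by
  ext j
  exact Nat.cast_injective (congrFun h j)

lemma support_add_finExp {m : Fin n →₀ ℕ} {σ : Finset (Fin n)} (h : m.support ⊆ σ) :
    (m + finExp σ).support = σ := by
  ext j
  simp only [Finsupp.mem_support_iff, Finsupp.add_apply, finExp_apply]
  by_cases hj : j ∈ σ
  · simp [hj]
  · have : m j = 0 := Finsupp.notMem_support_iff.1 fun h' => hj (h h')
    simp [hj, this]

lemma sub_finExp_add (m : Fin n →₀ ℕ) : m - finExp m.support + finExp m.support = m := by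
  ext j
  simp only [Finsupp.add_apply, Finsupp.tsub_apply, finExp_apply, Finsupp.mem_support_iff]
  split_ifs <;> omega

lemma faceElt_mem_faceGrading (y : P) :
    (toFaceRing k x).symm (faceElt k y) ∈ faceGrading k x (sDeg 1 (supp x y)) :=
  ⟨MvPolynomial.X y, by
    rw [← faceDegree_eq]
    exact MvPolynomial.isWeightedHomogeneous_X _ _ _, rfl⟩

lemma C_smul_mem_faceGrading (a : k) (β : Fin n → ℤ) (v : FaceModule k x)
    (hv : v ∈ faceGrading k x β) :
    (MvPolynomial.C a : MvPolynomial (Fin n) k) • v ∈ faceGrading k x β := by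
  obtain ⟨p, hp, rfl⟩ := hv
  refine ⟨MvPolynomial.C a * p, ?_, ?_⟩
  · have := (MvPolynomial.isWeightedHomogeneous_C (faceDegree x) a).mul hp
    rwa [zero_add] at this
  · refine (toFaceRing k x).injective ?_
    rw [toFaceRing_smul, structureMap_C]
    exact map_mul (Ideal.Quotient.mk (faceIdeal k P)) _ _

lemma X_smul_mem_faceGrading (j : Fin n) (β : Fin n → ℤ) (v : FaceModule k x)
    (hv : v ∈ faceGrading k x β) :
    (MvPolynomial.X j : MvPolynomial (Fin n) k) • v ∈ faceGrading k x (β + Pi.single j 1) := by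
  obtain ⟨p, hp, rfl⟩ := hv
  refine ⟨MvPolynomial.X (x j : P) * p, ?_, ?_⟩
  · have := (MvPolynomial.isWeightedHomogeneous_X k (faceDegree x) (x j : P)).mul hp
    have hd : faceDegree x (x j : P) = Pi.single j 1 := by
      rw [faceDegree_eq, supp_vertex]
      ext l
      simp [sDeg, Pi.single_apply]
    rwa [hd, add_comm] at this
  · refine (toFaceRing k x).injective ?_
    rw [toFaceRing_smul, structureMap_X]
    exact map_mul (Ideal.Quotient.mk (faceIdeal k P)) _ _

lemma monomial_smul_mem_faceGrading (m : Fin n →₀ ℕ) (a : k) (β : Fin n → ℤ) (v : FaceModule k x)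
    (hv : v ∈ faceGrading k x β) :
    (MvPolynomial.monomial m a : MvPolynomial (Fin n) k) • v ∈ faceGrading k x (mdeg m + β) := by
  induction m using Finsupp.induction_linear generalizing a v β with
  | zero =>
    have := C_smul_mem_faceGrading x a β v hv
    rwa [show mdeg (0 : Fin n →₀ ℕ) = 0 from rfl, zero_add]
  | add m m' h h' =>
    rw [← mul_one a, ← MvPolynomial.monomial_mul, mul_smul, mdeg_add, add_assoc]
    exact h _ _ _ (h' _ _ _ hv)
  | single j s =>
    induction s generalizing v β with
    | zero =>
      rw [Finsupp.single_zero]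
      have := C_smul_mem_faceGrading x a β v hv
      rwa [show mdeg (0 : Fin n →₀ ℕ) = 0 from rfl, zero_add]
    | succ s ih =>
      rw [Finsupp.single_add, ← mul_one a, ← MvPolynomial.monomial_mul, mul_smul, mdeg_add,
        add_assoc]
      refine ih _ _ ?_
      have := X_smul_mem_faceGrading x j β v hv
      rw [add_comm]
      rw [show mdeg (Finsupp.single j 1) = (Pi.single j 1 : Fin n → ℤ) from ?_]
      · exact this
      ext l
      simp [mdeg, Finsupp.single_apply, Pi.single_apply, eq_comm]

/-- The subgroup spanned by the products of a face and a monomial, of total degree `β`. -/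
def monomialSpan (β : Fin n → ℤ) : AddSubgroup (FaceRing k P) :=
  AddSubgroup.closure {v | ∃ (m : Fin n →₀ ℕ) (a : k) (y : P), mdeg m + sDeg 1 (supp x y) = β ∧
    v = (structureMap k x (MvPolynomial.monomial m a) * faceElt k y)}

/-- The subgroup spanned by the standard monomials of degree `β`. -/
def standardSpan (β : Fin n → ℤ) : AddSubgroup (FaceRing k P) :=
  AddSubgroup.closure {v | ∃ (m : Fin n →₀ ℕ) (a : k) (y : P), m.support ⊆ supp x y ∧
    mdeg m + sDeg 1 (supp x y) = β ∧
    v = (structureMap k x (MvPolynomial.monomial m a) * faceElt k y)}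

/-- Straightening is homogeneous: `1_{S ∪ T} + 1_{S ∩ T} = 1_S + 1_T`. -/
lemma faceElt_mul_mem_monomialSpan (hP : IsSimplicial P) (w : P) {β : Fin n → ℤ}
    {v : FaceRing k P} (hv : v ∈ monomialSpan x β) :
    (faceElt k w * v : FaceRing k P) ∈ (monomialSpan x (sDeg 1 (supp x w) + β) :
      AddSubgroup (FaceRing k P)) := by
  have key : monomialSpan x β ≤ (monomialSpan x (sDeg 1 (supp x w) + β)).comap
      (AddMonoidHom.mulLeft (faceElt k w) : FaceRing k P →+ FaceRing k P) := by
    refine (AddSubgroup.closure_le _).2 ?_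
    rintro _ ⟨m, a, y, rfl, rfl⟩
    change (faceElt k w * (structureMap k x (MvPolynomial.monomial m a) * faceElt k y) :
      FaceRing k P) ∈ monomialSpan x _
    rw [mul_left_comm, faceElt_mul (x := x) hP, Finset.mul_sum]
    refine sum_mem fun z hz =>
      AddSubgroup.subset_closure ⟨m + finExp (supp x w ∩ supp x y), a, z, ?_, ?_⟩
    · rw [mem_minUpperBounds_iff (x := x) hP] at hz
      rw [hz.2.2, mdeg_add, mdeg_finExp, add_assoc, add_left_comm (sDeg 1 (supp x w))]
      congr 1
      rw [← mdeg_finExp, ← mdeg_finExp, ← mdeg_finExp, ← mdeg_finExp, ← mdeg_add, ← mdeg_add,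
        add_comm, finExp_union_add_inter]
    · have hprod : MvPolynomial.monomial (m + finExp (supp x w ∩ supp x y)) a =
          MvPolynomial.monomial m a * ∏ j ∈ supp x w ∩ supp x y, MvPolynomial.X j := by
        rw [← monomial_finExp, MvPolynomial.monomial_mul, mul_one]
      rw [hprod, map_mul, map_prod, mul_assoc]
      congr 2
      exact Finset.prod_congr rfl fun j _ => (structureMap_X x j).symm
  exact key hv

lemma mk_monomial_mem_monomialSpan (hP : IsSimplicial P) (d : P →₀ ℕ) (a : k) :
    (Ideal.Quotient.mk (faceIdeal k P) (MvPolynomial.monomial d a) : FaceRing k P) ∈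
      (monomialSpan x (Finsupp.weight (faceDegree x) d) : AddSubgroup (FaceRing k P)) := by
  -- The claim is strengthened to multiplication of an arbitrary element by the monomial, so that
  -- induction on the exponent composes.
  suffices h : ∀ p : MvPolynomial P k, ∀ β, (Ideal.Quotient.mk (faceIdeal k P) p : FaceRing k P) ∈
      (monomialSpan x β : AddSubgroup (FaceRing k P)) →
      (Ideal.Quotient.mk (faceIdeal k P) (MvPolynomial.monomial d 1 * p) : FaceRing k P) ∈
      (monomialSpan x (Finsupp.weight (faceDegree x) d + β) : AddSubgroup (FaceRing k P)) by
    have h1 := h (MvPolynomial.C a) 0 (AddSubgroup.subset_closure ⟨0, a, ⊥, ?_, ?_⟩)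
    · rwa [mul_comm, MvPolynomial.C_mul_monomial, mul_one, add_zero] at h1
    · rw [supp_bot, sDeg_empty, add_zero]
      rfl
    · rw [faceElt_bot, mul_one, ← MvPolynomial.C_apply, structureMap_C]
  induction d using Finsupp.induction_linear with
  | zero =>
    intro p β hp
    rwa [map_zero, zero_add, ← MvPolynomial.C_apply, MvPolynomial.C_1, one_mul]
  | add d d' h h' =>
    intro p β hp
    rw [← mul_one (1 : k), ← MvPolynomial.monomial_mul, mul_assoc, map_add, add_assoc]
    exact h _ _ (h' _ _ hp)
  | single w s =>
    intro p β hp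
    induction s with
    | zero =>
      rwa [Finsupp.single_zero, map_zero, zero_add, ← MvPolynomial.C_apply, MvPolynomial.C_1,
        one_mul]
    | succ s ih =>
      have := faceElt_mul_mem_monomialSpan x hP w ih
      have hw : Finsupp.weight (faceDegree x) (Finsupp.single w 1) = faceDegree x w := by
        simp [Finsupp.weight_apply]
      rw [Nat.add_comm, Finsupp.single_add, ← mul_one (1 : k), ← MvPolynomial.monomial_mul,
        mul_assoc, map_add, add_assoc, map_mul, hw, faceDegree_eq]
      exact this

/-- If `x_j` is a vertex of `y`, the variable is absorbed by the monomial. Otherwise `x_j · y` is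
the sum of the minimal upper bounds, whose supports are larger, so the monomials stay standard. -/
lemma X_mul_mem_standardSpan (hP : IsSimplicial P) (j : Fin n) {β : Fin n → ℤ}
    {v : FaceRing k P} (hv : v ∈ standardSpan x β) :
    (structureMap k x (MvPolynomial.X j) * v : FaceRing k P) ∈
      (standardSpan x (sDeg 1 {j} + β) : AddSubgroup (FaceRing k P)) := by
  have key : standardSpan x β ≤ (standardSpan x (sDeg 1 {j} + β)).comap
      (AddMonoidHom.mulLeft (structureMap k x (MvPolynomial.X j)) :
        FaceRing k P →+ FaceRing k P) := by
    refine (AddSubgroup.closure_le _).2 ?_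
    rintro _ ⟨m, a, y, hm, rfl, rfl⟩
    change (structureMap k x (MvPolynomial.X j) *
      (structureMap k x (MvPolynomial.monomial m a) * faceElt k y) : FaceRing k P) ∈
      standardSpan x _
    by_cases hj : j ∈ supp x y
    · refine AddSubgroup.subset_closure ⟨finExp {j} + m, a, y, ?_, ?_, ?_⟩
      · refine Finsupp.support_add.trans (Finset.union_subset ?_ hm)
        rw [support_finExp]
        simpa using hj
      · rw [mdeg_add, mdeg_finExp, add_assoc]
      · rw [← mul_assoc, ← map_mul, ← one_mul a, ← MvPolynomial.monomial_mul, monomial_finExp,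
          Finset.prod_singleton, one_mul]
    · rw [structureMap_X, mul_left_comm, faceElt_mul (x := x) hP, supp_vertex,
        Finset.singleton_inter_of_notMem hj, Finset.prod_empty, Finset.mul_sum]
      refine sum_mem fun z hz =>
        AddSubgroup.subset_closure ⟨m, a, z, ?_, ?_, ?_⟩
      · rw [mem_minUpperBounds_iff (x := x) hP] at hz
        exact hm.trans (supp_mono x hz.2.1)
      · rw [mem_minUpperBounds_iff (x := x) hP, supp_vertex] at hz
        have h := finExp_union_add_inter {j} (supp x y)
        rw [Finset.singleton_inter_of_notMem hj, show finExp (∅ : Finset (Fin n)) = 0 from rfl,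
          add_zero] at h
        rw [hz.2.2, add_left_comm, ← mdeg_finExp, ← mdeg_finExp, ← mdeg_finExp,
          ← mdeg_add _ (finExp (supp x y)), ← h]
      · rw [one_mul]
  exact key hv

lemma monomialSpan_le_standardSpan (hP : IsSimplicial P) (β : Fin n → ℤ) :
    (monomialSpan x β : AddSubgroup (FaceRing k P)) ≤ standardSpan x β := by
  refine (AddSubgroup.closure_le _).2 ?_
  rintro _ ⟨m, a, y, rfl, rfl⟩
  suffices h : ∀ β, ∀ v ∈ (standardSpan x β : AddSubgroup (FaceRing k P)),
      (structureMap k x (MvPolynomial.monomial m 1) * v : FaceRing k P) ∈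
        (standardSpan x (mdeg m + β) : AddSubgroup (FaceRing k P)) by
    have := h (sDeg 1 (supp x y)) (structureMap k x (MvPolynomial.monomial 0 a) * faceElt k y :
      FaceRing k P) (AddSubgroup.subset_closure ⟨0, a, y, by simp, ?_, rfl⟩)
    · rwa [← mul_assoc, ← map_mul, MvPolynomial.monomial_mul, add_zero, one_mul] at this
    · exact zero_add _
  induction m using Finsupp.induction_linear with
  | zero =>
    intro β v hv
    rwa [← MvPolynomial.C_apply, MvPolynomial.C_1, map_one, one_mul,
      show mdeg (0 : Fin n →₀ ℕ) = 0 from rfl, zero_add]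
  | add m m' h h' =>
    intro β v hv
    rw [← mul_one (1 : k), ← MvPolynomial.monomial_mul, map_mul, mul_assoc, mdeg_add, add_assoc]
    exact h _ _ (h' _ _ hv)
  | single j s =>
    intro β v hv
    induction s with
    | zero =>
      rwa [Finsupp.single_zero, ← MvPolynomial.C_apply, MvPolynomial.C_1, map_one, one_mul,
        show mdeg (0 : Fin n →₀ ℕ) = 0 from rfl, zero_add]
    | succ s ih =>
      have := X_mul_mem_standardSpan x hP j ih
      rw [Nat.add_comm, Finsupp.single_add, ← mul_one (1 : k), ← MvPolynomial.monomial_mul,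
        map_mul, mul_assoc, mdeg_add, add_assoc]
      rwa [← mdeg_finExp, finExp, Finset.sum_singleton] at this

lemma faceGrading_le_standardSpan (hP : IsSimplicial P) (β : Fin n → ℤ) :
    (faceGrading k x β).map (toFaceRing k x).toAddMonoidHom ≤ standardSpan x β := by
  rintro _ ⟨_, ⟨p, hp, rfl⟩, rfl⟩
  refine monomialSpan_le_standardSpan x hP β ?_
  change (Ideal.Quotient.mk (faceIdeal k P) p : FaceRing k P) ∈
    (monomialSpan x β : AddSubgroup (FaceRing k P))
  rw [p.as_sum, map_sum]
  refine sum_mem fun d hd => ?_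
  have := mk_monomial_mem_monomialSpan x hP d (MvPolynomial.coeff d p)
  rwa [hp (MvPolynomial.mem_support_iff.1 hd)] at this

end FaceGrading

/-! ### The standard basis and bijectivity of multiplication by monomials. -/

section FaceGradingBasis

variable {k : Type u} [Field k] {P : Type u} [PartialOrder P] [OrderBot P] [Finite P] {n : ℕ}
  (x : Fin n ≃ Vertex P)

/-- The combination of standard monomials of exponent `m` with given coefficients. -/
def standardElt (m : Fin n →₀ ℕ) : (P → k) →+ FaceModule k x where
  toFun a := ∑ y ∈ (Set.toFinite {y : P | supp x y = m.support}).toFinset,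
    (MvPolynomial.monomial (m - finExp m.support) (a y) : MvPolynomial (Fin n) k) •
      (toFaceRing k x).symm (faceElt k y)
  map_zero' := Finset.sum_eq_zero fun y _ => by rw [Pi.zero_apply, map_zero, zero_smul]
  map_add' a b := by
    rw [← Finset.sum_add_distrib]
    exact Finset.sum_congr rfl fun y _ => by rw [Pi.add_apply, map_add, add_smul]

lemma standardElt_apply (m : Fin n →₀ ℕ) (a : P → k) :
    standardElt x m a = ∑ y ∈ (Set.toFinite {y : P | supp x y = m.support}).toFinset,
      (MvPolynomial.monomial (m - finExp m.support) (a y) : MvPolynomial (Fin n) k) •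
        (toFaceRing k x).symm (faceElt k y) := rfl

lemma standardElt_mem (m : Fin n →₀ ℕ) (a : P → k) :
    standardElt x m a ∈ faceGrading k x (mdeg m) := by
  rw [standardElt_apply]
  refine sum_mem fun y hy => ?_
  rw [Set.Finite.mem_toFinset, Set.mem_ofPred_eq] at hy
  have := monomial_smul_mem_faceGrading x (m - finExp m.support) (a y) _ _
    (faceElt_mem_faceGrading (k := k) x y)
  rwa [hy, ← mdeg_finExp, ← mdeg_add, sub_finExp_add] at this

/-- Two faces with the support of `m` are comparable only if equal, so restriction to `y` kills
every standard monomial of this degree but the one on `y`. This is the linear independence of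
standard monomials. -/
lemma faceCoeff_standardElt (hP : IsSimplicial P) {m : Fin n →₀ ℕ} (a : P → k) {y : P}
    (hy : supp x y = m.support) : faceCoeff x hP m (standardElt x m a) y = a y := by
  classical
  have key : ∀ z, supp x z = m.support → faceCoeff x hP m
      ((MvPolynomial.monomial (m - finExp m.support) (a z) : MvPolynomial (Fin n) k) •
        (toFaceRing k x).symm (faceElt k z)) y = if z = y then a z else 0 := by
    intro z hz
    have h := faceCoeff_monomial_smul x hP (m := finExp m.support) (m' := m - finExp m.support)
      (le_refl y) (by rw [support_finExp, hy])
      (Finsupp.support_tsub.trans hy.ge) (a z) ((toFaceRing k x).symm (faceElt k z))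
    rw [add_comm, sub_finExp_add] at h
    rw [h, faceCoeff_apply, AddEquiv.apply_symm_apply, restrictFace_faceElt, restrictGen]
    split_ifs with h1 h2 h2
    · rw [hz, MvPolynomial.coeff_monomial, if_pos rfl, mul_one]
    · exact absurd (eq_of_supp_eq hP h1 le_rfl (hz.trans hy.symm)) h2
    · exact absurd h2.le h1
    · rw [MvPolynomial.coeff_zero, mul_zero]
  rw [standardElt_apply, map_sum, Finset.sum_apply, Finset.sum_congr rfl fun z hz => key z
    (by rwa [Set.Finite.mem_toFinset] at hz), Finset.sum_ite_eq', if_pos]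
  rwa [Set.Finite.mem_toFinset]

lemma exists_standardElt (hP : IsSimplicial P) {m : Fin n →₀ ℕ} {v : FaceModule k x}
    (hv : v ∈ faceGrading k x (mdeg m)) : ∃ a, standardElt x m a = v := by
  classical
  have key : standardSpan x (mdeg m) ≤
      ((standardElt x m).range.map (toFaceRing k x).toAddMonoidHom) := by
    refine (AddSubgroup.closure_le _).2 ?_
    rintro _ ⟨m', a, y, hm', hdeg, rfl⟩
    rw [← mdeg_finExp, ← mdeg_add] at hdeg
    obtain rfl := mdeg_injective hdeg
    refine ⟨_, ⟨Pi.single y a, rfl⟩, ?_⟩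
    change toFaceRing k x (standardElt x _ _) = _
    rw [standardElt_apply, map_sum, support_add_finExp hm', Finset.sum_eq_single y]
    · rw [toFaceRing_smul, AddEquiv.apply_symm_apply, add_tsub_cancel_right, Pi.single_eq_same]
    · intro z _ hz
      rw [Pi.single_eq_of_ne hz, map_zero, zero_smul, map_zero]
    · intro h
      rw [Set.Finite.mem_toFinset] at h
      exact absurd rfl h
  obtain ⟨_, ⟨a, rfl⟩, ha⟩ := key (faceGrading_le_standardSpan x hP _ ⟨v, hv, rfl⟩)
  exact ⟨a, (toFaceRing k x).injective ha⟩

lemma exists_mdeg_eq (hP : IsSimplicial P) {β : Fin n → ℤ} {v : FaceModule k x}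
    (hv : v ∈ faceGrading k x β) (h0 : v ≠ 0) : ∃ m, mdeg m = β := by
  by_contra hβ
  refine h0 ((toFaceRing k x).injective ?_)
  have key : standardSpan x β ≤ (⊥ : AddSubgroup (FaceRing k P)) := by
    refine (AddSubgroup.closure_le _).2 ?_
    rintro _ ⟨m', a, y, hm', hdeg, rfl⟩
    rw [← mdeg_finExp, ← mdeg_add] at hdeg
    exact absurd ⟨_, hdeg⟩ hβ
  rw [map_zero]
  exact AddSubgroup.mem_bot.1 (key (faceGrading_le_standardSpan x hP _ ⟨v, hv, rfl⟩))

/-- By spanning, both elements are combinations of standard monomials, and their coefficients are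
recovered by restriction to the faces of support `m.support`. -/
lemma eq_of_faceCoeff_eq (hP : IsSimplicial P) {m : Fin n →₀ ℕ} {v v' : FaceModule k x}
    (hv : v ∈ faceGrading k x (mdeg m)) (hv' : v' ∈ faceGrading k x (mdeg m))
    (h : ∀ y, supp x y = m.support → faceCoeff x hP m v y = faceCoeff x hP m v' y) : v = v' := by
  obtain ⟨a, rfl⟩ := exists_standardElt x hP hv
  obtain ⟨b, rfl⟩ := exists_standardElt x hP hv'
  rw [standardElt_apply, standardElt_apply]
  refine Finset.sum_congr rfl fun y hy => ?_
  rw [Set.Finite.mem_toFinset, Set.mem_ofPred_eq] at hy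
  have := h y hy
  rw [faceCoeff_standardElt x hP _ hy, faceCoeff_standardElt x hP _ hy] at this
  rw [this]

lemma restrictFace_mem_polyPiece (hP : IsSimplicial P) {β : Fin n → ℤ} {v : FaceModule k x}
    (hv : v ∈ faceGrading k x β) (y : P) :
    restrictFace x hP (toFaceRing k x v) y ∈ polyPiece k n β := by
  have key : standardSpan x β ≤ (polyPiece k n β).toAddSubgroup.comap
      ((Pi.evalAddMonoidHom (fun _ : P => MvPolynomial (Fin n) k) y).comp
        (restrictFace x hP).toAddMonoidHom) := by
    refine (AddSubgroup.closure_le _).2 ?_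
    rintro _ ⟨m', a, z, hm', hdeg, rfl⟩
    change restrictFace x hP (structureMap k x (MvPolynomial.monomial m' a) * faceElt k z) y ∈
      polyPiece k n β
    rw [map_mul, Pi.mul_apply, restrictFace_faceElt, restrictGen]
    split_ifs with h
    · rw [restrictFace_structureMap_monomial x hP (hm'.trans (supp_mono x h)), ← hdeg,
        ← mdeg_finExp]
      exact mul_mem_polyPiece (monomial_mem_polyPiece _ _) (monomial_mem_polyPiece _ _)
    · rw [mul_zero]
      exact zero_mem _
  exact key (faceGrading_le_standardSpan x hP _ ⟨v, hv, rfl⟩)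

/-- The sum of the pieces is direct because restriction to faces preserves degree and is injective
on each piece; the pieces span because monomials in the faces are homogeneous. -/
lemma faceGrading_isMultigrading (hP : IsSimplicial P) :
    IsMultigrading (k := k) (faceGrading k x) where
  isInternal := by
    have key : ∀ (u : ⨁ β, faceGrading k x β) (γ : Fin n → ℤ) (y : P),
        polyProj γ (restrictFace x hP (toFaceRing k x
          (DirectSum.coeAddMonoidHom (faceGrading k x) u)) y) =
          restrictFace x hP (toFaceRing k x (u γ)) y := by
      intro u γ y
      induction u using DirectSum.induction_on with
      | zero =>
        rw [map_zero, map_zero, map_zero, DirectSum.zero_apply, ZeroMemClass.coe_zero, map_zero,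
          map_zero]
        exact map_zero _
      | of β v =>
        rw [DirectSum.coeAddMonoidHom_of]
        have hv := restrictFace_mem_polyPiece x hP v.2 y
        by_cases hβ : β = γ
        · subst hβ
          rw [polyProj_isProjFamily.self _ _ hv, DirectSum.of_eq_same]
        · rw [polyProj_isProjFamily.ne _ _ hβ _ hv, DirectSum.of_eq_of_ne _ _ _ (Ne.symm hβ),
            ZeroMemClass.coe_zero, map_zero, map_zero]
          rfl
      | add u v hu hv =>
        rw [map_add, map_add, map_add, Pi.add_apply, map_add, hu, hv, DirectSum.add_apply,
          AddSubgroup.coe_add, map_add, map_add, Pi.add_apply]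
    constructor
    · rw [injective_iff_map_eq_zero]
      intro u hu
      ext γ
      rw [DirectSum.zero_apply, ZeroMemClass.coe_zero]
      by_contra h0
      obtain ⟨m, rfl⟩ := exists_mdeg_eq x hP (u γ).2 h0
      refine h0 (eq_of_faceCoeff_eq x hP (u (mdeg m)).2 (zero_mem _) fun y _ => ?_)
      rw [faceCoeff_apply, ← key, hu, map_zero, map_zero, map_zero, Pi.zero_apply, map_zero,
        MvPolynomial.coeff_zero]
      rfl
    · intro v
      obtain ⟨p, rfl⟩ := (toFaceRing k x).symm.surjective v
      obtain ⟨p, rfl⟩ := Ideal.Quotient.mk_surjective p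
      induction p using MvPolynomial.induction_on' with
      | monomial d a =>
        exact ⟨DirectSum.of _ (Finsupp.weight (faceDegree x) d)
          ⟨_, MvPolynomial.monomial d a, MvPolynomial.isWeightedHomogeneous_monomial _ _ _ rfl,
            rfl⟩, DirectSum.coeAddMonoidHom_of _ _ _⟩
      | add p q hp hq =>
        obtain ⟨a, ha⟩ := hp
        obtain ⟨b, hb⟩ := hq
        exact ⟨a + b, by rw [map_add, ha, hb, map_add, map_add]⟩
  C_smul_mem := C_smul_mem_faceGrading x
  X_smul_mem := X_smul_mem_faceGrading x

lemma exists_mdeg_eq_of_nonneg {β : Fin n → ℤ} (h : ∀ j, 0 ≤ β j) : ∃ m, mdeg m = β :=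
  ⟨Finsupp.equivFunOnFinite.symm fun j => (β j).toNat, funext fun j => Int.toNat_of_nonneg (h j)⟩

/-- If `β = mdeg m ≥ 0`, the hypothesis makes `m` and `m + m'` have the same support, so both sides
are indexed by the same faces and the coefficients do not change. If some `β j < 0`, then `m' j = 0`
and both sides are zero. -/
lemma monomial_smul_bijOn (hP : IsSimplicial P) {β : Fin n → ℤ} {m' : Fin n →₀ ℕ}
    (h : ∀ j ∈ m'.support, 1 ≤ β j) :
    Set.BijOn (fun v => (MvPolynomial.monomial m' 1 : MvPolynomial (Fin n) k) • v)
      (faceGrading k x β : Set (FaceModule k x)) (faceGrading k x (mdeg m' + β)) := by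
  by_cases hβ : ∀ j, 0 ≤ β j
  · obtain ⟨m, rfl⟩ := exists_mdeg_eq_of_nonneg hβ
    have hsub : m'.support ⊆ m.support := fun j hj => by
      have := h j hj
      rw [mdeg] at this
      rw [Finsupp.mem_support_iff]
      omega
    have hsupp : (m + m').support = m.support := by
      refine (Finset.Subset.antisymm ?_ fun j hj => ?_)
      · exact Finsupp.support_add.trans (Finset.union_subset subset_rfl hsub)
      · rw [Finsupp.mem_support_iff] at hj ⊢
        rw [Finsupp.add_apply]
        omega
    have hmem : ∀ v ∈ faceGrading k x (mdeg m),
        (MvPolynomial.monomial m' 1 : MvPolynomial (Fin n) k) • v ∈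
          faceGrading k x (mdeg (m + m')) := fun v hv => by
      rw [add_comm, mdeg_add]
      exact monomial_smul_mem_faceGrading x m' 1 _ v hv
    have hcoeff : ∀ (v : FaceModule k x) (y : P), supp x y = m.support →
        faceCoeff x hP (m + m') ((MvPolynomial.monomial m' 1 : MvPolynomial (Fin n) k) • v) y =
          faceCoeff x hP m v y := fun v y hy => by
      rw [faceCoeff_monomial_smul x hP le_rfl hy.ge (hsub.trans hy.ge), one_mul]
    rw [← mdeg_add, add_comm]
    refine ⟨hmem, fun v hv w hw hvw => ?_, fun v hv => ?_⟩
    · refine eq_of_faceCoeff_eq x hP hv hw fun y hy => ?_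
      rw [← hcoeff v y hy, ← hcoeff w y hy]
      exact congrArg (fun u => faceCoeff x hP (m + m') u y) hvw
    · refine ⟨standardElt x m (faceCoeff x hP (m + m') v), standardElt_mem x _ _, ?_⟩
      refine eq_of_faceCoeff_eq x hP (hmem _ (standardElt_mem x _ _)) hv fun y hy => ?_
      rw [hsupp] at hy
      rw [hcoeff _ _ hy, faceCoeff_standardElt x hP _ hy]
  · push Not at hβ
    obtain ⟨j, hj⟩ := hβ
    have hz : ∀ v ∈ faceGrading k x β, v = 0 := fun v hv => by
      by_contra h0
      obtain ⟨m, rfl⟩ := exists_mdeg_eq x hP hv h0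
      simp [mdeg] at hj
      omega
    have hm' : m' j = 0 := by
      by_contra h'
      have := h j (Finsupp.mem_support_iff.2 h')
      omega
    have hz' : ∀ v ∈ faceGrading k x (mdeg m' + β), v = 0 := fun v hv => by
      by_contra h0
      obtain ⟨m, hm⟩ := exists_mdeg_eq x hP hv h0
      have := congrFun hm j
      simp only [mdeg, Pi.add_apply, hm'] at this
      omega
    refine ⟨fun v hv => monomial_smul_mem_faceGrading x m' 1 β v hv, fun v hv w hw _ => ?_,
      fun v hv => ⟨0, zero_mem _, ?_⟩⟩
    · rw [hz v hv, hz w hw]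
    · rw [hz' v hv]
      exact smul_zero _

/-- On `σ` the transition involves only the variables `x_l` with `l ∈ σ`, and there the degree is
already `α_l + s ≥ 1`. -/
lemma faceGrading_isStableDegree (hP : IsSimplicial P) {α : Fin n → ℤ} {s : ℕ}
    (hs : ∀ j, 1 ≤ α j + s) : IsStableDegree k (faceGrading k x) s α := by
  intro σ t hst
  have hmon : (MvPolynomial.monomial ((t - s) • finExp σ) 1 : MvPolynomial (Fin n) k) =
      ∏ l ∈ σ, varPow k n (t - s) l := by
    rw [← one_pow (t - s), ← MvPolynomial.monomial_pow, monomial_finExp, ← Finset.prod_pow]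
    rfl
  have hdeg : mdeg ((t - s) • finExp σ) + (α + sDeg s σ) = α + sDeg t σ := by
    ext j
    simp only [mdeg, Pi.add_apply, sDeg, Finsupp.smul_apply, finExp_apply]
    split_ifs
    · simp
      omega
    · simp
  rw [← hmon, ← hdeg]
  refine monomial_smul_bijOn x hP fun j hj => ?_
  have hjσ : j ∈ σ := by
    rw [← support_finExp σ]
    exact Finsupp.support_smul hj
  rw [Pi.add_apply, sDeg, if_pos hjσ]
  exact hs j

lemma varPow_smul_bijOn (hP : IsSimplicial P) {α : Fin n → ℤ} {j : Fin n} (hj : 1 ≤ α j) (s : ℕ)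
    {σ : Finset (Fin n)} (hσ : j ∉ σ) :
    Set.BijOn (fun v => varPow k n s j • v)
      (faceGrading k x (α + sDeg s σ) : Set (FaceModule k x))
      (faceGrading k x (α + sDeg s (insert j σ))) := by
  have hmon : (MvPolynomial.monomial (Finsupp.single j s) 1 : MvPolynomial (Fin n) k) =
      varPow k n s j := by
    rw [varPow, MvPolynomial.X_pow_eq_monomial]
  have hdeg : mdeg (Finsupp.single j s) + (α + sDeg s σ) = α + sDeg s (insert j σ) := by
    rw [sDeg_insert s hσ, add_comm, add_assoc]
    congr 2
    ext l
    by_cases h : l = j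
    · subst h
      simp [mdeg]
    · simp [mdeg, h]
  rw [← hmon, ← hdeg]
  refine monomial_smul_bijOn x hP fun l hl => ?_
  obtain rfl : l = j := by
    simpa using Finsupp.support_single_subset hl
  rw [Pi.add_apply, sDeg, if_neg hσ, add_zero]
  exact hj

end FaceGradingBasis

/-! ### Vanishing in degrees with a positive coordinate. -/

section Acyclic

variable {k : Type u} [Field k] {n : ℕ} {M : Type u} [AddCommGroup M]
  [Module (MvPolynomial (Fin n) k) M] {ℳ : (Fin n → ℤ) → AddSubgroup M}

/-- The sets with and without `j` exhibit the complex as the cone of the bijection `x_jˢ`. The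
primitive vanishes on sets containing `j`, and elsewhere it is the solution of `x_jˢ b_σ = ± c_{σ ∪
j}`. -/
lemma exists_koszulδ_eq_of_bijOn (hℳ : IsMultigrading (k := k) ℳ) {s i : ℕ} {α : Fin n → ℤ}
    {j : Fin n}
    (hbij : ∀ σ, j ∉ σ → Set.BijOn (fun v => varPow k n s j • v) (ℳ (α + sDeg s σ) : Set M)
      (ℳ (α + sDeg s (insert j σ)))) {c : Finset (Fin n) → M}
    (hcc : c ∈ koszulCocycles k n M s i) (hc : IsHomogeneousCochain ℳ s α c) :
    ∃ b : Finset (Fin n) → M, (∀ σ, σ.card + 1 ≠ i → b σ = 0) ∧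
      IsHomogeneousCochain ℳ s α b ∧ koszulδ M (varPow k n s) b = c := by
  have hex : ∀ σ : Finset (Fin n), ∃ v ∈ ℳ (α + sDeg s σ), (j ∈ σ → v = 0) ∧
      (j ∉ σ → varPow k n s j • v = kSign j σ • c (insert j σ)) := fun σ => by
    by_cases hj : j ∈ σ
    · exact ⟨0, zero_mem _, fun _ => rfl, fun h => absurd hj h⟩
    · obtain ⟨v, hv, h⟩ := (hbij σ hj).surjOn
        ((ℳ _).zsmul_mem (hc (insert j σ)) (kSign j σ))
      exact ⟨v, hv, fun h => absurd h hj, fun _ => h⟩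
  choose b hb hb0 hb1 using hex
  have hbh : IsHomogeneousCochain ℳ s α b := hb
  refine ⟨b, fun σ hσ => ?_, hb, ?_⟩
  · by_cases hj : j ∈ σ
    · exact hb0 σ hj
    · refine (hbij σ hj).injOn (hb σ) (zero_mem _) ?_
      refine (hb1 σ hj).trans ?_
      rw [hcc.1 _ (by rwa [Finset.card_insert_of_notMem hj]), smul_zero]
      exact (smul_zero _).symm
  · ext τ
    by_cases hj : j ∈ τ
    · rw [koszulδ_apply, Finset.sum_eq_single_of_mem j hj, hb1 _ (by simp),
        Finset.insert_erase hj, smul_smul, kSign_mul_self, one_smul]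
      intro l _ hl
      rw [hb0 _ (Finset.mem_erase.2 ⟨hl.symm, hj⟩), smul_zero, smul_zero]
    -- The equation at `τ` is checked after the injective multiplication by `x_jˢ`, where it becomes
    -- the cocycle identity at `insert j τ`.
    · refine (hbij τ hj).injOn (hbh.koszulδ hℳ τ) (hc τ) ?_
      have h0 : koszulδ M (varPow k n s) c (insert j τ) = 0 :=
        congrFun (LinearMap.mem_ker.1 hcc.2) _
      rw [koszulδ_apply, Finset.sum_insert hj, Finset.erase_insert hj] at h0
      have h1 := eq_neg_of_add_eq_zero_left h0
      have h2 := congrArg (fun v => kSign j τ • v) h1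
      simp only [smul_smul, kSign_mul_self, one_smul] at h2
      rw [h2, koszulδ_apply, Finset.smul_sum, smul_neg, Finset.smul_sum, ← Finset.sum_neg_distrib]
      refine Finset.sum_congr rfl fun l hl => ?_
      have hne : l ≠ j := fun h => hj (h ▸ hl)
      have hj' : j ∉ τ.erase l := fun h => hj (Finset.mem_of_mem_erase h)
      rw [Finset.erase_insert_of_ne hne.symm, smul_comm (varPow k n s j),
        smul_comm (varPow k n s j) (varPow k n s l), hb1 _ hj', smul_comm (varPow k n s l),
        smul_smul, smul_smul, ← neg_smul]
      congr 1
      have hs := kSign_insert_mul_kSign_insert hne (Finset.notMem_erase l τ) hj'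
      rw [Finset.insert_erase hl] at hs
      linarith

lemma localCohomologyPiece_eq_bot (hℳ : IsMultigrading (k := k) ℳ) {s i : ℕ} {α : Fin n → ℤ}
    (hst : IsStableDegree k ℳ s α) {j : Fin n}
    (hbij : ∀ σ, j ∉ σ → Set.BijOn (fun v => varPow k n s j • v) (ℳ (α + sDeg s σ) : Set M)
      (ℳ (α + sDeg s (insert j σ)))) : localCohomologyPiece k M ℳ i α = ⊥ := by
  refine (Submodule.eq_bot_iff _).2 fun h hh => ?_
  obtain ⟨c, hcc, hc, rfl⟩ := (mem_localCohomologyPiece_iff hℳ hst h).1 hh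
  rw [(koszulClass_eq_zero_iff hℳ hst hcc hc).2 (exists_koszulδ_eq_of_bijOn hℳ hbij hcc hc),
    map_zero]

end Acyclic

/-! ### Signs of reorderings. -/

section Signs

variable {n : ℕ}

open Classical in
/-- The sign of the permutation relating the order of `Fin n` to a relation `R` on a subset. -/
def inversionSign (R : Fin n → Fin n → Prop) (T : Finset (Fin n)) : ℤ :=
  ∏ j ∈ T, ∏ j' ∈ T, if j < j' ∧ R j' j then -1 else 1

lemma kSign_eq_prod (l : Fin n) (T : Finset (Fin n)) :
    kSign l T = ∏ j ∈ T, if l < j then -1 else 1 := by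
  rw [kSign, ← Finset.prod_filter, Finset.prod_const]

open Classical in
lemma inversionSign_congr {R R' : Fin n → Fin n → Prop} {T : Finset (Fin n)}
    (h : ∀ j ∈ T, ∀ j' ∈ T, R j j' ↔ R' j j') : inversionSign R T = inversionSign R' T := by
  rw [inversionSign, inversionSign]
  refine Finset.prod_congr rfl fun j hj => Finset.prod_congr rfl fun j' hj' => ?_
  exact if_congr (and_congr_right fun _ => h j' hj' j hj) rfl rfl

-- The label `l` forms an inversion with `j` exactly when the two orders disagree about them, that
-- is, when exactly one of `l < j` and `R l j` holds.
open Classical in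
lemma inversionSign_insert {R : Fin n → Fin n → Prop} {l : Fin n} {T : Finset (Fin n)} (hl : l ∉ T)
    (hR : ∀ j ∈ T, (R l j ↔ ¬ R j l)) :
    inversionSign R (insert l T) =
      inversionSign R T * (kSign l T * (-1) ^ (T.filter (R l ·)).card) := by
  rw [inversionSign, Finset.prod_insert hl, Finset.prod_insert hl, if_neg (by simp), one_mul]
  simp only [Finset.prod_insert hl]
  rw [Finset.prod_mul_distrib, inversionSign, kSign_eq_prod,
    ← Finset.prod_const, Finset.prod_filter, ← mul_assoc, mul_comm,
    ← Finset.prod_mul_distrib, ← Finset.prod_mul_distrib]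
  rw [Finset.prod_mul_distrib]
  congr 1
  rw [← Finset.prod_mul_distrib]
  refine Finset.prod_congr rfl fun j hj => ?_
  have hne : l ≠ j := fun h => hl (h ▸ hj)
  have := hR j hj
  rcases lt_or_gt_of_ne hne with h | h
  · have h' := h.not_gt
    by_cases hjl : R j l
    · simp [h, h', hjl, this]
    · simp [h, h', hjl, this]
  · have h' := h.not_gt
    by_cases hjl : R j l
    · simp [h, h', hjl, this]
    · simp [h, h', hjl, this]

lemma inversionSign_mul_self (R : Fin n → Fin n → Prop) (T : Finset (Fin n)) :
    inversionSign R T * inversionSign R T = 1 := by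
  rw [inversionSign, ← Finset.prod_mul_distrib]
  refine Finset.prod_eq_one fun j _ => ?_
  rw [← Finset.prod_mul_distrib]
  refine Finset.prod_eq_one fun j' _ => ?_
  split_ifs <;> norm_num

lemma kSign_union {l : Fin n} {S T : Finset (Fin n)} (h : Disjoint S T) :
    kSign l (S ∪ T) = kSign l S * kSign l T := by
  rw [kSign_eq_prod, kSign_eq_prod, kSign_eq_prod, Finset.prod_union h]

end Signs

/-! ### Faces, vertices and coboundary of a link in terms of labels. -/

section Links

variable {P : Type u} [PartialOrder P] [OrderBot P] [Finite P] {n : ℕ} {x : Fin n ≃ Vertex P}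

lemma lt_of_supp_ssubset (hP : IsSimplicial P) {a b y : P} (ha : a ≤ y) (hb : b ≤ y)
    (h : supp x a ⊂ supp x b) : a < b :=
  lt_of_le_of_ne (le_of_supp_subset hP ha hb h.1) (by rintro rfl; exact ssubset_irrefl _ h)

lemma supp_ssubset (hP : IsSimplicial P) {a b : P} (h : a < b) : supp x a ⊂ supp x b :=
  (supp_mono x h.le).ssubset_of_ne fun he => h.ne (eq_of_supp_eq hP h.le le_rfl he)

/-- Going down in the link strictly shrinks the set of labels outside `w`, and erasing a single one
of these labels produces a face of the link with exactly one label fewer. -/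
lemma link_height (hP : IsSimplicial P) (x : Fin n ≃ Vertex P) {w : P} (y : Link w) :
    Order.height y = ((supp x y.1 \ supp x w).card : ℕ) := by
  obtain ⟨d, hd⟩ : ∃ d, (supp x y.1 \ supp x w).card = d := ⟨_, rfl⟩
  induction d using Nat.strong_induction_on generalizing y with
  | _ d ih =>
    have hlt : ∀ b : Link w, b < y → (supp x b.1 \ supp x w).card < d := fun b hb => by
      rw [← hd]
      refine Finset.card_lt_card ?_
      have h1 := supp_ssubset (x := x) hP (show b.1 < y.1 from hb)
      have h2 := supp_mono x (show w ≤ b.1 from b.2)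
      refine ⟨Finset.sdiff_subset_sdiff h1.1 subset_rfl, fun h => h1.2 fun j hj => ?_⟩
      by_cases hjw : j ∈ supp x w
      · exact h2 hjw
      · exact (Finset.mem_sdiff.1 (h (Finset.mem_sdiff.2 ⟨hj, hjw⟩))).1
    rw [hd]
    refine le_antisymm ?_ ?_
    · refine Order.height_le_coe_iff.2 fun b hb => ?_
      rw [ih _ (hlt b hb) b rfl]
      exact_mod_cast hlt b hb
    · rcases Nat.eq_zero_or_pos d with rfl | hpos
      · simp
      · obtain ⟨l, hl⟩ := Finset.card_pos.1 (hd ▸ hpos)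
        rw [Finset.mem_sdiff] at hl
        obtain ⟨b, hby, hb⟩ := exists_supp_eq hP (x := x) (Finset.erase_subset l (supp x y.1))
        have hwb : w ≤ b := le_of_supp_subset (x := x) hP y.2 hby
          (hb ▸ fun j hj => Finset.mem_erase.2
            ⟨fun h => hl.2 (h ▸ hj), supp_mono x (show w ≤ y.1 from y.2) hj⟩)
        have hbc : (supp x b \ supp x w).card = d - 1 := by
          rw [hb, Finset.erase_sdiff_comm, Finset.card_erase_of_mem (Finset.mem_sdiff.2 hl), hd]
        have hlt' : (⟨b, hwb⟩ : Link w) < y := by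
          refine lt_of_supp_ssubset (x := x) hP hby le_rfl ?_
          rw [hb]
          exact Finset.erase_ssubset hl.1
        have := ih (d - 1) (by omega) ⟨b, hwb⟩ hbc
        have h2 := Order.height_add_one_le hlt'
        rw [this, hbc] at h2
        refine le_trans ?_ h2
        exact_mod_cast (show d ≤ d - 1 + 1 by omega)

lemma link_rk (hP : IsSimplicial P) (x : Fin n ≃ Vertex P) {w : P} (y : Link w) :
    (rk y : ℤ) = (supp x y.1).card - (supp x w).card := by
  rw [rk, link_height hP x, ENat.toNat_natCast,
    Finset.card_sdiff_of_subset (supp_mono x (show w ≤ y.1 from y.2)),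
    Nat.cast_sub (Finset.card_le_card (supp_mono x (show w ≤ y.1 from y.2)))]

lemma link_isAtom_iff (hP : IsSimplicial P) {w : P} {a : Link w} :
    IsAtom a ↔ ∃ j ∉ supp x w, supp x a.1 = insert j (supp x w) := by
  have hwa : w ≤ a.1 := a.2
  constructor
  · intro ha
    have hlt : w < a.1 := lt_of_le_of_ne hwa fun h => ha.1 (Subtype.ext h.symm)
    obtain ⟨j, hj, hjw⟩ := Finset.exists_of_ssubset (supp_ssubset (x := x) hP hlt)
    refine ⟨j, hjw, ?_⟩
    obtain ⟨b, hba, hb⟩ := exists_supp_eq hP (x := x) (y := a.1) (σ := insert j (supp x w))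
      (Finset.insert_subset hj (supp_mono x hwa))
    have hwb : w ≤ b := le_of_supp_subset (x := x) hP hwa hba (hb ▸ Finset.subset_insert _ _)
    have hle : (⟨b, hwb⟩ : Link w) ≤ a := hba
    rcases ha.le_iff.1 hle with h | h
    · have hbw : b = w := congrArg Subtype.val h
      rw [hbw] at hb
      exact absurd (hb ▸ Finset.mem_insert_self j _) hjw
    · rw [← h, hb]
  · rintro ⟨j, hj, ha⟩
    refine ⟨fun h => hj ?_, fun b hb => ?_⟩
    · rw [h] at ha
      change supp x w = _ at ha
      rw [ha]
      exact Finset.mem_insert_self _ _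
    · have hwb : w ≤ b.1 := b.2
      have h1 := supp_ssubset (x := x) hP (show b.1 < a.1 from hb)
      have h2 := supp_mono x hwb
      refine Subtype.ext (eq_of_supp_eq (x := x) hP le_rfl hwb ?_)
      refine Finset.Subset.antisymm (fun l hl => ?_) h2
      have hl' := h1.1 hl
      rw [ha, Finset.mem_insert] at hl'
      rcases hl' with rfl | hl'
      · refine absurd ?_ h1.2
        rw [ha]
        exact Finset.insert_subset hl h2
      · exact hl'

lemma link_mem_minUpperBounds_iff (hP : IsSimplicial P) (x : Fin n ≃ Vertex P) {w : P}
    {a y z : Link w} :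
    z ∈ minUpperBounds a y ↔ a ≤ z ∧ y ≤ z ∧ supp x z.1 = supp x a.1 ∪ supp x y.1 := by
  rw [← and_assoc]
  have h1 := mem_minUpperBounds_iff (x := x) hP (w := a.1) (y := y.1) (z := z.1)
  rw [← and_assoc] at h1
  refine Iff.trans ?_ h1
  simp only [minUpperBounds, Set.Finite.mem_toFinset, Set.mem_ofPred_eq]
  constructor
  · intro h
    exact ⟨h.1, fun b hb hbz => h.2 (y := ⟨b, le_trans a.2 hb.1⟩) hb hbz⟩
  · intro h
    exact ⟨h.1, fun b hb hbz => h.2 (y := b.1) hb hbz⟩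

/-- The face of `z` opposite to the vertex labelled `l`. -/
def oppositeFace (hP : IsSimplicial P) (x : Fin n ≃ Vertex P) (z : P) (l : Fin n) : P :=
  (exists_supp_eq hP (x := x) (Finset.erase_subset l (supp x z))).choose

lemma oppositeFace_le (hP : IsSimplicial P) (z : P) (l : Fin n) : oppositeFace hP x z l ≤ z :=
  (exists_supp_eq hP (x := x) (Finset.erase_subset l (supp x z))).choose_spec.1

lemma supp_oppositeFace (hP : IsSimplicial P) (z : P) (l : Fin n) :
    supp x (oppositeFace hP x z l) = (supp x z).erase l :=
  (exists_supp_eq hP (x := x) (Finset.erase_subset l (supp x z))).choose_spec.2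

lemma le_oppositeFace (hP : IsSimplicial P) {w z : P} {l : Fin n} (hw : w ≤ z)
    (hl : l ∉ supp x w) : w ≤ oppositeFace hP x z l := by
  refine le_of_supp_subset (x := x) hP hw (oppositeFace_le hP z l) ?_
  rw [supp_oppositeFace]
  exact fun j hj => Finset.mem_erase.2 ⟨fun h => hl (h ▸ hj), supp_mono x hw hj⟩

lemma exists_link_vertex (hP : IsSimplicial P) {w : P} (z : Link w) {l : Fin n}
    (hl : l ∈ supp x z.1 \ supp x w) :
    ∃ a : Vertex (Link w), a.1 ≤ z ∧ supp x a.1.1 = insert l (supp x w) := by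
  rw [Finset.mem_sdiff] at hl
  have hwz : w ≤ z.1 := z.2
  obtain ⟨b, hbz, hb⟩ := exists_supp_eq hP (x := x) (y := z.1) (σ := insert l (supp x w))
    (Finset.insert_subset hl.1 (supp_mono x hwz))
  have hwb : w ≤ b := le_of_supp_subset (x := x) hP hwz hbz (hb ▸ Finset.subset_insert _ _)
  exact ⟨⟨⟨b, hwb⟩, (link_isAtom_iff (x := x) hP).2 ⟨l, hl.2, hb⟩⟩, hbz, hb⟩

/-- Several vertices of a link may carry the same label, but not below a common face. -/
lemma link_vertex_eq (hP : IsSimplicial P) {w : P} {z : Link w} {a b : Vertex (Link w)}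
    (ha : a.1 ≤ z) (hb : b.1 ≤ z) (h : supp x a.1.1 = supp x b.1.1) : a = b :=
  Subtype.ext (Subtype.ext (eq_of_supp_eq (x := x) hP (y := z.1) ha hb h))

/-- The pairs `(a, y)` contributing to the value at `z` are parametrised by the labels `l` of `z`
outside `w`: `y` is the face opposite `l` and `a` the vertex carrying `l`. As these are only
obtained by choice, the caller supplies the term as a function `G` of the label. -/
lemma coboundary_apply (k : Type u) [Field k] (hP : IsSimplicial P) {w : P}
    (O : VertexOrientation (Link w)) (f : Link w → k) (z : Link w)
    (G : Fin n → k)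
    (hG : ∀ l ∈ supp x z.1 \ supp x w, ∀ (a : Vertex (Link w)) (y : Link w), a.1 ≤ z →
      supp x a.1.1 = insert l (supp x w) → y.1 = oppositeFace hP x z.1 l →
      (-1 : k) ^ Set.ncard {b : Vertex (Link w) | (b : Link w) ≤ y ∧ O.lt a b} * f y = G l) :
    coboundary k O f z = ∑ l ∈ supp x z.1 \ supp x w, G l := by
  classical
  choose a ha using fun l hl => exists_link_vertex (x := x) hP z (l := l) hl
  have hex : ∀ l ∈ supp x z.1 \ supp x w, ∃ y : Link w, y.1 = oppositeFace hP x z.1 l :=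
    fun l hl => ⟨⟨_, le_oppositeFace hP z.2 (Finset.mem_sdiff.1 hl).2⟩, rfl⟩
  choose y hy using hex
  have := Fintype.ofFinite (Link w)
  have h1 : coboundary k O f z = ∑ v : Link w,
      ∑ b ∈ (Set.toFinite {b : Vertex (Link w) | ¬ (b : Link w) ≤ v}).toFinset,
        if z ∈ minUpperBounds (b : Link w) v then
          (-1 : k) ^ Set.ncard {b' : Vertex (Link w) | (b' : Link w) ≤ v ∧ O.lt b b'} * f v
        else 0 := by
    rw [coboundary, Module.Basis.constr_apply_fintype, Finset.sum_apply]
    refine Finset.sum_congr rfl fun v _ => ?_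
    rw [Pi.smul_apply, Finset.sum_apply, smul_eq_mul, Finset.mul_sum]
    refine Finset.sum_congr rfl fun b _ => ?_
    rw [Pi.smul_apply, Finset.sum_apply]
    simp only [Pi.basisFun_apply, Pi.single_apply, Finset.sum_ite_eq, smul_eq_mul,
      Pi.basisFun_equivFun]
    split_ifs
    · rw [mul_one, mul_comm]
      rfl
    · simp
  rw [h1, Finset.sum_sigma']
  rw [← Finset.sum_filter]
  symm
  refine Finset.sum_bij (fun l hl => (⟨y l hl, a l hl⟩ : (_ : Link w) × Vertex (Link w)))
    ?_ ?_ ?_ ?_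
  · intro l hl
    have hl' := Finset.mem_sdiff.1 hl
    obtain ⟨ha1, ha2⟩ := ha l hl
    have hsy : supp x (y l hl).1 = (supp x z.1).erase l := by rw [hy l hl, supp_oppositeFace]
    rw [Finset.mem_filter, Finset.mem_sigma, Set.Finite.mem_toFinset, Set.mem_ofPred_eq,
      link_mem_minUpperBounds_iff hP x]
    refine ⟨⟨Finset.mem_univ _, fun h => ?_⟩, ha1, ?_, ?_⟩
    · have := supp_mono x (show (a l hl).1.1 ≤ (y l hl).1 from h)
      rw [ha2, hsy] at this
      exact Finset.notMem_erase l _ (this (Finset.mem_insert_self _ _))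
    · change (y l hl).1 ≤ z.1
      rw [hy l hl]
      exact oppositeFace_le hP _ _
    · rw [ha2, hsy]
      have hwz := supp_mono x (show w ≤ z.1 from z.2)
      ext j
      simp only [Finset.mem_union, Finset.mem_insert, Finset.mem_erase]
      constructor
      · intro hj
        by_cases h : j = l
        · exact Or.inl (Or.inl h)
        · exact Or.inr ⟨h, hj⟩
      · rintro ((rfl | h) | h)
        · exact hl'.1
        · exact hwz h
        · exact h.2
  · intro l hl l' hl' h
    have h2 : a l hl = a l' hl' := by
      rw [Sigma.mk.injEq] at h
      exact eq_of_heq h.2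
    have h3 := (ha l hl).2
    rw [h2, (ha l' hl').2] at h3
    have h4 : l ∈ insert l' (supp x w) := h3 ▸ Finset.mem_insert_self l _
    rcases Finset.mem_insert.1 h4 with h5 | h5
    · exact h5
    · exact absurd h5 (Finset.mem_sdiff.1 hl).2
  · rintro ⟨v, b⟩ hvb
    rw [Finset.mem_filter, Finset.mem_sigma, Set.Finite.mem_toFinset, Set.mem_ofPred_eq,
      link_mem_minUpperBounds_iff hP x] at hvb
    obtain ⟨⟨-, hbv⟩, hbz, hvz, hz⟩ := hvb
    obtain ⟨l, hlw, hb⟩ := (link_isAtom_iff (x := x) hP).1 b.2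
    have hwv := supp_mono x (show w ≤ v.1 from v.2)
    have hlz : l ∈ supp x z.1 := supp_mono x (show b.1.1 ≤ z.1 from hbz)
      (hb ▸ Finset.mem_insert_self _ _)
    have hl : l ∈ supp x z.1 \ supp x w := Finset.mem_sdiff.2 ⟨hlz, hlw⟩
    have hlv : l ∉ supp x v.1 := fun h => hbv <| le_of_supp_subset (x := x) hP
      (show b.1.1 ≤ z.1 from hbz) (show v.1 ≤ z.1 from hvz) (hb ▸ Finset.insert_subset h hwv)
    refine ⟨l, hl, ?_⟩
    have h1 : y l hl = v := by
      refine Subtype.ext (eq_of_supp_eq (x := x) hP (y := z.1) ?_ hvz ?_)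
      · rw [hy l hl]
        exact oppositeFace_le hP _ _
      · rw [hy l hl, supp_oppositeFace, hz, hb]
        ext j
        simp only [Finset.mem_union, Finset.mem_insert, Finset.mem_erase]
        constructor
        · rintro ⟨h1, (h2 | h2) | h2⟩
          · exact absurd h2 h1
          · exact hwv h2
          · exact h2
        · exact fun h => ⟨fun h' => hlv (h' ▸ h), Or.inr h⟩
    have h2 : a l hl = b := link_vertex_eq (x := x) hP (ha l hl).1 hbz ((ha l hl).2.trans hb.symm)
    rw [h1, h2]
  · intro l hl
    exact (hG l hl _ _ (ha l hl).1 (ha l hl).2 (hy l hl)).symm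

end Links

/-! ### Comparing the label order with an orientation of the link. -/

section LinkSigns

variable {P : Type u} [PartialOrder P] [OrderBot P] {n : ℕ} (x : Fin n ≃ Vertex P)

/-- The relation on the labels of the vertices of a face of a link given by an orientation. -/
def vertexRel {w : P} (O : VertexOrientation (Link w)) (z : Link w) (j j' : Fin n) : Prop :=
  ∃ a b : Vertex (Link w), a.1 ≤ z ∧ b.1 ≤ z ∧ supp x a.1.1 = insert j (supp x w) ∧
    supp x b.1.1 = insert j' (supp x w) ∧ O.lt a b

/-- The sign comparing the orientation of a face of a link given by the order of the labels with the
one given by an orientation of the link. -/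
def linkSign {w : P} (O : VertexOrientation (Link w)) (z : Link w) : ℤ :=
  inversionSign (vertexRel x O z) (supp x z.1 \ supp x w) *
    ∏ j ∈ supp x z.1 \ supp x w, kSign j (supp x w)

lemma linkSign_mul_self {w : P} (O : VertexOrientation (Link w)) (z : Link w) :
    linkSign x O z * linkSign x O z = 1 := by
  rw [linkSign, mul_mul_mul_comm, inversionSign_mul_self, one_mul, ← Finset.prod_mul_distrib]
  exact Finset.prod_eq_one fun j _ => kSign_mul_self _ _

variable {x} [Finite P]

lemma vertexRel_iff (hP : IsSimplicial P) {w : P} {O : VertexOrientation (Link w)} {z : Link w}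
    {a b : Vertex (Link w)} {j j' : Fin n} (ha : a.1 ≤ z) (hb : b.1 ≤ z)
    (haj : supp x a.1.1 = insert j (supp x w)) (hbj : supp x b.1.1 = insert j' (supp x w)) :
    vertexRel x O z j j' ↔ O.lt a b := by
  constructor
  · rintro ⟨a', b', ha', hb', haj', hbj', h⟩
    rwa [link_vertex_eq (x := x) hP ha ha' (haj.trans haj'.symm),
      link_vertex_eq (x := x) hP hb hb' (hbj.trans hbj'.symm)]
  · exact fun h => ⟨a, b, ha, hb, haj, hbj, h⟩

-- Each vertex of the link has one label outside `supp x w`, and below `y` the label determines the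
-- vertex; so vertices can be counted by labels.
open Classical in
lemma ncard_vertices_eq (hP : IsSimplicial P) {w : P} {O : VertexOrientation (Link w)}
    {y z : Link w} (hyz : y ≤ z) {a : Vertex (Link w)} {l : Fin n} (ha : a.1 ≤ z)
    (hal : supp x a.1.1 = insert l (supp x w)) :
    Set.ncard {b : Vertex (Link w) | (b : Link w) ≤ y ∧ O.lt a b} =
      ((supp x y.1 \ supp x w).filter (vertexRel x O z l ·)).card := by
  rw [Set.ncard_eq_toFinset_card _ (Set.toFinite _)]
  have hlab : ∀ b : Vertex (Link w), ∃ j ∉ supp x w, supp x b.1.1 = insert j (supp x w) :=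
    fun b => (link_isAtom_iff (x := x) hP).1 b.2
  choose lab hlab hlab' using hlab
  refine Finset.card_bij (fun b _ => lab b) ?_ ?_ ?_
  · intro b hb
    rw [Set.Finite.mem_toFinset, Set.mem_ofPred_eq] at hb
    rw [Finset.mem_filter, Finset.mem_sdiff, vertexRel_iff hP ha (hb.1.trans hyz) hal (hlab' b)]
    refine ⟨⟨supp_mono x (show b.1.1 ≤ y.1 from hb.1) ?_, hlab b⟩, hb.2⟩
    rw [hlab' b]
    exact Finset.mem_insert_self _ _
  · intro b hb b' hb' h
    rw [Set.Finite.mem_toFinset, Set.mem_ofPred_eq] at hb hb'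
    refine link_vertex_eq (x := x) hP hb.1 hb'.1 ?_
    rw [hlab' b, hlab' b', h]
  · intro j hj
    rw [Finset.mem_filter] at hj
    obtain ⟨b, hby, hbj⟩ := exists_link_vertex hP y hj.1
    refine ⟨b, ?_, ?_⟩
    · rw [Set.Finite.mem_toFinset, Set.mem_ofPred_eq]
      exact ⟨hby, (vertexRel_iff hP ha (hby.trans hyz) hal hbj).1 hj.2⟩
    · have := hlab' b
      rw [hbj] at this
      have h4 : j ∈ insert (lab b) (supp x w) := this ▸ Finset.mem_insert_self j _
      rcases Finset.mem_insert.1 h4 with h5 | h5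
      · exact h5.symm
      · exact absurd h5 (Finset.mem_sdiff.1 hj.1).2

/-- The Koszul sign of `l` against the labels of the opposite face is the product of its signs
against `w` and against the rest. The first is the new factor in the product of `linkSign`; the
second, with the orientation sign, is the change of `inversionSign`. -/
lemma linkSign_oppositeFace (hP : IsSimplicial P) {w : P} {O : VertexOrientation (Link w)}
    {y z : Link w} {a : Vertex (Link w)} {l : Fin n} (hl : l ∈ supp x z.1 \ supp x w)
    (hy : y.1 = oppositeFace hP x z.1 l) (ha : a.1 ≤ z)
    (hal : supp x a.1.1 = insert l (supp x w)) :
    linkSign x O z =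
      kSign l ((supp x z.1).erase l) * linkSign x O y *
        (-1) ^ Set.ncard {b : Vertex (Link w) | (b : Link w) ≤ y ∧ O.lt a b} := by
  classical
  have hyz : y ≤ z := by
    change y.1 ≤ z.1
    rw [hy]
    exact oppositeFace_le hP _ _
  have hsy : supp x y.1 = (supp x z.1).erase l := by rw [hy, supp_oppositeFace]
  have hT : supp x z.1 \ supp x w = insert l (supp x y.1 \ supp x w) := by
    rw [hsy, Finset.erase_sdiff_comm, Finset.insert_erase hl]
  have hlT : l ∉ supp x y.1 \ supp x w := by
    rw [hsy, Finset.erase_sdiff_comm]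
    exact Finset.notMem_erase _ _
  have hunion : (supp x z.1).erase l = supp x w ∪ (supp x y.1 \ supp x w) := by
    rw [← hsy, Finset.union_sdiff_of_subset (supp_mono x (show w ≤ y.1 from y.2))]
  have hcongr : inversionSign (vertexRel x O z) (supp x y.1 \ supp x w) =
      inversionSign (vertexRel x O y) (supp x y.1 \ supp x w) := by
    refine inversionSign_congr fun j hj j' hj' => ?_
    obtain ⟨b, hb, hbj⟩ := exists_link_vertex hP y hj
    obtain ⟨b', hb', hbj'⟩ := exists_link_vertex hP y hj'
    rw [vertexRel_iff hP hb hb' hbj hbj', vertexRel_iff hP (hb.trans hyz) (hb'.trans hyz) hbj hbj']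
  have htot : ∀ j ∈ supp x y.1 \ supp x w, (vertexRel x O z l j ↔ ¬ vertexRel x O z j l) := by
    intro j hj
    obtain ⟨b, hb, hbj⟩ := exists_link_vertex hP y hj
    have hbz := hb.trans hyz
    rw [vertexRel_iff hP ha hbz hal hbj, vertexRel_iff hP hbz ha hbj hal]
    have hne : a ≠ b := by
      rintro rfl
      have := supp_mono x (show a.1.1 ≤ y.1 from hb)
      rw [hal] at this
      exact hlT (Finset.mem_sdiff.2 ⟨this (Finset.mem_insert_self _ _), (Finset.mem_sdiff.1 hl).2⟩)
    constructor
    · exact fun h h' => O.irrefl _ (O.trans _ _ _ h h')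
    · exact fun h => (O.total z a b ha hbz hne).resolve_right h
  rw [ncard_vertices_eq hP hyz ha hal, linkSign, linkSign, hT, inversionSign_insert hlT htot,
    Finset.prod_insert hlT, hcongr, hunion, kSign_union Finset.disjoint_sdiff]
  ring

end LinkSigns

/-! ### Homogeneous Koszul cochains as functions on the faces. -/

section Cochains

variable {k : Type u} [Field k] {P : Type u} [PartialOrder P] [OrderBot P] [Finite P] {n : ℕ}
  {x : Fin n ≃ Vertex P} {α : Fin n → ℤ} {s : ℕ}

variable (α s) in
/-- The exponent of the degree of the homogeneous Koszul cochains on `σ`. -/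
def cellExp (σ : Finset (Fin n)) : Fin n →₀ ℕ :=
  Finsupp.equivFunOnFinite.symm fun j => (α j + sDeg s σ j).toNat

/-- On `σ` the degree is `α j + s ≥ 1`; off `σ` it is `α j ≤ 0`, nonnegative only if `α j = 0`. -/
lemma nonneg_add_sDeg_iff (hα : ∀ j, α j ≤ 0) (hs : ∀ j, 1 ≤ α j + s) (σ : Finset (Fin n)) :
    (∀ j, 0 ≤ α j + sDeg s σ j) ↔ degSupp α ⊆ σ := by
  simp only [Finset.subset_iff, degSupp, Finset.mem_filter, Finset.mem_univ, true_and, sDeg]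
  refine forall_congr' fun j => ?_
  have h1 := hα j
  have h2 := hs j
  split_ifs with h
  · exact ⟨fun _ _ => h, fun _ => by omega⟩
  · simp only [h, imp_false, not_not]
    omega

lemma mdeg_cellExp (hα : ∀ j, α j ≤ 0) (hs : ∀ j, 1 ≤ α j + s) {σ : Finset (Fin n)}
    (hσ : degSupp α ⊆ σ) : mdeg (cellExp α s σ) = α + sDeg s σ :=
  funext fun j => Int.toNat_of_nonneg ((nonneg_add_sDeg_iff hα hs σ).2 hσ j)

lemma support_cellExp (hs : ∀ j, 1 ≤ α j + s) {σ : Finset (Fin n)} (hσ : degSupp α ⊆ σ) :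
    (cellExp α s σ).support = σ := by
  ext j
  simp only [Finsupp.mem_support_iff, cellExp, Finsupp.equivFunOnFinite_symm_apply_apply, sDeg]
  split_ifs with h
  · have := hs j
    simp only [h, iff_true]
    omega
  · have hj : α j = 0 := by
      by_contra h0
      exact h (hσ (by simp [degSupp, h0]))
    simp [h, hj]

lemma eq_zero_of_not_subset (hP : IsSimplicial P) (hα : ∀ j, α j ≤ 0) (hs : ∀ j, 1 ≤ α j + s)
    {c : Finset (Fin n) → FaceModule k x} (hc : IsHomogeneousCochain (faceGrading k x) s α c)
    {σ : Finset (Fin n)} (hσ : ¬ degSupp α ⊆ σ) : c σ = 0 := by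
  by_contra h0
  obtain ⟨m, hm⟩ := exists_mdeg_eq x hP (hc σ) h0
  refine hσ ((nonneg_add_sDeg_iff hα hs σ).1 fun j => ?_)
  have := congrFun hm j
  rw [Pi.add_apply] at this
  rw [← this]
  exact Int.natCast_nonneg _

variable (α s) in
/-- The coefficients of a homogeneous Koszul cochain at the faces. -/
def cochainCoeff (hP : IsSimplicial P) (c : Finset (Fin n) → FaceModule k x) (y : P) : k :=
  faceCoeff x hP (cellExp α s (supp x y)) (c (supp x y)) y

lemma eq_of_cochainCoeff_eq (hP : IsSimplicial P) (hα : ∀ j, α j ≤ 0) (hs : ∀ j, 1 ≤ α j + s)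
    {c c' : Finset (Fin n) → FaceModule k x} (hc : IsHomogeneousCochain (faceGrading k x) s α c)
    (hc' : IsHomogeneousCochain (faceGrading k x) s α c')
    (h : ∀ y, degSupp α ⊆ supp x y → cochainCoeff α s hP c y = cochainCoeff α s hP c' y) :
    c = c' := by
  ext σ
  by_cases hσ : degSupp α ⊆ σ
  · have h1 := hc σ
    have h2 := hc' σ
    rw [← mdeg_cellExp hα hs hσ] at h1 h2
    refine eq_of_faceCoeff_eq x hP h1 h2 fun y hy => ?_
    rw [support_cellExp hs hσ] at hy
    subst hy
    exact h y hσ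
  · rw [eq_zero_of_not_subset hP hα hs hc hσ, eq_zero_of_not_subset hP hα hs hc' hσ]

/-- Erasing a label of `degSupp α` leaves a set on which the cochain vanishes, so only the labels
outside it contribute. -/
lemma cochainCoeff_koszulδ (hP : IsSimplicial P) (hα : ∀ j, α j ≤ 0) (hs : ∀ j, 1 ≤ α j + s)
    {c : Finset (Fin n) → FaceModule k x} (hc : IsHomogeneousCochain (faceGrading k x) s α c)
    {z : P} (hz : degSupp α ⊆ supp x z) :
    cochainCoeff α s hP (koszulδ _ (varPow k n s) c) z = ∑ l ∈ supp x z \ degSupp α,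
      (kSign l ((supp x z).erase l) : k) * cochainCoeff α s hP c (oppositeFace hP x z l) := by
  rw [cochainCoeff, koszulδ_apply, map_sum, Finset.sum_apply]
  symm
  refine Finset.sum_subset_zero_on_sdiff Finset.sdiff_subset ?_ ?_
  · intro l hl
    have hlF : l ∈ degSupp α := by
      simp only [Finset.mem_sdiff, not_and, not_not] at hl
      exact hl.2 hl.1
    rw [eq_zero_of_not_subset hP hα hs hc fun h => Finset.notMem_erase l _ (h hlF), smul_zero,
      smul_zero, map_zero, Pi.zero_apply]
  · intro l hl
    rw [Finset.mem_sdiff] at hl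
    have hsub : degSupp α ⊆ (supp x z).erase l := fun j hj =>
      Finset.mem_erase.2 ⟨fun h => hl.2 (h ▸ hj), hz hj⟩
    have hexp : cellExp α s (supp x z) =
        cellExp α s ((supp x z).erase l) + Finsupp.single l s := by
      refine mdeg_injective ?_
      rw [mdeg_add, mdeg_cellExp hα hs hz, mdeg_cellExp hα hs hsub, add_assoc]
      congr 1
      conv_lhs => rw [← Finset.insert_erase hl.1]
      rw [sDeg_insert s (Finset.notMem_erase _ _)]
      congr 1
      ext j
      by_cases h : j = l
      · subst h
        simp [mdeg]
      · simp [mdeg, h]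
    have hmon : varPow k n s l = MvPolynomial.monomial (Finsupp.single l s) 1 := by
      rw [varPow, MvPolynomial.X_pow_eq_monomial]
    have hopp := supp_oppositeFace (x := x) hP z l
    rw [map_zsmul, Pi.smul_apply, zsmul_eq_mul, cochainCoeff, hopp, hexp, hmon,
      faceCoeff_monomial_smul x hP (oppositeFace_le hP z l), one_mul]
    · rw [support_cellExp hs hsub, hopp]
    · exact Finsupp.support_single_subset.trans (Finset.singleton_subset_iff.2 hl.1)

variable (O : ∀ w : P, VertexOrientation (Link w))

open Classical in
/-- The function on the faces of `P` obtained from functions on the links of the faces with a given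
support. -/
def glue (F : Finset (Fin n)) : ((w : {w : P // supp x w = F}) → Link w.1 → k) →ₗ[k] (P → k) where
  toFun f y := if h : ∃ w : {w : P // supp x w = F}, w.1 ≤ y then
    (linkSign x (O h.choose.1) ⟨y, h.choose_spec⟩ : k) * f h.choose ⟨y, h.choose_spec⟩ else 0
  map_add' f g := by
    ext y
    simp only [Pi.add_apply]
    split_ifs
    · rw [mul_add]
    · rw [add_zero]
  map_smul' a f := by
    ext y
    simp only [Pi.smul_apply, smul_eq_mul, RingHom.id_apply]
    split_ifs
    · rw [mul_left_comm]
    · rw [mul_zero]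

/-- Below `y` there is only one face with support `F`, so the choice in `glue` is irrelevant. -/
lemma glue_apply (hP : IsSimplicial P) {F : Finset (Fin n)}
    (f : (w : {w : P // supp x w = F}) → Link w.1 → k) (w : {w : P // supp x w = F})
    (y : Link w.1) : glue O F f y.1 = (linkSign x (O w.1) y : k) * f w y := by
  have h : ∃ w : {w : P // supp x w = F}, w.1 ≤ y.1 := ⟨w, y.2⟩
  have key : ∀ (w' : {w : P // supp x w = F}) (h' : w'.1 ≤ y.1),
      (linkSign x (O w'.1) ⟨y.1, h'⟩ : k) * f w' ⟨y.1, h'⟩ =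
        (linkSign x (O w.1) y : k) * f w y := by
    intro w' h'
    obtain rfl : w' = w :=
      Subtype.ext (eq_of_supp_eq (x := x) hP h' y.2 (w'.2.trans w.2.symm))
    rfl
  rw [← key h.choose h.choose_spec]
  exact dif_pos h

lemma exists_link (hP : IsSimplicial P) {F : Finset (Fin n)} {y : P} (hy : F ⊆ supp x y) :
    ∃ w : {w : P // supp x w = F}, w.1 ≤ y := by
  obtain ⟨w, hwy, hw⟩ := exists_supp_eq hP hy
  exact ⟨⟨w, hw⟩, hwy⟩

/-- Opposite faces for labels outside `F` remain above the same `w`, so there is no interaction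
between links; `linkSign` turns the signs of the orientation into Koszul signs. -/
lemma glue_coboundary (hP : IsSimplicial P) {F : Finset (Fin n)}
    (f : (w : {w : P // supp x w = F}) → Link w.1 → k) {z : P} (hz : F ⊆ supp x z) :
    glue O F (fun w => coboundary k (O w.1) (f w)) z = ∑ l ∈ supp x z \ F,
      (kSign l ((supp x z).erase l) : k) * glue O F f (oppositeFace hP x z l) := by
  classical
  obtain ⟨w, hwz⟩ := exists_link hP hz
  obtain ⟨z, rfl⟩ : ∃ z' : Link w.1, z'.1 = z := ⟨⟨z, hwz⟩, rfl⟩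
  have hT : supp x z.1 \ F = supp x z.1 \ supp x w.1 := by rw [w.2]
  rw [hT]
  rw [glue_apply O hP, coboundary_apply (x := x) k hP (O w.1) (f w) z
    (fun l => (linkSign x (O w.1) z : k) * ((kSign l ((supp x z.1).erase l) : k) *
      glue O F f (oppositeFace hP x z.1 l))), Finset.mul_sum]
  · refine Finset.sum_congr rfl fun l _ => ?_
    rw [← mul_assoc, ← Int.cast_mul, linkSign_mul_self, Int.cast_one, one_mul]
  · intro l hl a y ha hal hy
    rw [← hy, glue_apply O hP, linkSign_oppositeFace hP hl hy ha hal]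
    push_cast
    -- The Koszul sign and the sign of `y` both occur squared and cancel, leaving the sign of the
    -- orientation.
    have h1 : (kSign l ((supp x z.1).erase l) : k) * kSign l ((supp x z.1).erase l) = 1 := by
      rw [← Int.cast_mul, kSign_mul_self, Int.cast_one]
    have h2 : (linkSign x (O w.1) y : k) * linkSign x (O w.1) y = 1 := by
      rw [← Int.cast_mul, linkSign_mul_self, Int.cast_one]
    linear_combination (-((-1) ^ Set.ncard {b : Vertex (Link w.1) | b.1 ≤ y ∧ (O w.1).lt a b} *
      f w y)) * (h1 + (kSign l ((supp x z.1).erase l) : k) * kSign l ((supp x z.1).erase l) * (h2))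

variable (α s) in
open Classical in
/-- The homogeneous Koszul cochain with given coefficients. -/
def cochainOf (f : P → k) (σ : Finset (Fin n)) : FaceModule k x :=
  if degSupp α ⊆ σ then standardElt x (cellExp α s σ) f else 0

lemma cochainOf_add (f g : P → k) :
    cochainOf (x := x) α s (f + g) = cochainOf α s f + cochainOf α s g := by
  ext σ
  simp only [cochainOf, Pi.add_apply]
  split_ifs
  · rw [map_add]
  · rw [add_zero]

lemma standardElt_smul (m : Fin n →₀ ℕ) (a : k) (f : P → k) :
    standardElt x m (a • f) = (MvPolynomial.C a : MvPolynomial (Fin n) k) • standardElt x m f := by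
  rw [standardElt_apply, standardElt_apply, Finset.smul_sum]
  refine Finset.sum_congr rfl fun y _ => ?_
  rw [smul_smul, MvPolynomial.C_mul_monomial, Pi.smul_apply, smul_eq_mul]

lemma cochainOf_smul (a : k) (f : P → k) :
    cochainOf (x := x) α s (a • f) =
      (MvPolynomial.C a : MvPolynomial (Fin n) k) • cochainOf (x := x) α s f := by
  ext σ
  simp only [cochainOf, Pi.smul_apply]
  split_ifs
  · rw [standardElt_smul]
  · rw [smul_zero]

lemma cochainOf_isHomogeneous (hα : ∀ j, α j ≤ 0) (hs : ∀ j, 1 ≤ α j + s) (f : P → k) :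
    IsHomogeneousCochain (faceGrading k x) s α (cochainOf α s f) := by
  intro σ
  rw [cochainOf]
  split_ifs with h
  · rw [← mdeg_cellExp hα hs h]
    exact standardElt_mem x _ _
  · exact zero_mem _

lemma cochainCoeff_cochainOf (hP : IsSimplicial P) (hs : ∀ j, 1 ≤ α j + s) (f : P → k) {y : P}
    (hy : degSupp α ⊆ supp x y) : cochainCoeff α s hP (cochainOf (x := x) α s f) y = f y := by
  rw [cochainCoeff, cochainOf, if_pos hy,
    faceCoeff_standardElt x hP _ (support_cellExp hs hy).symm]

lemma cochainOf_eq_zero {f : P → k} {σ : Finset (Fin n)} (hs : ∀ j, 1 ≤ α j + s)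
    (h : degSupp α ⊆ σ → ∀ y, supp x y = σ → f y = 0) : cochainOf (x := x) α s f σ = 0 := by
  rw [cochainOf]
  split_ifs with hσ
  · rw [standardElt_apply]
    refine Finset.sum_eq_zero fun y hy => ?_
    rw [Set.Finite.mem_toFinset, Set.mem_ofPred_eq, support_cellExp hs hσ] at hy
    rw [h hσ y hy, map_zero, zero_smul]
  · rfl

end Cochains

/-! ### The isomorphism with the cohomology of the links. -/

section Comparison

variable {k : Type u} [Field k] {P : Type u} [PartialOrder P] [OrderBot P] [Finite P] {n : ℕ}
  {x : Fin n ≃ Vertex P} {α : Fin n → ℤ} {s : ℕ}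

lemma mem_cochains_iff {Q : Type u} [PartialOrder Q] [OrderBot Q] [Finite Q] {d : ℤ} {f : Q → k} :
    f ∈ cochains k Q d ↔ ∀ y, (rk y : ℤ) ≠ d + 1 → f y = 0 := by
  classical
  have := Fintype.ofFinite Q
  constructor
  · intro hf y hy
    induction hf using Submodule.span_induction with
    | mem f hf =>
      obtain ⟨y', hy', rfl⟩ := hf
      rw [Pi.basisFun_apply, Pi.single_eq_of_ne]
      rintro rfl
      exact hy hy'
    | zero => rfl
    | add f g _ _ hf hg => rw [Pi.add_apply, hf, hg, add_zero]
    | smul a f _ hf => rw [Pi.smul_apply, hf, smul_zero]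
  · intro hf
    rw [← (Pi.basisFun k Q).sum_repr f]
    refine Submodule.sum_mem _ fun y _ => ?_
    by_cases hy : (rk y : ℤ) = d + 1
    · exact Submodule.smul_mem _ _ (Submodule.subset_span ⟨y, hy, rfl⟩)
    · rw [Pi.basisFun_repr, hf y hy, zero_smul]
      exact zero_mem _

/-- The first isomorphism theorem, for a target that is only known to be an additive monoid. -/
def quotKerEquivRange' {Z N : Type*} [AddCommGroup Z] [Module k Z] [AddCommMonoid N] [Module k N]
    (f : Z →ₗ[k] N) : (Z ⧸ LinearMap.ker f) ≃ₗ[k] LinearMap.range f :=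
  letI : AddCommGroup N := Module.addCommMonoidToAddCommGroup k
  f.quotKerEquivRange

variable (O : ∀ w : P, VertexOrientation (Link w))

lemma koszulδ_cochainOf_glue (hP : IsSimplicial P) (hα : ∀ j, α j ≤ 0) (hs : ∀ j, 1 ≤ α j + s)
    (f : (w : {w : P // supp x w = degSupp α}) → Link w.1 → k) :
    koszulδ _ (varPow k n s) (cochainOf (x := x) α s (glue O (degSupp α) f)) =
      cochainOf α s (glue O (degSupp α) fun w => coboundary k (O w.1) (f w)) := by
  have hc := cochainOf_isHomogeneous (x := x) hα hs (glue O (degSupp α) f)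
  refine eq_of_cochainCoeff_eq hP hα hs (hc.koszulδ (faceGrading_isMultigrading x hP))
    (cochainOf_isHomogeneous hα hs _) fun z hz => ?_
  rw [cochainCoeff_koszulδ hP hα hs hc hz, cochainCoeff_cochainOf hP hs _ hz,
    glue_coboundary O hP f hz]
  refine Finset.sum_congr rfl fun l hl => ?_
  rw [cochainCoeff_cochainOf hP hs]
  rw [supp_oppositeFace]
  exact fun j hj => Finset.mem_erase.2 ⟨fun h => (Finset.mem_sdiff.1 hl).2 (h ▸ hj), hz hj⟩

lemma cochainOf_glue_injective (hP : IsSimplicial P) (hs : ∀ j, 1 ≤ α j + s)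
    {f g : (w : {w : P // supp x w = degSupp α}) → Link w.1 → k}
    (h : cochainOf (x := x) α s (glue O (degSupp α) f) = cochainOf α s (glue O (degSupp α) g)) :
    f = g := by
  ext w y
  have hy : degSupp α ⊆ supp x y.1 := w.2.ge.trans (supp_mono x y.2)
  have h1 := congrArg (fun c => cochainCoeff α s hP c y.1) h
  simp only [cochainCoeff_cochainOf hP hs _ hy] at h1
  rw [glue_apply O hP, glue_apply O hP] at h1
  have h2 : (linkSign x (O w.1) y : k) * linkSign x (O w.1) y = 1 := by
    rw [← Int.cast_mul, linkSign_mul_self, Int.cast_one]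
  exact mul_left_cancel₀ (left_ne_zero_of_mul_eq_one h2) h1

lemma cochainOf_glue_eq_zero (hP : IsSimplicial P) (hs : ∀ j, 1 ≤ α j + s) {e : ℤ}
    {f : (w : {w : P // supp x w = degSupp α}) → Link w.1 → k}
    (hf : ∀ w, f w ∈ cochains k (Link w.1) (e - (degSupp α).card - 1)) {σ : Finset (Fin n)}
    (hσ : (σ.card : ℤ) ≠ e) : cochainOf (x := x) α s (glue O (degSupp α) f) σ = 0 := by
  refine cochainOf_eq_zero hs fun hF y hy => ?_
  subst hy
  obtain ⟨w, hw⟩ := exists_link hP hF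
  rw [glue_apply O hP f w ⟨y, hw⟩, mem_cochains_iff.1 (hf w), mul_zero]
  rw [link_rk hP x, w.2]
  intro h
  exact hσ (by linarith)

/-- The signs square to one, so multiplying the coefficients by `linkSign` inverts the gluing. -/
lemma exists_cochainOf_glue (hP : IsSimplicial P) (hα : ∀ j, α j ≤ 0) (hs : ∀ j, 1 ≤ α j + s)
    {c : Finset (Fin n) → FaceModule k x} (hc : IsHomogeneousCochain (faceGrading k x) s α c)
    {e : ℤ} (he : ∀ σ : Finset (Fin n), (σ.card : ℤ) ≠ e → c σ = 0) :
    ∃ f : (w : {w : P // supp x w = degSupp α}) → Link w.1 → k,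
      (∀ w, f w ∈ cochains k (Link w.1) (e - (degSupp α).card - 1)) ∧
      cochainOf α s (glue O (degSupp α) f) = c := by
  refine ⟨fun w y => (linkSign x (O w.1) y : k) * cochainCoeff α s hP c y.1, fun w => ?_, ?_⟩
  · refine mem_cochains_iff.2 fun y hy => ?_
    have h0 : c (supp x y.1) = 0 := he _ fun h => by
      rw [link_rk hP x, w.2] at hy
      exact hy (by linarith)
    change _ * faceCoeff x hP _ (c (supp x y.1)) y.1 = 0
    rw [h0, map_zero, Pi.zero_apply, mul_zero]
  · refine eq_of_cochainCoeff_eq hP hα hs (cochainOf_isHomogeneous hα hs _) hc fun y hy => ?_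
    obtain ⟨w, hw⟩ := exists_link hP hy
    rw [cochainCoeff_cochainOf hP hs _ hy, glue_apply O hP _ w ⟨y, hw⟩, ← mul_assoc,
      ← Int.cast_mul, linkSign_mul_self, Int.cast_one, one_mul]

variable (x α) in
/-- The families of cocycles of the links of the faces with support `degSupp α`. -/
abbrev LinkCocycles (d : ℤ) : Type u :=
  (w : {w : P // supp x w = degSupp α}) → cocycles k (O w.1) d

variable (s) in
/-- The Koszul cochain given by a family of cocycles of links. -/
def linkCochain {d : ℤ} (f : LinkCocycles (k := k) x α O d) : Finset (Fin n) → FaceModule k x :=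
  cochainOf α s (glue O (degSupp α) fun w => (f w).1)

lemma linkCochain_mem (hP : IsSimplicial P) (hα : ∀ j, α j ≤ 0) (hs : ∀ j, 1 ≤ α j + s) {i : ℕ}
    (f : LinkCocycles (k := k) x α O ((i : ℤ) - (degSupp α).card - 1)) :
    linkCochain s O f ∈ koszulCocycles k n (FaceModule k x) s i := by
  refine ⟨fun σ hσ => cochainOf_glue_eq_zero O hP hs (fun w => (f w).2.1) (by exact_mod_cast hσ),
    LinearMap.mem_ker.2 ?_⟩
  rw [linkCochain, koszulδ_cochainOf_glue O hP hα hs]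
  have : (fun w => coboundary k (O w.1) (f w).1) =
      (0 : (w : {w : P // supp x w = degSupp α}) → Link w.1 → k) :=
    funext fun w => LinearMap.mem_ker.1 (f w).2.2
  rw [this, map_zero]
  exact funext fun σ => cochainOf_eq_zero hs fun _ _ _ => rfl

/-- The local cohomology class given by a family of cocycles of links. -/
def linkClass (hP : IsSimplicial P) (hα : ∀ j, α j ≤ 0) (hs : ∀ j, 1 ≤ α j + s) (i : ℕ) :
    LinkCocycles (k := k) x α O ((i : ℤ) - (degSupp α).card - 1) →ₗ[k]
      RestrictScalars k (MvPolynomial (Fin n) k)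
        (LocalCohomology (k := k) (n := n) (FaceModule k x) i) where
  toFun f := (RestrictScalars.addEquiv k (MvPolynomial (Fin n) k) _).symm
    (koszulClass s i ⟨linkCochain s O f, linkCochain_mem O hP hα hs f⟩)
  map_add' f g := by
    rw [← map_add, ← map_add]
    congr 2
    refine Subtype.ext ?_
    change linkCochain s O (f + g) = linkCochain s O f + linkCochain s O g
    rw [linkCochain, linkCochain, linkCochain, ← cochainOf_add, ← map_add]
    rfl
  map_smul' a f := by
    have h : (⟨linkCochain s O (a • f), linkCochain_mem O hP hα hs (a • f)⟩ :
        koszulCocycles k n (FaceModule k x) s i) =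
        (MvPolynomial.C a : MvPolynomial (Fin n) k) •
          ⟨linkCochain s O f, linkCochain_mem O hP hα hs f⟩ := by
      refine Subtype.ext ?_
      change linkCochain s O (a • f) =
        (MvPolynomial.C a : MvPolynomial (Fin n) k) • linkCochain s O f
      rw [linkCochain, linkCochain, ← cochainOf_smul, ← map_smul]
      rfl
    rw [h, map_smul]
    exact RestrictScalars.addEquiv_symm_map_algebraMap_smul _ _ _ _ _

lemma linkClass_apply (hP : IsSimplicial P) (hα : ∀ j, α j ≤ 0) (hs : ∀ j, 1 ≤ α j + s) (i : ℕ)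
    (f : LinkCocycles (k := k) x α O ((i : ℤ) - (degSupp α).card - 1)) :
    linkClass O hP hα hs i f = (RestrictScalars.addEquiv k (MvPolynomial (Fin n) k) _).symm
      (koszulClass s i ⟨linkCochain s O f, linkCochain_mem O hP hα hs f⟩) := rfl

/-- A homogeneous Koszul cocycle comes from a unique family of functions on the links, and
injectivity of the gluing turns the cocycle condition into one on each link. -/
lemma range_linkClass (hP : IsSimplicial P) (hα : ∀ j, α j ≤ 0) (hs : ∀ j, 1 ≤ α j + s) (i : ℕ) :
    LinearMap.range (linkClass (k := k) (x := x) O hP hα hs i) =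
      localCohomologyPiece k (FaceModule k x) (faceGrading k x) i α := by
  ext h
  rw [mem_localCohomologyPiece_iff (faceGrading_isMultigrading x hP)
    (faceGrading_isStableDegree x hP hs)]
  constructor
  · rintro ⟨f, rfl⟩
    exact ⟨_, linkCochain_mem O hP hα hs f, cochainOf_isHomogeneous hα hs _, rfl⟩
  · rintro ⟨c, hcc, hc, rfl⟩
    obtain ⟨f, hf, hfc⟩ := exists_cochainOf_glue O hP hα hs hc (e := i)
      fun σ hσ => hcc.1 σ (by exact_mod_cast hσ)
    have hker : (fun w => coboundary k (O w.1) (f w)) = 0 := by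
      refine cochainOf_glue_injective O hP hs ?_
      rw [← koszulδ_cochainOf_glue O hP hα hs, hfc, LinearMap.mem_ker.1 hcc.2, map_zero]
      exact (funext fun σ => cochainOf_eq_zero hs fun _ _ _ => rfl).symm
    refine ⟨fun w => ⟨f w, hf w, LinearMap.mem_ker.2 (congrFun hker w)⟩, ?_⟩
    rw [linkClass_apply]
    congr 2
    exact Subtype.ext hfc

lemma ker_linkClass (hP : IsSimplicial P) (hα : ∀ j, α j ≤ 0) (hs : ∀ j, 1 ≤ α j + s) (i : ℕ) :
    LinearMap.ker (linkClass (k := k) (x := x) O hP hα hs i) =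
      Submodule.pi Set.univ fun w : {w : P // supp x w = degSupp α} =>
        (coboundaries k (O w.1) ((i : ℤ) - (degSupp α).card - 1)).submoduleOf
          (cocycles k (O w.1) ((i : ℤ) - (degSupp α).card - 1)) := by
  ext f
  rw [LinearMap.mem_ker, linkClass_apply, EmbeddingLike.map_eq_zero_iff,
    koszulClass_eq_zero_iff (faceGrading_isMultigrading x hP)
      (faceGrading_isStableDegree x hP hs) (linkCochain_mem O hP hα hs f)
      (cochainOf_isHomogeneous hα hs _), Submodule.mem_pi]
  have hdeg : ((i : ℤ) - 1) - (degSupp α).card - 1 = (i : ℤ) - (degSupp α).card - 1 - 1 := by ring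
  constructor
  · rintro ⟨b, hb0, hb, hbf⟩ w -
    -- The degree `i - 1` is taken in the integers to include `i = 0`, where no set has cardinality
    -- `-1` and the primitive is zero.
    obtain ⟨g, hg, rfl⟩ := exists_cochainOf_glue O hP hα hs hb (e := (i : ℤ) - 1)
      fun σ hσ => hb0 σ (by omega)
    rw [koszulδ_cochainOf_glue O hP hα hs] at hbf
    have := congrFun (cochainOf_glue_injective O hP hs hbf) w
    exact ⟨g w, hdeg ▸ hg w, this⟩
  · intro hf
    choose g hg hgf using fun w => hf w (Set.mem_univ w)
    refine ⟨cochainOf α s (glue O (degSupp α) g), fun σ hσ => ?_,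
      cochainOf_isHomogeneous hα hs _, ?_⟩
    · exact cochainOf_glue_eq_zero O hP hs (e := (i : ℤ) - 1) (fun w => hdeg ▸ hg w) (by omega)
    · rw [koszulδ_cochainOf_glue O hP hα hs]
      exact congrArg (fun h => cochainOf α s (glue O (degSupp α) h)) (funext hgf)

lemma nonempty_localCohomologyPiece_equiv (hP : IsSimplicial P) (hα : ∀ j, α j ≤ 0)
    (hs : ∀ j, 1 ≤ α j + s) (i : ℕ) :
    Nonempty (localCohomologyPiece k (FaceModule k x) (faceGrading k x) i α ≃ₗ[k]
      ⨁ w : {w : P // supp x w = degSupp α},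
        ReducedCohomology k (O w.1) ((i : ℤ) - ((degSupp α).card : ℤ) - 1)) := by
  classical
  have := Fintype.ofFinite {w : P // supp x w = degSupp α}
  exact ⟨(LinearEquiv.ofEq _ _ (range_linkClass O hP hα hs i).symm).trans <|
    (quotKerEquivRange' (linkClass O hP hα hs i)).symm.trans <|
    (Submodule.quotEquivOfEq _ _ (ker_linkClass O hP hα hs i)).trans <|
    (Submodule.quotientPi _).trans (DirectSum.linearEquivFunOnFintype k _ _).symm⟩

lemma exists_stable_bound (α : Fin n → ℤ) : ∃ s : ℕ, ∀ j, 1 ≤ α j + s := by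
  -- The sum of the absolute values exceeds every `-α j`, and the extra `1` makes the exponents
  -- positive.
  refine ⟨1 + ∑ j, (α j).natAbs, fun j => ?_⟩
  have := Finset.single_le_sum (f := fun j => (α j).natAbs) (fun _ _ => Nat.zero_le _)
    (Finset.mem_univ j)
  omega

end Comparison

end SimplicialPoset

end

theorem theorem4p1 {k : Type u} [Field k] {P : Type u} [PartialOrder P] [OrderBot P] [Finite P]
    (hP : SimplicialPoset.IsSimplicial P) {n : ℕ} (x : Fin n ≃ SimplicialPoset.Vertex P)
    (O : ∀ w : P, SimplicialPoset.VertexOrientation (SimplicialPoset.Link w))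
    (i : ℕ) (α : Fin n → ℤ) :
    ((∀ j, α j ≤ 0) →
      Nonempty
        (SimplicialPoset.localCohomologyPiece k (SimplicialPoset.FaceModule k x)
            (SimplicialPoset.faceGrading k x) i α ≃ₗ[k]
          ⨁ w : {w : P // SimplicialPoset.supp x w = SimplicialPoset.degSupp α},
            SimplicialPoset.ReducedCohomology k (O w.1)
              ((i : ℤ) - ((SimplicialPoset.degSupp α).card : ℤ) - 1))) ∧
    ((¬ ∀ j, α j ≤ 0) →
      SimplicialPoset.localCohomologyPiece k (SimplicialPoset.FaceModule k x)
        (SimplicialPoset.faceGrading k x) i α = ⊥) := by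
  obtain ⟨s, hs⟩ := SimplicialPoset.exists_stable_bound α
  refine ⟨fun hα => SimplicialPoset.nonempty_localCohomologyPiece_equiv O hP hα hs i,
    fun hα => ?_⟩
  push Not at hα
  obtain ⟨j, hj⟩ := hα
  exact SimplicialPoset.localCohomologyPiece_eq_bot
    (SimplicialPoset.faceGrading_isMultigrading x hP)
    (SimplicialPoset.faceGrading_isStableDegree x hP hs)
    fun σ hσ => SimplicialPoset.varPow_smul_bijOn x hP hj s hσ
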